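/- **Setting.** Let $N\ge 1$ be an integer and $b\in\mathbb C$ with $|b|=1$, $\mathrm{Re}\,b>0$, $\mathrm{Im}\,b>0$. Put $\boldsymbol q=\exp[\frac{\pi i}{N}(b^2+1)]$, $\tilde{\boldsymbol q}=\exp[\frac{\pi i}{N}(b^{-2}+1)]$. On $\mathcal H=L^2(\mathbb R)\otimes\mathbb C^N$, realized as functions $f(\mu,m)$ with $\mu\in\mathbb R$, $m\in\mathbb Z/N$, let $\boldsymbol y,\tilde{\boldsymbol y}$ be the (unbounded, normal) operators of multiplication by $\exp[\frac{2\pi i}{N}(-ib\mu-m)]$ and $\exp[\frac{2\pi i}{N}(-ib^{-1}\mu+m)]$. Let $\boldsymbol u,\tilde{\boldsymbol u}$ be the normal operators that multiply the Fourier transform $\tilde f(\nu,n)=\frac1N\sum_m\int d\mu\, e^{\frac{2\pi i}{N}(\mu\nu-mn)}f(\mu,m)$ by $u=\exp[\frac{2\pi i}{N}(-ib\nu-n)]$ and $\tilde u=\exp[\frac{2\pi i}{N}(-ib^{-1}\nu+n)]$, i.e. $\boldsymbol uf(\mu,m)=f(\mu+ib,m-1)$, $\tilde{\boldsymbol u}f(\mu,m)=f(\mu+ib^{-1},m+1)$.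 Let $\mathfrak D\subset\mathcal H$ be the common domain of all Laurent polynomials in $\boldsymbol u,\boldsymbol y,\tilde{\boldsymbol u},\tilde{\boldsymbol y}$ (the largest subspace on which the integer powers of these operators are defined and which they map to itself). Write $e^{\alpha\boldsymbol U+\beta\boldsymbol Y+c}=e^c\boldsymbol q^{-\alpha\beta}\boldsymbol u^\alpha\boldsymbol y^\beta$ for $\alpha,\beta\in\mathbb Z$, $c\in\mathbb C$. For $L_1,\dots,L_4\in\mathbb C$, $\lambda_a=e^{L_a}$, let $$\boldsymbol Z_1=-\boldsymbol U,\quad \boldsymbol Z_2=-2L_3+\boldsymbol Y+i\pi,\quad \boldsymbol Z_3=L_1-L_2+L_3+L_4+\boldsymbol U+2\pi i,$$ $$\boldsymbol Z_4=-L_1+L_2+L_3+L_4-\boldsymbol Y+i\pi,\quad \boldsymbol Z_5=-\boldsymbol Y+i\pi,\quad \boldsymbol Z_6=-L_1-L_2-L_3-L_4+\boldsymbol Y+i\pi,$$ and $\boldsymbol z_a=e^{\boldsymbol Z_a}$; these are the quantum Fock-Goncharov operators for the ideal triangulation $\mathcal T$ of the 4-holed sphere with oriented triangles (edges in counterclockwise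 order) $(3,6,4),(3,2,5),(1,4,6),(1,5,2)$. Flipping the edge $3$ gives the tetrahedral triangulation $\mathcal T'$ with oriented triangles $(4,2,3),(5,6,3),(1,4,6),(1,5,2)$. Let $\varepsilon_{ab}$, $\varepsilon'_{ab}$ be the numbers of oriented triangles of $\mathcal T$, $\mathcal T'$ shared by the edges $a,b$, where a triangle counts $+1$ ($-1$) if $a$ rotates to $b$ counterclockwise (clockwise) in it. Put $$i_3(\boldsymbol Z_3)=-\boldsymbol Z_3+2\pi i,\qquad i_3(\boldsymbol Z_a)=\boldsymbol Z_a+\max(\varepsilon_{a3},0)(\boldsymbol Z_3-i\pi)\ (a\ne3),\qquad i_3(\boldsymbol z_a)=e^{i_3(\boldsymbol Z_a)}.$$ The tilded operators $\tilde{\boldsymbol z}_a$, $i_3(\tilde{\boldsymbol z}_a)$ are defined by the same formulas with $\boldsymbol u,\boldsymbol y,\boldsymbol q,L_a$ replaced by $\tilde{\boldsymbol u},\tilde{\boldsymbol y},\tilde{\boldsymbol q},\tilde L_a=\overline{L_a}$. Finally let $$\varphi(y,\tilde y)=\Big[\prod_{j\ge0}(1+\boldsymbol q^{2j+1}y)\Big/\prod_{j\ge0}(1+\tilde{\boldsymbol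 q}^{-2j-1}\tilde y)\Big]^{-1}$$ be the quantum dilogarithm, and let $V=\varphi(-\boldsymbol z_3,-\tilde{\boldsymbol z}_3)$ be the operator that multiplies $\tilde f(\nu,n)$ by $\varphi\big(-\frac{\lambda_1\lambda_3\lambda_4}{\lambda_2}u,-\frac{\tilde\lambda_1\tilde\lambda_3\tilde\lambda_4}{\tilde\lambda_2}\tilde u\big)$, where $\tilde\lambda_a=\overline{\lambda_a}$. **Claim.** $\mathfrak D$ is dense in $\mathcal H$, and $V$ is a unitary operator. Let $$\boldsymbol z'_a=V\,i_3(\boldsymbol z_a)\,V^{-1},\qquad \tilde{\boldsymbol z}'_a=V\,i_3(\tilde{\boldsymbol z}_a)\,V^{-1}\qquad(a=1,\dots,6).$$ 1. *(Quantum torus relations of $\mathcal T'$.)* The operators $\boldsymbol z'_a,\tilde{\boldsymbol z}'_a$ are injective; they and their inverses are defined on $V\mathfrak D$ and map it to itself. On $V\mathfrak D$, for all $a,c$, $$\boldsymbol z'_a\boldsymbol z'_c=\boldsymbol q^{2\varepsilon'_{ac}}\boldsymbol z'_c\boldsymbol z'_a,\qquad \tilde{\boldsymbol z}'_a\tilde{\boldsymbol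 z}'_c=\tilde{\boldsymbol q}^{2\varepsilon'_{ac}}\tilde{\boldsymbol z}'_c\tilde{\boldsymbol z}'_a,\qquad \boldsymbol z'_a\tilde{\boldsymbol z}'_c=\tilde{\boldsymbol z}'_c\boldsymbol z'_a .$$ 2. *(Explicit form.)* $\boldsymbol z'_1=\boldsymbol z_1$ and $\boldsymbol z'_3=\boldsymbol z_3^{-1}$ as operators with their domains, and the $\boldsymbol z_a$ restrict to bijections of $\mathfrak D$. If moreover $\frac{\lambda_1\lambda_3\lambda_4}{\lambda_2}=\exp[\frac{2\pi i}{N}(-ib\mu_0-m_0)]$ for some $\mu_0\in\mathbb R$, $m_0\in\mathbb Z$, then $\mathfrak D$ is contained in the domains of $\boldsymbol z'_2,\boldsymbol z'_4{}^{-1},\boldsymbol z'_5{}^{-1},\boldsymbol z'_6$, and on $\mathfrak D$ $$\boldsymbol z'_2=\boldsymbol z_2(1-\boldsymbol q\boldsymbol z_3),\qquad \boldsymbol z'_4{}^{-1}=(1-\boldsymbol q\boldsymbol z_3^{-1})\boldsymbol z_4^{-1},$$ $$\boldsymbol z'_6=\boldsymbol z_6(1-\boldsymbol q\boldsymbol z_3),\qquad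 \boldsymbol z'_5{}^{-1}=(1-\boldsymbol q\boldsymbol z_3^{-1})\boldsymbol z_5^{-1}.$$ The same holds for the tilded operators, with $\tilde{\boldsymbol q}$ in place of $\boldsymbol q$. 3. *(Classical limit.)* As $N\to\infty$ with $b$ fixed, $\boldsymbol q\to1$ and $\tilde{\boldsymbol q}\to1$. For commuting non-zero numbers $z_1,\dots,z_6$ with $z_3\ne1$, the expressions for $z'_1,\dots,z'_6$ determined by the formulas in 2, with coefficient $\boldsymbol q$ or with coefficient $\tilde{\boldsymbol q}$, converge to the classical cluster transformation $$z'_1=z_1,\quad z'_3=z_3^{-1},\quad z'_2=z_2(1-z_3),\quad z'_6=z_6(1-z_3),\quad z'_4{}^{-1}=(1-z_3^{-1})z_4^{-1},\quad z'_5{}^{-1}=(1-z_3^{-1})z_5^{-1}.$$ -/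

import Mathlib

open MeasureTheory Filter Topology Complex

noncomputable section

namespace FlipQuantization

/-! ### The two ideal triangulations of the 4-holed sphere

Edge `a ∈ {1, …, 6}` is the element `a - 1` of `Fin 6`. An oriented triangle is the triple of its
edges, listed in the cyclic order in which they rotate counterclockwise into each other. -/

/-- Contribution of one oriented triangle to `ε x y`: it is `+1` (`-1`) if `x` rotates to `y`
counterclockwise (clockwise) in the triangle. -/
def triangleSign (t : Fin 6 × Fin 6 × Fin 6) (x y : Fin 6) : ℤ :=
  (if (x, y) = (t.1, t.2.1) ∨ (x, y) = (t.2.1, t.2.2) ∨ (x, y) = (t.2.2, t.1) then 1 else 0) -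
  (if (y, x) = (t.1, t.2.1) ∨ (y, x) = (t.2.1, t.2.2) ∨ (y, x) = (t.2.2, t.1) then 1 else 0)

/-- The exchange matrix `ε` of a triangulation. -/
def exchange (T : List (Fin 6 × Fin 6 × Fin 6)) (x y : Fin 6) : ℤ :=
  (T.map fun t => triangleSign t x y).sum

/-- The two triangles on both sides of the diagonal `e` of a quadrilateral with the sides
`x, y, z, w` in counterclockwise order. -/
def halves (e x y z w : Fin 6) : List (Fin 6 × Fin 6 × Fin 6) := [(e, x, y), (e, z, w)]

/-- The two triangles of the same quadrilateral on both sides of the other diagonal, again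
called `e`: the result of flipping the edge `e`. -/
def flippedHalves (e x y z w : Fin 6) : List (Fin 6 × Fin 6 × Fin 6) := [(y, z, e), (w, x, e)]

/-- The triangulation `T`: the edge `3` is the diagonal of the quadrilateral with the sides
`6, 4, 2, 5`, and the other two triangles are `(1, 4, 6)` and `(1, 5, 2)`. -/
def triT : List (Fin 6 × Fin 6 × Fin 6) := halves 2 5 3 1 4 ++ [(0, 3, 5), (0, 4, 1)]

/-- The tetrahedral triangulation `T'`, obtained from `T` by flipping the edge `3`. -/
def triT' : List (Fin 6 × Fin 6 × Fin 6) := flippedHalves 2 5 3 1 4 ++ [(0, 3, 5), (0, 4, 1)]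

def eps : Fin 6 → Fin 6 → ℤ := exchange triT
def eps' : Fin 6 → Fin 6 → ℤ := exchange triT'

theorem eps_eq : eps =
    ![![0, -1, 0, 1, 1, -1],
      ![1, 0, -1, 0, 0, 0],
      ![0, 1, 0, -1, -1, 1],
      ![-1, 0, 1, 0, 0, 0],
      ![-1, 0, 1, 0, 0, 0],
      ![1, 0, -1, 0, 0, 0]] := by
  decide

theorem eps'_eq : eps' =
    ![![0, -1, 0, 1, 1, -1],
      ![1, 0, 1, -1, -1, 0],
      ![0, -1, 0, 1, 1, -1],
      ![-1, 1, -1, 0, 0, 1],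
      ![-1, 1, -1, 0, 0, 1],
      ![1, 0, 1, -1, -1, 0]] := by
  decide

/-! ### The Hilbert space and unbounded operators on it -/

/-- The Hilbert space `L²(ℝ) ⊗ ℂ^N` of functions `f(μ, m)`, `μ ∈ ℝ`, `m ∈ ℤ/N`. -/
abbrev Hil (N : ℕ) : Type := PiLp 2 (fun _ : ZMod N => Lp ℂ 2 (volume : Measure ℝ))

/-- A partially defined operator on the Hilbert space. -/
abbrev Op (N : ℕ) : Type := Hil N →ₗ.[ℂ] Hil N

variable {N : ℕ}

/-- The graph `{(f, g) | g(μ, m) = s(μ, m) f(μ, m)}`. -/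
def mulGraph (s : ℝ → ZMod N → ℂ) : Submodule ℂ (Hil N × Hil N) where
  carrier := {p | ∀ m, p.2 m =ᵐ[volume] fun μ => s μ m * p.1 m μ}
  add_mem' := by
    intro p r hp hr m
    filter_upwards [hp m, hr m, Lp.coeFn_add (p.1 m) (r.1 m), Lp.coeFn_add (p.2 m) (r.2 m)]
      with μ h1 h2 h3 h4
    simp only [Prod.snd_add, Prod.fst_add, PiLp.add_apply]
    rw [h3, h4, Pi.add_apply, Pi.add_apply, h1, h2, mul_add]
  zero_mem' := by
    intro m
    filter_upwards [Lp.coeFn_zero ℂ 2 (volume : Measure ℝ)] with μ h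
    simp only [Prod.snd_zero, Prod.fst_zero, PiLp.zero_apply]
    rw [h]
    simp
  smul_mem' := by
    intro c p hp m
    filter_upwards [hp m, Lp.coeFn_smul c (p.1 m), Lp.coeFn_smul c (p.2 m)] with μ h1 h2 h3
    simp only [Prod.smul_snd, Prod.smul_fst, PiLp.smul_apply]
    rw [h2, h3, Pi.smul_apply, Pi.smul_apply, h1, smul_eq_mul, smul_eq_mul]
    ring

theorem mulGraph_functional (s : ℝ → ZMod N → ℂ) (p : Hil N × Hil N) (hp : p ∈ mulGraph s)
    (h0 : p.1 = 0) : p.2 = 0 := by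
  ext1 m
  apply Lp.ext
  filter_upwards [hp m, Lp.coeFn_zero ℂ 2 (volume : Measure ℝ)] with μ h1 h2
  have e1 : p.1 m = 0 := by rw [h0]; rfl
  change (p.2 m) μ = ((0 : Lp ℂ 2 (volume : Measure ℝ)) : ℝ → ℂ) μ
  rw [h1, e1, h2]
  simp

/-- Multiplication by `s(μ, m)` with its maximal domain `{f ∈ L² | s f ∈ L²}`. -/
def mulOp (s : ℝ → ZMod N → ℂ) : Op N := (mulGraph s).toLinearPMap

theorem mulOp_graph (s : ℝ → ZMod N → ℂ) : (mulOp s).graph = mulGraph s :=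
  Submodule.toLinearPMap_graph_eq _ (mulGraph_functional s)

/-- The operator `e A e⁻¹` with the domain `e (Dom A)`. -/
def conjOp (e : Hil N ≃ₗ[ℂ] Hil N) (A : Op N) : Op N where
  domain := A.domain.comap (e.symm : Hil N →ₗ[ℂ] Hil N)
  toFun := (e : Hil N →ₗ[ℂ] Hil N) ∘ₗ A.toFun ∘ₗ
    (((e.symm : Hil N →ₗ[ℂ] Hil N) ∘ₗ Submodule.subtype _).codRestrict A.domain fun f => f.2)

/-- The product `A B` with its natural domain `{f ∈ Dom B | B f ∈ Dom A}`. -/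
def prodOp (A B : Op N) : Op N where
  domain := (A.domain.comap B.toFun).map B.domain.subtype
  toFun := A.toFun ∘ₗ
    (B.toFun ∘ₗ Submodule.inclusion (Submodule.map_subtype_le _ _)).codRestrict A.domain (by
      rintro ⟨f, h⟩
      obtain ⟨g, hg, rfl⟩ := h
      exact hg)

theorem mem_prodOp_graph {A B : Op N} {f g h : Hil N} (h1 : (f, g) ∈ B.graph)
    (h2 : (g, h) ∈ A.graph) : (f, h) ∈ (prodOp A B).graph := by
  rw [LinearPMap.mem_graph_iff] at h1 h2 ⊢
  obtain ⟨x, hx, hxg⟩ := h1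
  obtain ⟨w, hw, hwh⟩ := h2
  have hmem : B.toFun x ∈ A.domain := by
    have : B.toFun x = (w : Hil N) := hxg.trans hw.symm
    rw [this]
    exact w.2
  refine ⟨⟨f, ⟨x, hmem, hx⟩⟩, rfl, ?_⟩
  rw [← hwh]
  change A.toFun _ = A.toFun _
  congr 1
  apply Subtype.ext
  have hxx : Submodule.inclusion (Submodule.map_subtype_le B.domain (A.domain.comap B.toFun))
      ⟨f, ⟨x, hmem, hx⟩⟩ = x := Subtype.ext hx.symm
  change B.toFun (Submodule.inclusion _ ⟨f, _⟩) = (w : Hil N)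
  rw [hxx]
  exact hxg.trans hw.symm

/-- The Fourier transform in both variables, `f ↦ ∑_m ∫ e^{-2πi(ξ μ + m n / N)} f(μ, m) dμ`, as a
map to functions of `(ξ, n)`. With `ν = -N ξ` the kernel is `e^{(2πi/N)(μ ν - m n)}`. -/
def fourierHil (N : ℕ) [NeZero N] : Hil N ≃ₗ[ℂ] Hil N :=
  (WithLp.linearEquiv 2 ℂ (ZMod N → Lp ℂ 2 (volume : Measure ℝ))).trans
    ((LinearEquiv.piCongrRight fun _ : ZMod N =>
        (Lp.fourierTransformₗᵢ ℝ ℂ).toLinearEquiv).trans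
      ((ZMod.dft (N := N) (E := Lp ℂ 2 (volume : Measure ℝ))).trans
        (WithLp.linearEquiv 2 ℂ (ZMod N → Lp ℂ 2 (volume : Measure ℝ))).symm))

variable [NeZero N]

/-- The operator that multiplies the Fourier transform `f̃(ν, n)` by `s(ν, n)`, with its maximal
domain. -/
def fourierMulOp (s : ℝ → ZMod N → ℂ) : Op N :=
  conjOp (fourierHil N).symm (mulOp fun ξ n => s (-(N * ξ)) n)

/-! ### The quantum torus

All objects come in an untilded (`t = false`) and a tilded (`t = true`) version. -/

/-- `b` for the untilded and `b⁻¹` for the tilded operators. -/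
def par (b : ℂ) (t : Bool) : ℂ := if t then b⁻¹ else b

/-- `q = exp(πi (b² + 1) / N)`, `q̃ = exp(πi (b⁻² + 1) / N)`. -/
def qpar (N : ℕ) (b : ℂ) (t : Bool) : ℂ := exp (Real.pi * I / N * ((par b t) ^ 2 + 1))

/-- `exp[(2πi/N)(-i b μ - m)]`, respectively `exp[(2πi/N)(-i b⁻¹ μ + m)]`. -/
def sym (N : ℕ) (b : ℂ) (t : Bool) (μ : ℝ) (m : ZMod N) : ℂ :=
  exp (2 * Real.pi * I / N * (-I * par b t * μ + (if t then 1 else -1) * (m.val : ℂ)))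

/-- The normal operators `y^k`, respectively `ỹ^k`. -/
def yPow (N : ℕ) [NeZero N] (b : ℂ) (t : Bool) (k : ℤ) : Op N :=
  mulOp fun μ m => sym N b t μ m ^ k

/-- The normal operators `u^k`, respectively `ũ^k`; explicitly `u f(μ, m) = f(μ + i b, m - 1)` and
`ũ f(μ, m) = f(μ + i b⁻¹, m + 1)`. -/
def uPow (N : ℕ) [NeZero N] (b : ℂ) (t : Bool) (k : ℤ) : Op N :=
  fourierMulOp fun ν n => sym N b t ν n ^ k

/-- `A` is defined on all of `D` and maps it to itself. -/
def Preserves (D : Submodule ℂ (Hil N)) (A : Op N) : Prop :=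
  ∀ f ∈ D, ∃ g ∈ D, (f, g) ∈ A.graph

/-- The common domain of all Laurent polynomials in `u, y, ũ, ỹ`: the largest subspace on which the
powers of these four operators are defined and which they map to itself. -/
def commonDomain (N : ℕ) [NeZero N] (b : ℂ) : Submodule ℂ (Hil N) :=
  sSup {D | ∀ (t : Bool) (k : ℤ), Preserves D (uPow N b t k) ∧ Preserves D (yPow N b t k)}

/-- A logarithmic coordinate `α U + β Y + c` is the triple `(α, β, c)`. -/
abbrev LogCoord : Type := ℤ × ℤ × ℂ

def logU : LogCoord := (1, 0, 0)
def logY : LogCoord := (0, 1, 0)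
def const (c : ℂ) : LogCoord := (0, 0, c)

/-- `exp(α U + β Y + c) = e^c q^{-αβ} u^α y^β`. -/
def expOp (N : ℕ) [NeZero N] (b : ℂ) (t : Bool) (Z : LogCoord) : Op N :=
  (exp Z.2.2 * qpar N b t ^ (-(Z.1 * Z.2.1))) • prodOp (uPow N b t Z.1) (yPow N b t Z.2.1)

/-! ### Fock-Goncharov operators on both triangulations -/

/-- The parameters `L_a` (with `λ_a = exp L_a`), respectively `L̃_a = conj L_a`. -/
def lift (L : Fin 4 → ℂ) (t : Bool) (a : Fin 4) : ℂ := if t then starRingEnd ℂ (L a) else L a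

/-- The logarithmic Fock-Goncharov coordinates `Z_1, …, Z_6` on `T` in terms of `U`, `Y` and
`L_1, …, L_4`. -/
def logZ (L : Fin 4 → ℂ) : Fin 6 → LogCoord :=
  ![-logU,
    logY + const (-2 * L 2 + I * Real.pi),
    logU + const (L 0 - L 1 + L 2 + L 3 + 2 * I * Real.pi),
    -logY + const (-L 0 + L 1 + L 2 + L 3 + I * Real.pi),
    -logY + const (I * Real.pi),
    logY + const (-L 0 - L 1 - L 2 - L 3 + I * Real.pi)]

/-- The map `i_3` on the logarithmic coordinates. -/
def i3 (Z : Fin 6 → LogCoord) (a : Fin 6) : LogCoord :=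
  if a = 2 then -Z 2 + const (2 * Real.pi * I)
  else Z a + max (eps a 2) 0 • (Z 2 - const (I * Real.pi))

/-- The quantum coordinates `z_a`, respectively `z̃_a`, on `T`. -/
def zOp (N : ℕ) [NeZero N] (b : ℂ) (L : Fin 4 → ℂ) (t : Bool) (a : Fin 6) : Op N :=
  expOp N b t (logZ (lift L t) a)

/-- The operators `i_3(z_a) = exp(i_3(Z_a))`, respectively `i_3(z̃_a)`. -/
def i3zOp (N : ℕ) [NeZero N] (b : ℂ) (L : Fin 4 → ℂ) (t : Bool) (a : Fin 6) : Op N :=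
  expOp N b t (i3 (logZ (lift L t)) a)

/-- The quantum dilogarithm
`φ(y, ỹ) = [∏_{j ≥ 0} (1 + q^{2j+1} y) / ∏_{j ≥ 0} (1 + q̃^{-2j-1} ỹ)]⁻¹`. -/
def dilog (N : ℕ) (b y y' : ℂ) : ℂ :=
  ((∏' j : ℕ, (1 + qpar N b false ^ (2 * j + 1) * y)) /
    (∏' j : ℕ, (1 + (qpar N b true)⁻¹ ^ (2 * j + 1) * y')))⁻¹

/-- The scalar `λ_1 λ_3 λ_4 / λ_2` with `z_3 = (λ_1 λ_3 λ_4 / λ_2) u`, respectively its tilded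
version. -/
def z3coeff (L : Fin 4 → ℂ) (t : Bool) : ℂ :=
  exp (lift L t 0) * exp (lift L t 2) * exp (lift L t 3) / exp (lift L t 1)

/-- The operator `φ(-z_3, -z̃_3)`: multiplication of `f̃(ν, n)` by
`φ(-(λ_1 λ_3 λ_4 / λ_2) u, -(λ̃_1 λ̃_3 λ̃_4 / λ̃_2) ũ)`, where `u, ũ` are the values of the symbols
at `(ν, n)`. -/
def dilogOp (N : ℕ) [NeZero N] (b : ℂ) (L : Fin 4 → ℂ) : Op N :=
  fourierMulOp fun ν n =>
    dilog N b (-(z3coeff L false * sym N b false ν n)) (-(z3coeff L true * sym N b true ν n))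

/-- The operators `V i_3(z_a) V⁻¹`, respectively `V i_3(z̃_a) V⁻¹`, on `T'`. -/
def zPrime (b : ℂ) (L : Fin 4 → ℂ) (V : Hil N ≃ₗᵢ[ℂ] Hil N) (t : Bool) (a : Fin 6) : Op N :=
  conjOp V.toLinearEquiv (i3zOp N b L t a)

/-- `A B f = k B A f` for all `f ∈ D`, both products being defined there. -/
def QCommuteOn (D : Submodule ℂ (Hil N)) (A B : Op N) (k : ℂ) : Prop :=
  ∀ f ∈ D, ∃ g, (f, g) ∈ (prodOp B A).graph ∧ (f, k • g) ∈ (prodOp A B).graph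

/-! ### The cluster transformation of the flip -/

/-- The right-hand sides of the quantum cluster transformation,
`z_1, z_2 (1 - q z_3), z_3⁻¹, (1 - q z_3⁻¹) z_4⁻¹, (1 - q z_3⁻¹) z_5⁻¹, z_6 (1 - q z_3)`,
in an arbitrary algebra. They are the values of `z'_1, z'_2, z'_3, z'_4⁻¹, z'_5⁻¹, z'_6`. -/
def flipExpr {A : Type*} [Ring A] [Algebra ℂ A] (q : ℂ) (z : Fin 6 → A) : Fin 6 → A :=
  ![z 0,
    z 1 * (1 - q • z 2),
    Ring.inverse (z 2),
    (1 - q • Ring.inverse (z 2)) * Ring.inverse (z 3),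
    (1 - q • Ring.inverse (z 2)) * Ring.inverse (z 4),
    z 5 * (1 - q • z 2)]

/-- The exponents with which `z'_1, …, z'_6` occur on the left-hand sides. -/
def flipSign : Fin 6 → ℤ := ![1, 1, 1, -1, -1, 1]

/-- `z'_a` or its inverse operator, according to `flipSign`. -/
def flipLhs (z' : Fin 6 → Op N) (a : Fin 6) : Op N :=
  if flipSign a = 1 then z' a else (z' a).inverse

/-- The classical cluster transformation of the flip. -/
def classicalFlip (x : Fin 6 → ℂ) : Fin 6 → ℂ :=
  ![x 0,
    x 1 * (1 - x 2),
    (x 2)⁻¹,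
    ((1 - (x 2)⁻¹) * (x 3)⁻¹)⁻¹,
    ((1 - (x 2)⁻¹) * (x 4)⁻¹)⁻¹,
    x 5 * (1 - x 2)]

/-! ### The operators `z_a` as endomorphisms of the common domain -/

theorem commonDomain_preserves (b : ℂ) (t : Bool) (k : ℤ) :
    Preserves (commonDomain N b) (uPow N b t k) ∧ Preserves (commonDomain N b) (yPow N b t k) := by
  have key : ∀ A : Op N,
      (∀ D : Submodule ℂ (Hil N), (∀ (t : Bool) (k : ℤ), Preserves D (uPow N b t k) ∧
        Preserves D (yPow N b t k)) → Preserves D A) → Preserves (commonDomain N b) A := by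
    intro A hA
    have hle : commonDomain N b ≤
        ((A.graph ⊓ (commonDomain N b).comap (LinearMap.snd ℂ (Hil N) (Hil N))).map
          (LinearMap.fst ℂ (Hil N) (Hil N))) := by
      refine sSup_le fun D hD f hf => ?_
      obtain ⟨g, hg, hfg⟩ := hA D hD f hf
      have hDle : D ≤ commonDomain N b := le_sSup hD
      exact ⟨(f, g), ⟨hfg, hDle hg⟩, rfl⟩
    intro f hf
    obtain ⟨⟨f', g⟩, ⟨h1, h2⟩, h3⟩ := hle hf
    have h3' : f' = f := h3
    subst h3'
    exact ⟨g, h2, h1⟩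
  exact ⟨key _ fun D hD => (hD t k).1, key _ fun D hD => (hD t k).2⟩

theorem expOp_preserves (b : ℂ) (t : Bool) (Z : LogCoord) :
    Preserves (commonDomain N b) (expOp N b t Z) := by
  intro f hf
  obtain ⟨g, hg, hfg⟩ := (commonDomain_preserves (N := N) b t Z.2.1).2 f hf
  obtain ⟨h, hh, hgh⟩ := (commonDomain_preserves (N := N) b t Z.1).1 g hg
  have hm := mem_prodOp_graph hfg hgh
  refine ⟨(exp Z.2.2 * qpar N b t ^ (-(Z.1 * Z.2.1))) • h, Submodule.smul_mem _ _ hh, ?_⟩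
  rw [LinearPMap.mem_graph_iff] at hm
  obtain ⟨x, hx, hxh⟩ := hm
  refine LinearPMap.mem_graph_iff _ |>.mpr ⟨x, hx, ?_⟩
  exact congrArg (fun w => (exp Z.2.2 * qpar N b t ^ (-(Z.1 * Z.2.1))) • w) hxh

/-- The restriction of an operator to a subspace that it preserves. -/
def restrictTo (D : Submodule ℂ (Hil N)) (A : Op N) (hA : Preserves D A) : Module.End ℂ D :=
  have hdom : D ≤ A.domain := fun f hf => by
    obtain ⟨g, -, hfg⟩ := hA f hf
    exact LinearPMap.mem_domain_of_mem_graph hfg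
  (A.toFun ∘ₗ Submodule.inclusion hdom).codRestrict D (by
    intro f
    obtain ⟨g, hg, hfg⟩ := hA f f.2
    rw [LinearPMap.mem_graph_iff] at hfg
    obtain ⟨x, hx, hxg⟩ := hfg
    have hx' : Submodule.inclusion hdom f = x := Subtype.ext hx.symm
    change A.toFun (Submodule.inclusion hdom f) ∈ D
    rw [hx']
    exact (show A.toFun x = g from hxg) ▸ hg)

/-- The quantum coordinate `z_a`, respectively `z̃_a`, as an endomorphism of the common domain. -/
def zEnd (N : ℕ) [NeZero N] (b : ℂ) (L : Fin 4 → ℂ) (t : Bool) (a : Fin 6) :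
    Module.End ℂ (commonDomain N b) :=
  restrictTo (commonDomain N b) (zOp N b L t a) (expOp_preserves b t _)

end FlipQuantization

end

/-! The torus relations are algebraic once `V` is known to be unitary. Since `|b| = 1`, one has `b⁻¹
= conj b` and `q̃⁻¹ = conj q`, so the two infinite products in the quantum dilogarithm are complex
conjugates of each other at real `ν`. The symbol of `V` therefore has modulus one off a countable
set. On `𝔇` the exponentials `exp(αU + βY + c)` satisfy Weyl relations governed by `αβ' - βα'`
(`expEnd_mul`, `commute_expEnd`). For the `i_3(Z_a)` this form is `ε'` (`eps'_eq_symplectic`), and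
conjugation by `V` carries the relations to `V𝔇`. Because `V` is diagonal on the Fourier side, it
commutes with the powers of `u`, which gives `z'_1` and `z'_3`.

The analytic core is `V y V⁻¹ = y (1 - q z_3)` on `𝔇` (`symm_yEnd_mem_yPow_graph`). Formally this is
the functional equation of the infinite products. The difficulty is the domain: `V⁻¹ f` must be
shown to lie in the domain of `y`. The identity is put in weak form against Gaussians, which suffice
to recognize a multiplication operator (`mem_mulOp_graph_of_gauss`). Both sides then become
integrals of `dilogRatio`, the conjugate of the symbol of `V`, against Gaussians, along the two
edges of the strip `-Re b ≤ Im z ≤ 0`. Cauchy's theorem identifies them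
(`integral_dilogRatio_shift`). The ratio is holomorphic inside the strip, its singularities on the
edges are cancelled by zeros of the numerator (`zeros_denominator`), and its growth is at most
exponential (`dilogRatio_le_exp`), which Gaussians beat. The condition on the `λ_a` says that the
coefficient of `z_3` is a translation of `(ν, n)` with real `μ₀`, so the strip keeps its position
relative to the poles.

The formulas for `z'_4⁻¹` and `z'_5⁻¹` follow from the one for `y` by reordering, and the classical
limit is continuity at `q = 1`. -/

noncomputable section

namespace FlipQuantization

open FourierTransform SchwartzMap

/-! ### Gaussians on the line -/

/-- The Gaussian `exp(-π x² + c x)` as an entire function. -/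
def gaussFun (c z : ℂ) : ℂ := exp (-Real.pi * z ^ 2 + c * z)

theorem differentiable_gaussFun (c : ℂ) : Differentiable ℂ (gaussFun c) := by
  unfold gaussFun; fun_prop

theorem continuous_gaussFun_ofReal (c : ℂ) : Continuous fun x : ℝ => gaussFun c x :=
  (differentiable_gaussFun c).continuous.comp continuous_ofReal

/-- Complex translations and exponential factors only change the complex parameter `c`, so the
Gaussians are stable under all Weyl operators. -/
theorem gaussFun_add (c z w : ℂ) :
    gaussFun c (z + w) = gaussFun c w * gaussFun (c - 2 * Real.pi * w) z := by
  rw [gaussFun, gaussFun, gaussFun, ← Complex.exp_add]; congr 1; ring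

theorem exp_mul_gaussFun (v c z : ℂ) : exp (v * z) * gaussFun c z = gaussFun (c + v) z := by
  rw [gaussFun, gaussFun, ← Complex.exp_add]; congr 1; ring

theorem conj_gaussFun (c z : ℂ) :
    starRingEnd ℂ (gaussFun c z) = gaussFun (starRingEnd ℂ c) (starRingEnd ℂ z) := by
  simp [gaussFun, ← Complex.exp_conj]

theorem integrable_gaussFun (c : ℂ) : Integrable fun x : ℝ => gaussFun c x := by
  have := integrable_cexp_quadratic (b := Real.pi) (by simpa using Real.pi_pos) c 0
  simpa [gaussFun] using this

theorem norm_gaussFun_ofReal (c : ℂ) (x : ℝ) :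
    ‖gaussFun c x‖ = Real.exp (-Real.pi * x ^ 2 + c.re * x) := by
  rw [gaussFun, Complex.norm_exp]; congr 1
  simp [← ofReal_pow]

theorem memLp_gaussFun (c : ℂ) : MemLp (fun x : ℝ => gaussFun c x) 2 volume := by
  rw [memLp_two_iff_integrable_sq_norm (continuous_gaussFun_ofReal c).aestronglyMeasurable]
  have := (integrable_cexp_quadratic (b := 2 * Real.pi) (by simpa using Real.pi_pos)
    (2 * c) 0).norm
  refine this.congr (Eventually.of_forall fun x => ?_)
  simp only [norm_gaussFun_ofReal, Complex.norm_exp, ← Real.exp_nat_mul]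
  congr 1
  simp [← ofReal_pow]; ring

/-- The Gaussian as an element of `L²(ℝ)`. -/
def gaussLp (c : ℂ) : Lp ℂ 2 (volume : Measure ℝ) := (memLp_gaussFun c).toLp _

theorem coeFn_gaussLp (c : ℂ) : gaussLp c =ᵐ[volume] fun x : ℝ => gaussFun c x :=
  MemLp.coeFn_toLp _

theorem fourier_gaussFun (c : ℂ) :
    (𝓕 fun x : ℝ => gaussFun c x) =
      fun t : ℝ => exp (c ^ 2 / (4 * Real.pi)) * gaussFun (-I * c) t := by
  have hpi : (Real.pi : ℂ) ≠ 0 := ofReal_ne_zero.2 Real.pi_ne_zero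
  have := fourier_gaussian_pi' (b := 1) (by simp) (c / (2 * Real.pi))
  have h2 : (fun x : ℝ => gaussFun c x) = fun x : ℝ =>
      cexp (-Real.pi * 1 * x ^ 2 + 2 * Real.pi * (c / (2 * Real.pi)) * x) := by
    funext x; rw [gaussFun]; congr 1; field_simp
  rw [h2, this]
  funext t
  rw [gaussFun, ← Complex.exp_add]
  simp only [one_cpow, div_one, one_mul]
  congr 1
  have : (t + I * (c / (2 * Real.pi))) ^ 2
      = (t:ℂ) ^ 2 + I * c * t / Real.pi - c ^ 2 / (4 * Real.pi ^ 2) := by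
    ring_nf; rw [I_sq]; field_simp
  rw [this]; field_simp; ring

theorem integral_fourier_mul_eq_flip {f g : ℝ → ℂ} (hf : Integrable f) (hg : Integrable g) :
    ∫ x, 𝓕 f x * g x = ∫ x, f x * 𝓕 g x := by
  simpa using! (VectorFourier.integral_fourierIntegral_smul_eq_flip (L := innerₗ ℝ)
    Real.continuous_fourierChar continuous_inner hf hg)

/-- The Fourier transform on `L²` is given by the integral on `L¹ ∩ L²`. -/
theorem fourierTransform_toLp {f g : ℝ → ℂ} (hf : Integrable f) (hf2 : MemLp f 2 volume)
    (hg2 : MemLp g 2 volume) (h : 𝓕 f = g) :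
    Lp.fourierTransformₗᵢ ℝ ℂ (hf2.toLp f) = hg2.toLp g := by
  -- The two classes are compared as tempered distributions, into which `L²` embeds.
  have key : ((𝓕 (hf2.toLp f) : Lp ℂ 2 (volume : Measure ℝ)) : 𝓢'(ℝ, ℂ)) =
      ((hg2.toLp g : Lp ℂ 2 (volume : Measure ℝ)) : 𝓢'(ℝ, ℂ)) := by
    rw [← Lp.fourier_toTemperedDistribution_eq]
    ext φ
    rw [TemperedDistribution.fourier_apply, Lp.toTemperedDistribution_apply,
      Lp.toTemperedDistribution_apply]
    have e1 : ∫ x, (𝓕 φ) x • (hf2.toLp f) x = ∫ x, 𝓕 (φ : ℝ → ℂ) x * f x := by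
      refine integral_congr_ae ?_
      filter_upwards [hf2.coeFn_toLp] with x hx
      rw [hx, smul_eq_mul, SchwartzMap.fourier_coe]
    have e2 : ∫ x, φ x • (hg2.toLp g) x = ∫ x, φ x * 𝓕 f x := by
      refine integral_congr_ae ?_
      filter_upwards [hg2.coeFn_toLp] with x hx
      rw [hx, smul_eq_mul, h]
    rw [e1, e2]
    exact integral_fourier_mul_eq_flip φ.integrable hf
  have inj : Function.Injective (Lp.toTemperedDistributionCLM ℂ (volume : Measure ℝ) 2) :=
    LinearMap.ker_eq_bot.1 Lp.ker_toTemperedDistributionCLM_eq_bot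
  exact inj key

theorem fourierTransform_gaussLp (c : ℂ) :
    Lp.fourierTransformₗᵢ ℝ ℂ (gaussLp c) =
      exp (c ^ 2 / (4 * Real.pi)) • gaussLp (-I * c) := by
  rw [gaussLp, fourierTransform_toLp (integrable_gaussFun c) (memLp_gaussFun c)
    ((memLp_gaussFun (-I * c)).const_smul (exp (c ^ 2 / (4 * Real.pi)))) (fourier_gaussFun c),
    MemLp.toLp_const_smul, gaussLp]

/-- Every test function is the Fourier transform of a Schwartz function, and the transform can be
moved onto `w`. -/
theorem ae_eq_zero_of_fourier_eq_zero {w : ℝ → ℂ} (hw : Integrable w) (h : 𝓕 w = 0) :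
    w =ᵐ[volume] 0 := by
  apply ae_eq_zero_of_integral_contDiff_smul_eq_zero hw.locallyIntegrable
  intro g g_smooth g_cpt
  have hg₁ : HasCompactSupport (Complex.ofRealCLM ∘ g) := g_cpt.comp_left rfl
  have hg₂ : ContDiff ℝ (⊤ : ℕ∞) (Complex.ofRealCLM ∘ g) := by fun_prop
  set φ : 𝓢(ℝ, ℂ) := hg₁.toSchwartzMap hg₂ with hφ
  have e : ∀ x, (g x : ℂ) = 𝓕 ((𝓕⁻ φ : 𝓢(ℝ, ℂ)) : ℝ → ℂ) x := by
    intro x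
    rw [← SchwartzMap.fourier_coe, FourierTransform.fourier_fourierInv_eq]
    rfl
  calc ∫ x, g x • w x = ∫ x, 𝓕 ((𝓕⁻ φ : 𝓢(ℝ, ℂ)) : ℝ → ℂ) x * w x := by
        refine integral_congr_ae (Eventually.of_forall fun x => ?_)
        simp only [← e, real_smul]
    _ = 0 := by
        rw [integral_fourier_mul_eq_flip (SchwartzMap.integrable _) hw, h]; simp

/-- The Gaussians `exp(-π x² + c x)` are total. -/
theorem ae_eq_zero_of_integral_gaussFun {w : ℝ → ℂ}
    (hw : Integrable fun x : ℝ => gaussFun 0 x * w x)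
    (h : ∀ c : ℂ, ∫ x : ℝ, gaussFun c x * w x = 0) : w =ᵐ[volume] 0 := by
  have := ae_eq_zero_of_fourier_eq_zero hw (by
    funext t
    rw [Real.fourier_real_eq_integral_exp_smul]
    simp only [Pi.zero_apply]
    -- For imaginary `c` the pairing is the Fourier transform of the Gaussian times `w`.
    refine Eq.trans ?_ (h (-2 * Real.pi * t * I))
    refine integral_congr_ae (Eventually.of_forall fun x => ?_)
    simp only [smul_eq_mul]
    rw [← mul_assoc]
    congr 1
    have := exp_mul_gaussFun (-2 * Real.pi * t * I) 0 x
    rw [zero_add] at this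
    rw [← this]; congr 2; push_cast; ring)
  filter_upwards [this] with x hx
  have h0 : gaussFun 0 x ≠ 0 := Complex.exp_ne_zero _
  simpa [h0] using hx

end FlipQuantization

end

/-! ### Graphs, multiplication operators and the Fourier transform on `L²(ℝ) ⊗ ℂ^N`. -/

noncomputable section

namespace FlipQuantization

open scoped ComplexInnerProductSpace

variable {N : ℕ}

/-! ### Graphs of the basic constructions -/

theorem mem_mulOp_graph {s : ℝ → ZMod N → ℂ} {f g : Hil N} :
    (f, g) ∈ (mulOp s).graph ↔ ∀ m, g m =ᵐ[volume] fun μ => s μ m * f m μ := by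
  rw [mulOp_graph]; rfl

theorem mem_conjOp_graph {e : Hil N ≃ₗ[ℂ] Hil N} {A : Op N} {f g : Hil N} :
    (f, g) ∈ (conjOp e A).graph ↔ (e.symm f, e.symm g) ∈ A.graph := by
  simp only [LinearPMap.mem_graph_iff]
  constructor
  · rintro ⟨x, hx, hxg⟩
    refine ⟨⟨e.symm x, x.2⟩, by simp only [hx], ?_⟩
    rw [← hxg]
    exact (e.symm_apply_apply _).symm
  · rintro ⟨x, hx, hxg⟩
    have hf : f ∈ (conjOp e A).domain := by
      change e.symm f ∈ A.domain
      rw [← hx]; exact x.2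
    refine ⟨⟨f, hf⟩, rfl, ?_⟩
    have hg : e (A x) = g := by rw [← e.symm_apply_eq.1 hxg.symm]
    refine Eq.trans ?_ hg
    exact congrArg (fun y => e (A.toFun y)) (Subtype.ext hx.symm : (⟨e.symm f, hf⟩ : A.domain) = x)

theorem mem_prodOp_graph_iff {A B : Op N} {f h : Hil N} :
    (f, h) ∈ (prodOp A B).graph ↔ ∃ g, (f, g) ∈ B.graph ∧ (g, h) ∈ A.graph := by
  constructor
  · intro hfh
    rw [LinearPMap.mem_graph_iff] at hfh
    obtain ⟨⟨x, hx⟩, rfl, hxh⟩ := hfh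
    obtain ⟨y, hy, rfl⟩ := hx
    refine ⟨B y, LinearPMap.mem_graph _ y, ?_⟩
    have := LinearPMap.mem_graph A ⟨B.toFun y, hy⟩
    exact (show (prodOp A B) _ = h from hxh) ▸ this
  · rintro ⟨g, h1, h2⟩
    exact mem_prodOp_graph h1 h2

theorem mem_smul_graph {A : Op N} {c : ℂ} {f g : Hil N} (h : (f, g) ∈ A.graph) :
    (f, c • g) ∈ (c • A).graph := by
  rw [LinearPMap.mem_graph_iff] at h ⊢
  obtain ⟨x, hx, hxg⟩ := h
  exact ⟨x, hx, congrArg (c • ·) hxg⟩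

theorem mem_smul_graph_iff {A : Op N} {c : ℂ} (hc : c ≠ 0) {f g : Hil N} :
    (f, g) ∈ (c • A).graph ↔ (f, c⁻¹ • g) ∈ A.graph := by
  constructor
  · intro h
    rw [LinearPMap.mem_graph_iff] at h ⊢
    obtain ⟨x, hx, hxg⟩ := h
    refine ⟨x, hx, ?_⟩
    have hxg' : c • A x = g := hxg
    change A x = c⁻¹ • g
    rw [← hxg', inv_smul_smul₀ hc]
  · intro h
    simpa [smul_smul, hc] using mem_smul_graph (c := c) h

theorem ker_eq_bot_of_graph {A : Op N} (h : ∀ f, (f, (0 : Hil N)) ∈ A.graph → f = 0) :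
    LinearMap.ker A.toFun = ⊥ := by
  rw [LinearMap.ker_eq_bot']
  intro x hx
  exact Subtype.ext (h x (by rw [← hx]; exact LinearPMap.mem_graph A x))

theorem mem_inverse_graph_iff {A : Op N} (hA : LinearMap.ker A.toFun = ⊥) {f g : Hil N} :
    (f, g) ∈ A.inverse.graph ↔ (g, f) ∈ A.graph := by
  rw [LinearPMap.inverse_graph hA]
  constructor
  · rintro ⟨⟨x, y⟩, hx, h⟩
    obtain ⟨rfl, rfl⟩ := Prod.ext_iff.1 h
    exact hx
  · intro h
    exact ⟨(g, f), h, rfl⟩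

theorem graph_unique {A : Op N} {f g g' : Hil N} (h : (f, g) ∈ A.graph) (h' : (f, g') ∈ A.graph) :
    g = g' :=
  LinearPMap.mem_graph_snd_inj A h h' rfl

theorem op_ext {A B : Op N} (h : ∀ f g, (f, g) ∈ A.graph ↔ (f, g) ∈ B.graph) : A = B :=
  LinearPMap.eq_of_eq_graph (Submodule.ext fun p => h p.1 p.2)

/-! ### Multiplication operators -/

/-- The complex conjugate symbol. -/
def conjSymbol (s : ℝ → ZMod N → ℂ) : ℝ → ZMod N → ℂ := fun μ m => starRingEnd ℂ (s μ m)

/-- The conjugate symbol gives a formal adjoint; the weak arguments below move operators across the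
inner product in this way. -/
theorem inner_mulOp [NeZero N] {s : ℝ → ZMod N → ℂ} {f f' g g' : Hil N}
    (hf : (f, f') ∈ (mulOp s).graph) (hg : (g, g') ∈ (mulOp (conjSymbol s)).graph) :
    ⟪g, f'⟫ = ⟪g', f⟫ := by
  rw [mem_mulOp_graph] at hf hg
  rw [PiLp.inner_apply, PiLp.inner_apply]
  refine Finset.sum_congr rfl fun m _ => ?_
  rw [L2.inner_def, L2.inner_def]
  refine integral_congr_ae ?_
  filter_upwards [hf m, hg m] with μ h1 h2
  rw [h1, h2]
  simp [conjSymbol]; ring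

/-- The Gaussian `exp(-π μ² + c μ)` in the component `m`. -/
def gauss [NeZero N] (c : ℂ) (m : ZMod N) : Hil N := PiLp.single 2 m (gaussLp c)

theorem gauss_self [NeZero N] (c : ℂ) (m : ZMod N) : gauss c m m = gaussLp c := by
  simp [gauss]

theorem gauss_of_ne [NeZero N] (c : ℂ) {m n : ZMod N} (h : n ≠ m) : gauss c m n = 0 := by
  simp [gauss, h]

theorem inner_gauss [NeZero N] (c : ℂ) (m : ZMod N) (f : Hil N) :
    ⟪gauss c m, f⟫ = ⟪gaussLp c, f m⟫ := by
  rw [PiLp.inner_apply, Finset.sum_eq_single m, gauss_self]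
  · intro n _ h
    rw [gauss_of_ne c h, inner_zero_left]
  · simp

theorem smul_gauss_mem_mulOp_graph [NeZero N] {s : ℝ → ZMod N → ℂ} {c d k : ℂ} {m : ZMod N}
    (h : ∀ x : ℝ, s x m * gaussFun c x = k * gaussFun d x) :
    (gauss c m, k • gauss d m) ∈ (mulOp s).graph := by
  rw [mem_mulOp_graph]
  intro n
  rcases eq_or_ne n m with rfl | hn
  · rw [PiLp.smul_apply, gauss_self, gauss_self]
    filter_upwards [coeFn_gaussLp c, coeFn_gaussLp d, Lp.coeFn_smul k (gaussLp d)] with x h1 h2 h3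
    rw [h3, Pi.smul_apply, h1, h2, h, smul_eq_mul]
  · rw [PiLp.smul_apply, gauss_of_ne _ hn, gauss_of_ne _ hn, smul_zero]
    filter_upwards [Lp.coeFn_zero ℂ 2 (volume : Measure ℝ)] with x h1
    rw [h1]; simp

/-- The linear combinations of Gaussians are a core for multiplication operators. -/
theorem mem_mulOp_graph_of_gauss [NeZero N] {s : ℝ → ZMod N → ℂ} {f f' : Hil N}
    (h : ∀ c m, ∃ g', (gauss c m, g') ∈ (mulOp (conjSymbol s)).graph ∧
      ⟪gauss c m, f'⟫ = ⟪g', f⟫) : (f, f') ∈ (mulOp s).graph := by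
  rw [mem_mulOp_graph]
  intro m
  -- A priori `s f` need not be square integrable; only its products with Gaussians are known to be
  -- integrable, and totality of the Gaussians needs no more.
  have main : ∀ c, Integrable (fun x : ℝ => gaussFun (starRingEnd ℂ c) x *
      (f' m x - s x m * f m x)) ∧
      ∫ x : ℝ, gaussFun (starRingEnd ℂ c) x * (f' m x - s x m * f m x) = 0 := by
    intro c
    obtain ⟨g', hg', hin⟩ := h c m
    rw [mem_mulOp_graph] at hg'
    have e0 : ⟪g', f⟫ = ⟪g' m, f m⟫ := by
      rw [PiLp.inner_apply, Finset.sum_eq_single m]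
      · intro n _ hn
        have : g' n = 0 := by
          rw [Lp.eq_zero_iff_ae_eq_zero]
          have := hg' n
          rw [gauss_of_ne c hn] at this
          filter_upwards [this, Lp.coeFn_zero ℂ 2 (volume : Measure ℝ)] with x h1 h2
          rw [h1, h2]; simp
        rw [this, inner_zero_left]
      · simp
    have e1 : (fun x => ⟪gaussLp c x, f' m x⟫ - ⟪g' m x, f m x⟫) =ᵐ[volume]
        fun x : ℝ => gaussFun (starRingEnd ℂ c) x * (f' m x - s x m * f m x) := by
      have := hg' m
      rw [gauss_self] at this
      filter_upwards [this, coeFn_gaussLp c] with x h1 h2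
      rw [h1, h2]
      have := conj_gaussFun c x
      simp only [RCLike.inner_apply, conjSymbol, map_mul, this, conj_conj, conj_ofReal]
      ring
    have i1 := L2.integrable_inner (𝕜 := ℂ) (gaussLp c) (f' m)
    have i2 := L2.integrable_inner (𝕜 := ℂ) (g' m) (f m)
    refine ⟨(i1.sub i2).congr e1, ?_⟩
    rw [← integral_congr_ae e1, integral_sub i1 i2, ← L2.inner_def, ← L2.inner_def, ← e0, ← hin,
      inner_gauss, sub_self]
  have := ae_eq_zero_of_integral_gaussFun (w := fun x => f' m x - s x m * f m x)
    (by simpa using (main 0).1) (fun c => by simpa using (main (starRingEnd ℂ c)).2)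
  filter_upwards [this] with x hx
  exact sub_eq_zero.1 hx

/-- The weak criterion for the zero symbol: it forces `f = 0 · f`. -/
theorem eq_zero_of_inner_gauss [NeZero N] {f : Hil N} (h : ∀ c m, ⟪gauss c m, f⟫ = 0) :
    f = 0 := by
  have h0 : ∀ g : Hil N, (g, (0 : Hil N)) ∈ (mulOp (N := N) (fun _ _ => 0)).graph := fun g => by
    rw [mem_mulOp_graph]
    intro m
    filter_upwards [Lp.coeFn_zero ℂ 2 (volume : Measure ℝ)] with x h1
    rw [PiLp.zero_apply, h1]; simp
  have : (f, f) ∈ (mulOp (N := N) (fun _ _ => 0)).graph :=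
    mem_mulOp_graph_of_gauss fun c m => ⟨0, by
      have e : conjSymbol (N := N) (fun _ _ => 0) = fun _ _ => 0 := by
        funext; simp [conjSymbol]
      rw [e]; exact h0 _, by rw [h, inner_zero_left]⟩
  exact graph_unique this (h0 f)

/-! ### The Fourier transform -/

variable [NeZero N]

theorem fourierHil_apply (f : Hil N) (n : ZMod N) :
    fourierHil N f n =
      ∑ m, ZMod.stdAddChar (-(m * n)) • Lp.fourierTransformₗᵢ ℝ ℂ (f m) := by
  exact ZMod.dft_apply _ _

theorem sum_stdAddChar_mul (m : ZMod N) :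
    ∑ n : ZMod N, ZMod.stdAddChar (n * m) = if m = 0 then (N : ℂ) else 0 := by
  have := AddChar.sum_mulShift m (ZMod.isPrimitive_stdAddChar N)
  simpa [ZMod.card] using this

theorem conj_stdAddChar (m : ZMod N) :
    starRingEnd ℂ (ZMod.stdAddChar m) = ZMod.stdAddChar (-m) :=
  (AddChar.map_neg_eq_conj _ _).symm

/-- Plancherel in the continuous variable and orthogonality of characters in the discrete one; the
discrete transform is not normalized, hence the factor `N`. -/
theorem inner_fourierHil (f g : Hil N) :
    ⟪fourierHil N f, fourierHil N g⟫ = N * ⟪f, g⟫ := by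
  simp only [PiLp.inner_apply, fourierHil_apply, inner_sum, sum_inner, inner_smul_left,
    inner_smul_right, LinearIsometryEquiv.inner_map_map, conj_stdAddChar]
  have e : ∀ n i j : ZMod N, (ZMod.stdAddChar (-(i * n)) : ℂ) *
      (ZMod.stdAddChar (-(-(j * n))) * ⟪f j, g i⟫) =
      ZMod.stdAddChar (n * (j - i)) * ⟪f j, g i⟫ := by
    intro n i j
    rw [← mul_assoc, ← AddChar.map_add_eq_mul]
    congr 2; ring
  simp only [Finset.mul_sum, e]
  rw [Finset.sum_comm]
  refine Finset.sum_congr rfl fun i _ => ?_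
  rw [Finset.sum_comm]
  simp only [← Finset.sum_mul, sum_stdAddChar_mul, sub_eq_zero]
  simp [Finset.sum_ite_eq']

theorem norm_fourierHil (f : Hil N) : ‖fourierHil N f‖ ^ 2 = N * ‖f‖ ^ 2 := by
  have := inner_fourierHil f f
  rw [inner_self_eq_norm_sq_to_K, inner_self_eq_norm_sq_to_K] at this
  apply Complex.ofReal_injective
  push_cast
  exact this

theorem mem_fourierMulOp_graph {s : ℝ → ZMod N → ℂ} {f g : Hil N} :
    (f, g) ∈ (fourierMulOp s).graph ↔
      (fourierHil N f, fourierHil N g) ∈ (mulOp fun ξ n => s (-(N * ξ)) n).graph := by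
  rw [fourierMulOp, mem_conjOp_graph]; rfl

/-- The vectors whose Fourier transform is a Gaussian. -/
def fgauss (c : ℂ) (n : ZMod N) : Hil N := (fourierHil N).symm (gauss c n)

theorem fourierHil_fgauss (c : ℂ) (n : ZMod N) : fourierHil N (fgauss c n) = gauss c n :=
  (fourierHil N).apply_symm_apply _

theorem fourierHil_gauss (c : ℂ) (m n : ZMod N) :
    fourierHil N (gauss c m) n =
      (ZMod.stdAddChar (-(m * n)) * exp (c ^ 2 / (4 * Real.pi))) • gaussLp (-I * c) := by
  rw [fourierHil_apply, Finset.sum_eq_single m]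
  · rw [gauss_self, fourierTransform_gaussLp, smul_smul]
  · intro k _ hk
    rw [gauss_of_ne c hk, map_zero, smul_zero]
  · simp

end FlipQuantization

end

/-! ### Weyl operators on Gaussians, and density of the common domain. -/

noncomputable section

namespace FlipQuantization

open scoped ComplexInnerProductSpace

variable {N : ℕ} [NeZero N]

/-! ### Weyl operators -/

/-- The character `exp(v μ) e^{2πi l m / N}`. -/
def charSymbol (v : ℂ) (l : ZMod N) (μ : ℝ) (m : ZMod N) : ℂ := exp (v * μ) * ZMod.stdAddChar (l * m)

/-- Multiplication by the character `exp(v μ) e^{2πi l m / N}`. -/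
def charOp (v : ℂ) (l : ZMod N) : Op N := mulOp (charSymbol v l)

/-- The translation `f(μ, m) ↦ f(μ + w, m + j)`. -/
def shiftOp (w : ℂ) (j : ZMod N) : Op N :=
  conjOp (fourierHil N).symm (mulOp (charSymbol (2 * Real.pi * I * w) j))

theorem mem_shiftOp_graph {w : ℂ} {j : ZMod N} {f g : Hil N} :
    (f, g) ∈ (shiftOp w j).graph ↔
      (fourierHil N f, fourierHil N g) ∈ (charOp (2 * Real.pi * I * w) j).graph := by
  rw [shiftOp, mem_conjOp_graph]; rfl

theorem conjSymbol_charSymbol (v : ℂ) (l : ZMod N) :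
    conjSymbol (charSymbol v l) = charSymbol (starRingEnd ℂ v) (-l) := by
  funext μ m
  simp [conjSymbol, charSymbol, ← Complex.exp_conj, conj_stdAddChar]

theorem inner_charOp {v : ℂ} {l : ZMod N} {f f' g g' : Hil N}
    (hf : (f, f') ∈ (charOp v l).graph) (hg : (g, g') ∈ (charOp (starRingEnd ℂ v) (-l)).graph) :
    ⟪g, f'⟫ = ⟪g', f⟫ := by
  rw [charOp, ← conjSymbol_charSymbol] at hg
  exact inner_mulOp hf hg

theorem inner_shiftOp {w : ℂ} {j : ZMod N} {f f' g g' : Hil N}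
    (hf : (f, f') ∈ (shiftOp w j).graph) (hg : (g, g') ∈ (shiftOp (-starRingEnd ℂ w) (-j)).graph) :
    ⟪g, f'⟫ = ⟪g', f⟫ := by
  rw [mem_shiftOp_graph] at hf hg
  have e : 2 * Real.pi * I * -starRingEnd ℂ w = starRingEnd ℂ (2 * Real.pi * I * w) := by
    have : starRingEnd ℂ 2 = 2 := map_ofNat _ 2
    simp [this]
  rw [e] at hg
  have := inner_charOp hf hg
  rw [inner_fourierHil, inner_fourierHil] at this
  exact mul_left_cancel₀ (Nat.cast_ne_zero.2 (NeZero.ne N)) this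

theorem charOp_gauss (v : ℂ) (l : ZMod N) (c : ℂ) (m : ZMod N) :
    (gauss c m, (ZMod.stdAddChar (l * m) : ℂ) • gauss (c + v) m) ∈ (charOp v l).graph :=
  smul_gauss_mem_mulOp_graph fun x => by
    rw [← exp_mul_gaussFun, charSymbol]; ring

/-- The Fourier multiplier acts on a Gaussian as analytic continuation to the argument translated by
the complex number `w`. -/
theorem shiftOp_gauss (w : ℂ) (j : ZMod N) (c : ℂ) (m : ZMod N) :
    (gauss c m, gaussFun c w • gauss (c - 2 * Real.pi * w) (m - j)) ∈ (shiftOp w j).graph := by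
  rw [mem_shiftOp_graph, charOp, mem_mulOp_graph]
  intro n
  rw [map_smul, PiLp.smul_apply, fourierHil_gauss, fourierHil_gauss, smul_smul]
  filter_upwards [coeFn_gaussLp (-I * c), coeFn_gaussLp (-I * (c - 2 * Real.pi * w)),
    Lp.coeFn_smul (gaussFun c w * (ZMod.stdAddChar (-((m - j) * n)) *
      exp ((c - 2 * Real.pi * w) ^ 2 / (4 * Real.pi)))) (gaussLp (-I * (c - 2 * Real.pi * w))),
    Lp.coeFn_smul (ZMod.stdAddChar (-(m * n)) * exp (c ^ 2 / (4 * Real.pi)))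
      (gaussLp (-I * c))] with x h1 h2 h3 h4
  rw [h3, h4, Pi.smul_apply, Pi.smul_apply, h1, h2, smul_eq_mul, smul_eq_mul, charSymbol]
  have e1 : (ZMod.stdAddChar (-((m - j) * n)) : ℂ) =
      ZMod.stdAddChar (-(m * n)) * ZMod.stdAddChar (j * n) := by
    rw [← AddChar.map_add_eq_mul]; congr 1; ring
  have e2 : gaussFun c w * exp ((c - 2 * Real.pi * w) ^ 2 / (4 * Real.pi)) *
      gaussFun (-I * (c - 2 * Real.pi * w)) x =
      exp (2 * Real.pi * I * w * x) * exp (c ^ 2 / (4 * Real.pi)) * gaussFun (-I * c) x := by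
    have hpi : (Real.pi : ℂ) ≠ 0 := ofReal_ne_zero.2 Real.pi_ne_zero
    rw [gaussFun, gaussFun, gaussFun]
    simp only [← Complex.exp_add]
    congr 1
    field_simp
    ring
  rw [e1]
  linear_combination (ZMod.stdAddChar (-(m * n)) * ZMod.stdAddChar (j * n) : ℂ) * e2

theorem fgauss_eq_sum (c : ℂ) (n : ZMod N) :
    fgauss c n = ∑ m : ZMod N, ((N : ℂ)⁻¹ * ZMod.stdAddChar (m * n) *
      exp (c ^ 2 / (4 * Real.pi))) • gauss (I * c) m := by
  have hN : (N : ℂ) ≠ 0 := Nat.cast_ne_zero.2 (NeZero.ne N)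
  rw [fgauss, LinearEquiv.symm_apply_eq, map_sum]
  ext1 k
  have e0 : -I * (I * c) = c := by rw [← mul_assoc, neg_mul, I_mul_I]; ring
  have e : ∀ m : ZMod N, (fourierHil N (((N : ℂ)⁻¹ * ZMod.stdAddChar (m * n) *
      exp (c ^ 2 / (4 * Real.pi))) • gauss (I * c) m)) k =
      ((N : ℂ)⁻¹ * ZMod.stdAddChar (m * (n - k))) • gaussLp c := by
    intro m
    rw [map_smul, PiLp.smul_apply, fourierHil_gauss, smul_smul, e0]
    congr 1
    have e1 : (ZMod.stdAddChar (m * (n - k)) : ℂ) =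
        ZMod.stdAddChar (m * n) * ZMod.stdAddChar (-(m * k)) := by
      rw [← AddChar.map_add_eq_mul]; congr 1; ring
    have e2 : exp (c ^ 2 / (4 * Real.pi)) * exp ((I * c) ^ 2 / (4 * Real.pi)) = 1 := by
      rw [← Complex.exp_add, mul_pow, I_sq]; ring_nf; exact Complex.exp_zero
    rw [e1]
    linear_combination ((N : ℂ)⁻¹ * (ZMod.stdAddChar (m * n) * ZMod.stdAddChar (-(m * k)))) * e2
  have e3 : (∑ m : ZMod N, fourierHil N (((N : ℂ)⁻¹ * ZMod.stdAddChar (m * n) *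
      exp (c ^ 2 / (4 * Real.pi))) • gauss (I * c) m)) k =
      ∑ m : ZMod N, (fourierHil N (((N : ℂ)⁻¹ * ZMod.stdAddChar (m * n) *
      exp (c ^ 2 / (4 * Real.pi))) • gauss (I * c) m)) k := by simp
  rw [e3]
  simp only [e, ← Finset.sum_smul, ← Finset.mul_sum, sum_stdAddChar_mul, sub_eq_zero]
  rcases eq_or_ne n k with rfl | h
  · simp [gauss_self, hN]
  · rw [gauss_of_ne c h.symm]; simp [h]

theorem shiftOp_fgauss (w : ℂ) (j : ZMod N) (c : ℂ) (n : ZMod N) :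
    (fgauss c n, (ZMod.stdAddChar (j * n) : ℂ) • fgauss (c + 2 * Real.pi * I * w) n) ∈
      (shiftOp w j).graph := by
  rw [mem_shiftOp_graph, map_smul, fourierHil_fgauss, fourierHil_fgauss]
  exact charOp_gauss _ _ _ _

/-- Expanding `fgauss` into finitely many Gaussians reduces this to `charOp_gauss`. It makes `y`
explicit on vectors adapted to `V`, which is diagonal on the Fourier side. -/
theorem charOp_fgauss (v : ℂ) (l : ZMod N) (c : ℂ) (n : ZMod N) :
    (fgauss c n, gaussFun c (I * v / (2 * Real.pi)) • fgauss (c - I * v) (n + l)) ∈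
      (charOp v l).graph := by
  have hpi : (Real.pi : ℂ) ≠ 0 := ofReal_ne_zero.2 Real.pi_ne_zero
  have h := Submodule.sum_mem (charOp v l).graph (t := Finset.univ) fun m _ =>
    Submodule.smul_mem _ ((N : ℂ)⁻¹ * ZMod.stdAddChar (m * n) * exp (c ^ 2 / (4 * Real.pi)))
      (charOp_gauss v l (I * c) m)
  convert h using 1
  ext1
  · rw [fgauss_eq_sum, Prod.fst_sum]; rfl
  · change gaussFun c (I * v / (2 * Real.pi)) • fgauss (c - I * v) (n + l) = _
    rw [fgauss_eq_sum, Prod.snd_sum, Finset.smul_sum]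
    refine Finset.sum_congr rfl fun m _ => ?_
    simp only [Prod.smul_snd, smul_smul]
    have e0 : I * (c - I * v) = I * c + v := by rw [mul_sub, ← mul_assoc, I_mul_I]; ring
    have e1 : (ZMod.stdAddChar (m * (n + l)) : ℂ) =
        ZMod.stdAddChar (m * n) * ZMod.stdAddChar (l * m) := by
      rw [← AddChar.map_add_eq_mul]; congr 1; ring
    have e2 : gaussFun c (I * v / (2 * Real.pi)) * exp ((c - I * v) ^ 2 / (4 * Real.pi)) =
        exp (c ^ 2 / (4 * Real.pi)) := by
      rw [gaussFun, ← Complex.exp_add]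
      congr 1
      have : (I * v / (2 * Real.pi)) ^ 2 = - v ^ 2 / (4 * Real.pi ^ 2) := by
        rw [div_pow, mul_pow, I_sq]; ring
      have h3 : (c - I * v) ^ 2 = c ^ 2 - 2 * I * c * v - v ^ 2 := by
        ring_nf; rw [I_sq]; ring
      rw [this, h3]
      field_simp
      ring
    rw [e0, e1]
    congr 1
    linear_combination ((N : ℂ)⁻¹ * (ZMod.stdAddChar (m * n) * ZMod.stdAddChar (l * m))) * e2

/-- The Weyl commutation relations. -/
theorem weyl_comm {v w : ℂ} {l j : ZMod N} {f f₁ f₂ f₃ f₄ : Hil N}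
    (h₁ : (f, f₁) ∈ (charOp v l).graph) (h₂ : (f₁, f₂) ∈ (shiftOp w j).graph)
    (h₃ : (f, f₃) ∈ (shiftOp w j).graph) (h₄ : (f₃, f₄) ∈ (charOp v l).graph) :
    f₂ = (exp (v * w) * ZMod.stdAddChar (j * l)) • f₄ := by
  -- Nothing is needed of `f` beyond the existence of both products: all operators are moved onto a
  -- test Gaussian, where the relation is a computation.
  rw [← sub_eq_zero]
  refine eq_zero_of_inner_gauss fun c m => ?_
  rw [inner_sub_right, inner_smul_right,
    inner_shiftOp h₂ (shiftOp_gauss _ _ c m), inner_charOp h₄ (charOp_gauss _ _ c m),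
    inner_smul_left, inner_smul_left, inner_charOp h₁ (charOp_gauss _ _ _ _),
    inner_shiftOp h₃ (shiftOp_gauss _ _ _ _), inner_smul_left, inner_smul_left,
    conj_stdAddChar, conj_stdAddChar, conj_gaussFun, conj_gaussFun]
  have e1 : (ZMod.stdAddChar (-(-l * (m - -j))) : ℂ) =
      ZMod.stdAddChar (j * l) * ZMod.stdAddChar (-(-l * m)) := by
    rw [← AddChar.map_add_eq_mul]; congr 1; ring
  have e2 : c - 2 * Real.pi * -starRingEnd ℂ w + starRingEnd ℂ v =
      c + starRingEnd ℂ v - 2 * Real.pi * -starRingEnd ℂ w := by ring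
  have e3 : gaussFun (starRingEnd ℂ c) (starRingEnd ℂ (-starRingEnd ℂ w)) = exp (v * w) *
      gaussFun (starRingEnd ℂ (c + starRingEnd ℂ v)) (starRingEnd ℂ (-starRingEnd ℂ w)) := by
    rw [map_add, conj_conj, ← exp_mul_gaussFun, ← mul_assoc, ← Complex.exp_add]
    simp
  rw [e1, e2, e3]
  ring

/-! ### Powers of `u` and `y` as Weyl operators -/

/-- The sign of `m` in the symbols. -/
def sgn (t : Bool) : ℤ := if t then 1 else -1

theorem sym_eq (b : ℂ) (t : Bool) (x : ℝ) (m : ZMod N) :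
    sym N b t x m = exp (2 * Real.pi * par b t / N * x) * ZMod.stdAddChar ((sgn t : ZMod N) * m) := by
  have : ((sgn t : ZMod N) * m) = ((sgn t * m.val : ℤ) : ZMod N) := by simp
  rw [this, ZMod.stdAddChar_coe, sym, ← Complex.exp_add]
  congr 1
  have h2 : I * I = -1 := I_mul_I
  cases t <;> simp [sgn] <;> linear_combination (- 2 * Real.pi * par b _ / N * x) * h2

theorem sym_zpow (b : ℂ) (t : Bool) (k : ℤ) (x : ℝ) (m : ZMod N) :
    sym N b t x m ^ k = charSymbol (2 * Real.pi * k * par b t / N) ((k * sgn t : ℤ) : ZMod N) x m := by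
  rw [sym_eq, mul_zpow, ← Complex.exp_int_mul, charSymbol, ← AddChar.map_zsmul_eq_zpow]
  congr 2
  · ring
  · push_cast; rw [zsmul_eq_mul]; ring

theorem yPow_eq (b : ℂ) (t : Bool) (k : ℤ) :
    yPow N b t k = charOp (2 * Real.pi * k * par b t / N) (k * sgn t : ℤ) := by
  rw [yPow, charOp]; congr 1; funext x m; exact sym_zpow b t k x m

theorem uPow_eq (b : ℂ) (t : Bool) (k : ℤ) :
    uPow N b t k = shiftOp (I * k * par b t) (k * sgn t : ℤ) := by
  rw [uPow, fourierMulOp, shiftOp]; congr 2; funext x m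
  rw [sym_zpow, charSymbol, charSymbol]
  congr 2
  have hN : (N : ℂ) ≠ 0 := Nat.cast_ne_zero.2 (NeZero.ne N)
  push_cast
  field_simp
  linear_combination (-(k * par b t * x) : ℂ) * I_mul_I

/-- The Weyl phase of `u^k` and `y^l`: the continuous variable contributes the `b²` (tilded: `b⁻²`)
part of the exponent of `q`, the discrete variable the summand `1`. -/
theorem qpar_pow_eq (b : ℂ) (t : Bool) (k l : ℤ) :
    exp (2 * Real.pi * l * par b t / N * (I * k * par b t)) *
      ZMod.stdAddChar (((k * sgn t : ℤ) : ZMod N) * ((l * sgn t : ℤ) : ZMod N)) =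
      qpar N b t ^ (2 * (k * l)) := by
  rw [← Int.cast_mul, ZMod.stdAddChar_coe, ← Complex.exp_add, qpar, ← Complex.exp_int_mul]
  congr 1
  have : ((sgn t : ℤ) : ℂ) * sgn t = 1 := by cases t <;> simp [sgn]
  push_cast
  linear_combination (2 * Real.pi * I * k * l / N) * this

/-- Here the continuous phase involves `b b⁻¹ = 1`, and the opposite signs in the discrete variable
cancel it. -/
theorem mixed_comm_eq {b : ℂ} (hb : b ≠ 0) (t : Bool) (k l : ℤ) :
    exp (2 * Real.pi * l * par b t / N * (I * k * par b !t)) *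
      ZMod.stdAddChar (((k * sgn (!t) : ℤ) : ZMod N) * ((l * sgn t : ℤ) : ZMod N)) = 1 := by
  rw [← Int.cast_mul, ZMod.stdAddChar_coe, ← Complex.exp_add]
  have h1 : ((sgn !t : ℤ) : ℂ) * sgn t = -1 := by cases t <;> simp [sgn]
  have h2 : par b t * par b (!t) = 1 := by cases t <;> simp [par, hb]
  rw [← Complex.exp_zero]
  congr 1
  push_cast
  linear_combination (2 * Real.pi * I * k * l / N) * h1 + (2 * Real.pi * I * k * l / N) * h2

/-! ### Density of the common domain -/

/-- The linear combinations of Gaussians. -/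
def gaussSpan (N : ℕ) [NeZero N] : Submodule ℂ (Hil N) :=
  Submodule.span ℂ {f | ∃ c m, gauss c m = f}

theorem gauss_mem_gaussSpan (c : ℂ) (m : ZMod N) : gauss c m ∈ gaussSpan N :=
  Submodule.subset_span ⟨c, m, rfl⟩

theorem preserves_gaussSpan {A : Op N}
    (h : ∀ c m, ∃ g ∈ gaussSpan N, (gauss c m, g) ∈ A.graph) : Preserves (gaussSpan N) A := by
  intro f hf
  induction hf using Submodule.span_induction with
  | mem f hf => obtain ⟨c, m, rfl⟩ := hf; exact h c m
  | zero => exact ⟨0, Submodule.zero_mem _, A.graph.zero_mem⟩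
  | add f g _ _ hf hg =>
    obtain ⟨f', hf', h1⟩ := hf
    obtain ⟨g', hg', h2⟩ := hg
    exact ⟨f' + g', Submodule.add_mem _ hf' hg', A.graph.add_mem h1 h2⟩
  | smul k f _ hf =>
    obtain ⟨f', hf', h1⟩ := hf
    exact ⟨k • f', Submodule.smul_mem _ _ hf', A.graph.smul_mem k h1⟩

/-- The span of the Gaussians is one of the invariant subspaces whose supremum is `𝔇`. -/
theorem gaussSpan_le_commonDomain (b : ℂ) : gaussSpan N ≤ commonDomain N b := by
  refine le_sSup fun t k => ⟨?_, ?_⟩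
  · rw [uPow_eq]
    exact preserves_gaussSpan fun c m =>
      ⟨_, Submodule.smul_mem _ _ (gauss_mem_gaussSpan _ _), shiftOp_gauss _ _ c m⟩
  · rw [yPow_eq]
    exact preserves_gaussSpan fun c m =>
      ⟨_, Submodule.smul_mem _ _ (gauss_mem_gaussSpan _ _), charOp_gauss _ _ c m⟩

theorem dense_commonDomain (b : ℂ) : Dense (commonDomain N b : Set (Hil N)) := by
  refine Dense.mono (gaussSpan_le_commonDomain b) ?_
  rw [Submodule.dense_iff_topologicalClosure_eq_top, Submodule.topologicalClosure_eq_top_iff,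
    Submodule.eq_bot_iff]
  intro f hf
  exact eq_zero_of_inner_gauss fun c m =>
    (Submodule.mem_orthogonal _ _).1 hf _ (gauss_mem_gaussSpan c m)

end FlipQuantization

end

/-! ### The quantum torus on the common domain and its unitary conjugates. -/

noncomputable section

namespace FlipQuantization

open scoped ComplexInnerProductSpace

variable {N : ℕ}

/-! ### The Laurent polynomials as endomorphisms of the common domain -/

theorem restrictTo_graph {D : Submodule ℂ (Hil N)} {A : Op N} (hA : Preserves D A) (f : D) :
    ((f : Hil N), (restrictTo D A hA f : Hil N)) ∈ A.graph := by
  obtain ⟨g, -, hg⟩ := hA f f.2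
  rw [LinearPMap.mem_graph_iff]
  exact ⟨⟨f, LinearPMap.mem_domain_of_mem_graph hg⟩, rfl, rfl⟩

variable [NeZero N]

theorem charOp_comp {v v' : ℂ} {l l' : ZMod N} {f g h : Hil N} (h₁ : (f, g) ∈ (charOp v l).graph)
    (h₂ : (g, h) ∈ (charOp v' l').graph) : (f, h) ∈ (charOp (v + v') (l + l')).graph := by
  rw [charOp, mem_mulOp_graph] at *
  intro m
  filter_upwards [h₁ m, h₂ m] with x e1 e2
  rw [e2, e1, charSymbol, charSymbol, charSymbol, add_mul, add_mul, Complex.exp_add,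
    AddChar.map_add_eq_mul]
  ring

theorem charOp_zero (f : Hil N) : (f, f) ∈ (charOp (0 : ℂ) (0 : ZMod N)).graph := by
  rw [charOp, mem_mulOp_graph]
  exact fun m => Eventually.of_forall fun x => by simp [charSymbol]

theorem charOp_symm {v : ℂ} {l : ZMod N} {f g : Hil N} (h : (f, g) ∈ (charOp v l).graph) :
    (g, f) ∈ (charOp (-v) (-l)).graph := by
  rw [charOp, mem_mulOp_graph] at *
  intro m
  filter_upwards [h m] with x e1
  rw [e1, charSymbol, charSymbol, ← mul_assoc, mul_mul_mul_comm, ← Complex.exp_add,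
    ← AddChar.map_add_eq_mul]
  simp

theorem shiftOp_comp {w w' : ℂ} {j j' : ZMod N} {f g h : Hil N}
    (h₁ : (f, g) ∈ (shiftOp w j).graph) (h₂ : (g, h) ∈ (shiftOp w' j').graph) :
    (f, h) ∈ (shiftOp (w + w') (j + j')).graph := by
  rw [mem_shiftOp_graph] at *
  rw [mul_add]
  exact charOp_comp h₁ h₂

theorem shiftOp_zero (f : Hil N) : (f, f) ∈ (shiftOp (0 : ℂ) (0 : ZMod N)).graph := by
  rw [mem_shiftOp_graph, mul_zero]
  exact charOp_zero _

theorem shiftOp_symm {w : ℂ} {j : ZMod N} {f g : Hil N} (h : (f, g) ∈ (shiftOp w j).graph) :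
    (g, f) ∈ (shiftOp (-w) (-j)).graph := by
  rw [mem_shiftOp_graph] at *
  rw [mul_neg]
  exact charOp_symm h

theorem mem_uPow_neg {b : ℂ} {t : Bool} {k : ℤ} {f g : Hil N}
    (h : (f, g) ∈ (uPow N b t k).graph) : (g, f) ∈ (uPow N b t (-k)).graph := by
  rw [uPow_eq] at *
  convert shiftOp_symm h using 3 <;> push_cast <;> ring

theorem mem_yPow_neg {b : ℂ} {t : Bool} {k : ℤ} {f g : Hil N}
    (h : (f, g) ∈ (yPow N b t k).graph) : (g, f) ∈ (yPow N b t (-k)).graph := by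
  rw [yPow_eq] at *
  convert charOp_symm h using 3 <;> push_cast <;> ring

theorem mem_uPow_add {b : ℂ} {t : Bool} {k l : ℤ} {f g h : Hil N}
    (h₁ : (f, g) ∈ (uPow N b t l).graph) (h₂ : (g, h) ∈ (uPow N b t k).graph) :
    (f, h) ∈ (uPow N b t (k + l)).graph := by
  rw [uPow_eq] at *
  convert shiftOp_comp h₁ h₂ using 3 <;> push_cast <;> ring

theorem mem_yPow_add {b : ℂ} {t : Bool} {k l : ℤ} {f g h : Hil N}
    (h₁ : (f, g) ∈ (yPow N b t l).graph) (h₂ : (g, h) ∈ (yPow N b t k).graph) :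
    (f, h) ∈ (yPow N b t (k + l)).graph := by
  rw [yPow_eq] at *
  convert charOp_comp h₁ h₂ using 3 <;> push_cast <;> ring

theorem mem_uPow_zero (b : ℂ) (t : Bool) (f : Hil N) : (f, f) ∈ (uPow N b t 0).graph := by
  rw [uPow_eq]
  simpa using shiftOp_zero f

theorem mem_yPow_zero (b : ℂ) (t : Bool) (f : Hil N) : (f, f) ∈ (yPow N b t 0).graph := by
  rw [yPow_eq]
  simpa using charOp_zero f

/-- The powers of `u`, respectively `ũ`, on the common domain. -/
def uEnd (N : ℕ) [NeZero N] (b : ℂ) (t : Bool) (k : ℤ) : Module.End ℂ (commonDomain N b) :=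
  restrictTo (commonDomain N b) (uPow N b t k) (commonDomain_preserves b t k).1

/-- The powers of `y`, respectively `ỹ`, on the common domain. -/
def yEnd (N : ℕ) [NeZero N] (b : ℂ) (t : Bool) (k : ℤ) : Module.End ℂ (commonDomain N b) :=
  restrictTo (commonDomain N b) (yPow N b t k) (commonDomain_preserves b t k).2

/-- The exponentials `exp(α U + β Y + c)` on the common domain. -/
def expEnd (N : ℕ) [NeZero N] (b : ℂ) (t : Bool) (Z : LogCoord) :
    Module.End ℂ (commonDomain N b) :=
  restrictTo (commonDomain N b) (expOp N b t Z) (expOp_preserves b t Z)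

section

variable (b : ℂ) (t : Bool)

theorem uEnd_graph (k : ℤ) (f : commonDomain N b) :
    ((f : Hil N), (uEnd N b t k f : Hil N)) ∈ (uPow N b t k).graph :=
  restrictTo_graph _ f

theorem yEnd_graph (k : ℤ) (f : commonDomain N b) :
    ((f : Hil N), (yEnd N b t k f : Hil N)) ∈ (yPow N b t k).graph :=
  restrictTo_graph _ f

theorem expEnd_graph (Z : LogCoord) (f : commonDomain N b) :
    ((f : Hil N), (expEnd N b t Z f : Hil N)) ∈ (expOp N b t Z).graph :=
  restrictTo_graph _ f

theorem uEnd_mul (k l : ℤ) : uEnd N b t k * uEnd N b t l = uEnd N b t (k + l) :=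
  LinearMap.ext fun f => Subtype.ext <| graph_unique
    (mem_uPow_add (uEnd_graph b t l f) (uEnd_graph b t k (uEnd N b t l f)))
    (uEnd_graph b t (k + l) f)

theorem yEnd_mul (k l : ℤ) : yEnd N b t k * yEnd N b t l = yEnd N b t (k + l) :=
  LinearMap.ext fun f => Subtype.ext <| graph_unique
    (mem_yPow_add (yEnd_graph b t l f) (yEnd_graph b t k (yEnd N b t l f)))
    (yEnd_graph b t (k + l) f)

theorem uEnd_zero : uEnd N b t 0 = 1 :=
  LinearMap.ext fun f => Subtype.ext (graph_unique (uEnd_graph b t 0 f) (mem_uPow_zero b t _))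

theorem yEnd_zero : yEnd N b t 0 = 1 :=
  LinearMap.ext fun f => Subtype.ext (graph_unique (yEnd_graph b t 0 f) (mem_yPow_zero b t _))

theorem uEnd_mul_yEnd (k l : ℤ) :
    uEnd N b t k * yEnd N b t l = qpar N b t ^ (2 * (k * l)) • (yEnd N b t l * uEnd N b t k) := by
  refine LinearMap.ext fun f => Subtype.ext ?_
  have h₁ := yEnd_graph b t l f
  have h₂ := uEnd_graph b t k (yEnd N b t l f)
  have h₃ := uEnd_graph b t k f
  have h₄ := yEnd_graph b t l (uEnd N b t k f)
  rw [uPow_eq] at h₂ h₃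
  rw [yPow_eq] at h₁ h₄
  have := weyl_comm h₁ h₂ h₃ h₄
  rw [qpar_pow_eq] at this
  exact this

theorem qpar_ne_zero (N : ℕ) : qpar N b t ≠ 0 := Complex.exp_ne_zero _

theorem yEnd_mul_uEnd (k l : ℤ) :
    yEnd N b t l * uEnd N b t k = qpar N b t ^ (-(2 * (k * l))) • (uEnd N b t k * yEnd N b t l) := by
  rw [uEnd_mul_yEnd, smul_smul, ← zpow_add₀ (qpar_ne_zero b t N), neg_add_cancel, zpow_zero,
    one_smul]

theorem commute_uEnd_uEnd (t' : Bool) (k l : ℤ) : Commute (uEnd N b t k) (uEnd N b t' l) := by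
  refine LinearMap.ext fun f => Subtype.ext ?_
  have h₁ := uEnd_graph b t' l f
  have h₂ := uEnd_graph b t k (uEnd N b t' l f)
  have h₃ := uEnd_graph b t k f
  have h₄ := uEnd_graph b t' l (uEnd N b t k f)
  rw [uPow_eq] at h₁ h₂ h₃ h₄
  have h₅ := shiftOp_comp h₃ h₄
  rw [add_comm, add_comm ((k * sgn t : ℤ) : ZMod N)] at h₅
  exact graph_unique (shiftOp_comp h₁ h₂) h₅

theorem commute_yEnd_yEnd (t' : Bool) (k l : ℤ) : Commute (yEnd N b t k) (yEnd N b t' l) := by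
  refine LinearMap.ext fun f => Subtype.ext ?_
  have h₁ := yEnd_graph b t' l f
  have h₂ := yEnd_graph b t k (yEnd N b t' l f)
  have h₃ := yEnd_graph b t k f
  have h₄ := yEnd_graph b t' l (yEnd N b t k f)
  rw [yPow_eq] at h₁ h₂ h₃ h₄
  have h₅ := charOp_comp h₃ h₄
  rw [add_comm, add_comm ((k * sgn t : ℤ) : ZMod N)] at h₅
  exact graph_unique (charOp_comp h₁ h₂) h₅

variable {b} in
theorem commute_uEnd_yEnd (hb : b ≠ 0) (k l : ℤ) :
    Commute (uEnd N b (!t) k) (yEnd N b t l) := by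
  refine LinearMap.ext fun f => Subtype.ext ?_
  have h₁ := yEnd_graph b t l f
  have h₂ := uEnd_graph b (!t) k (yEnd N b t l f)
  have h₃ := uEnd_graph b (!t) k f
  have h₄ := yEnd_graph b t l (uEnd N b (!t) k f)
  rw [uPow_eq] at h₂ h₃
  rw [yPow_eq] at h₁ h₄
  have := weyl_comm h₁ h₂ h₃ h₄
  rw [mixed_comm_eq hb, one_smul] at this
  exact this

theorem expEnd_eq (Z : LogCoord) : expEnd N b t Z =
    (exp Z.2.2 * qpar N b t ^ (-(Z.1 * Z.2.1))) • (uEnd N b t Z.1 * yEnd N b t Z.2.1) := by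
  refine LinearMap.ext fun f => Subtype.ext ?_
  refine graph_unique (expEnd_graph b t Z f) ?_
  exact mem_smul_graph (mem_prodOp_graph (yEnd_graph b t _ f) (uEnd_graph b t _ _))

/-- The prefactor `q^{-αβ}` is the Weyl ordering; it turns the reordering phase into the
antisymmetric form `αβ' - βα'`. -/
theorem expEnd_mul (Z Z' : LogCoord) : expEnd N b t Z * expEnd N b t Z' =
    qpar N b t ^ (Z.1 * Z'.2.1 - Z.2.1 * Z'.1) • expEnd N b t (Z + Z') := by
  have hq := qpar_ne_zero b t N
  simp only [expEnd_eq, smul_mul_assoc, mul_smul_comm, smul_smul, Prod.fst_add, Prod.snd_add]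
  rw [mul_assoc (uEnd N b t Z.1), ← mul_assoc (yEnd N b t Z.2.1), yEnd_mul_uEnd,
    smul_mul_assoc, mul_smul_comm, smul_smul, mul_assoc (uEnd N b t _), yEnd_mul,
    ← mul_assoc (uEnd N b t _), uEnd_mul, Complex.exp_add]
  congr 1
  have e1 : qpar N b t ^ (Z.1 * Z'.2.1 - Z.2.1 * Z'.1) *
      qpar N b t ^ (-((Z.1 + Z'.1) * (Z.2.1 + Z'.2.1))) =
      qpar N b t ^ (-(Z.1 * Z.2.1)) * qpar N b t ^ (-(Z'.1 * Z'.2.1)) *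
      qpar N b t ^ (-(2 * (Z'.1 * Z.2.1))) := by
    rw [← zpow_add₀ hq, ← zpow_add₀ hq, ← zpow_add₀ hq]; congr 1; ring
  linear_combination (-exp Z.2.2 * exp Z'.2.2) * e1

theorem expEnd_zero : expEnd N b t 0 = 1 := by
  rw [expEnd_eq]; simp [uEnd_zero, yEnd_zero]

theorem expEnd_mul_neg (Z : LogCoord) : expEnd N b t Z * expEnd N b t (-Z) = 1 := by
  rw [expEnd_mul, add_neg_cancel, expEnd_zero]
  simp [mul_comm]

theorem expEnd_neg_mul (Z : LogCoord) : expEnd N b t (-Z) * expEnd N b t Z = 1 := by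
  have := expEnd_mul_neg (N := N) b t (-Z)
  rwa [neg_neg] at this

theorem isUnit_expEnd (Z : LogCoord) : IsUnit (expEnd N b t Z) :=
  ⟨⟨_, _, expEnd_mul_neg b t Z, expEnd_neg_mul b t Z⟩, rfl⟩

theorem ringInverse_expEnd (Z : LogCoord) :
    Ring.inverse (expEnd N b t Z) = expEnd N b t (-Z) :=
  left_inv_eq_right_inv (Ring.inverse_mul_cancel _ (isUnit_expEnd b t Z)) (expEnd_mul_neg b t Z)

theorem expEnd_comm (Z Z' : LogCoord) : expEnd N b t Z * expEnd N b t Z' =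
    qpar N b t ^ (2 * (Z.1 * Z'.2.1 - Z.2.1 * Z'.1)) • (expEnd N b t Z' * expEnd N b t Z) := by
  rw [expEnd_mul, expEnd_mul, smul_smul, ← zpow_add₀ (qpar_ne_zero b t N), add_comm Z' Z]
  congr 2; ring

variable {b} in
theorem commute_expEnd (hb : b ≠ 0) (Z Z' : LogCoord) :
    Commute (expEnd N b t Z) (expEnd N b (!t) Z') := by
  have h₁ : Commute (uEnd N b t Z.1) (yEnd N b (!t) Z'.2.1) := by
    have := commute_uEnd_yEnd (N := N) (!t) hb Z.1 Z'.2.1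
    rwa [Bool.not_not] at this
  have h₂ : Commute (yEnd N b t Z.2.1) (uEnd N b (!t) Z'.1) := (commute_uEnd_yEnd t hb _ _).symm
  have h : Commute (uEnd N b t Z.1 * yEnd N b t Z.2.1)
      (uEnd N b (!t) Z'.1 * yEnd N b (!t) Z'.2.1) :=
    ((commute_uEnd_uEnd b t (!t) _ _).mul_right h₁).mul_left
      (h₂.mul_right (commute_yEnd_yEnd b t (!t) _ _))
  rw [commute_iff_eq, expEnd_eq, expEnd_eq, smul_mul_smul_comm, smul_mul_smul_comm, h.eq,
    mul_comm (exp Z.2.2 * _)]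

end

/-! ### Conjugates of the exponentials -/

theorem expOp_injective (b : ℂ) (t : Bool) (Z : LogCoord) {f : Hil N}
    (h : (f, (0 : Hil N)) ∈ (expOp N b t Z).graph) : f = 0 := by
  rw [expOp, mem_smul_graph_iff (mul_ne_zero (Complex.exp_ne_zero _)
    (zpow_ne_zero _ (qpar_ne_zero b t N))), smul_zero, mem_prodOp_graph_iff] at h
  obtain ⟨g, h₁, h₂⟩ := h
  have hg : g = 0 := graph_unique (mem_uPow_neg h₂) (Submodule.zero_mem _)
  rw [hg] at h₁
  exact graph_unique (mem_yPow_neg h₁) (Submodule.zero_mem _)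

section

variable (b : ℂ) (t : Bool) (V : Hil N ≃ₗᵢ[ℂ] Hil N)

theorem mem_conj_graph {A : Op N} {f g : Hil N} (h : (f, g) ∈ A.graph) :
    (V f, V g) ∈ (conjOp V.toLinearEquiv A).graph := by
  rw [mem_conjOp_graph]
  convert h <;> exact V.symm_apply_apply _

theorem ker_conj_expOp (Z : LogCoord) :
    LinearMap.ker (conjOp V.toLinearEquiv (expOp N b t Z)).toFun = ⊥ := by
  refine ker_eq_bot_of_graph fun f hf => ?_
  rw [mem_conjOp_graph, map_zero] at hf
  exact V.toLinearEquiv.symm.map_eq_zero_iff.1 (expOp_injective b t Z hf)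

theorem preserves_conj_expOp (Z : LogCoord) :
    Preserves ((commonDomain N b).map V.toLinearEquiv.toLinearMap)
      (conjOp V.toLinearEquiv (expOp N b t Z)) := by
  rintro _ ⟨f, hf, rfl⟩
  exact ⟨_, ⟨expEnd N b t Z ⟨f, hf⟩, (expEnd N b t Z ⟨f, hf⟩).2, rfl⟩,
    mem_conj_graph V (expEnd_graph b t Z ⟨f, hf⟩)⟩

theorem preserves_conj_expOp_inverse (Z : LogCoord) :
    Preserves ((commonDomain N b).map V.toLinearEquiv.toLinearMap)
      (conjOp V.toLinearEquiv (expOp N b t Z)).inverse := by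
  rintro _ ⟨f, hf, rfl⟩
  refine ⟨_, ⟨expEnd N b t (-Z) ⟨f, hf⟩, (expEnd N b t (-Z) ⟨f, hf⟩).2, rfl⟩, ?_⟩
  rw [mem_inverse_graph_iff (ker_conj_expOp b t V Z)]
  refine mem_conj_graph V ?_
  have h := expEnd_graph b t Z (expEnd N b t (-Z) ⟨f, hf⟩)
  rw [← Module.End.mul_apply, expEnd_mul_neg] at h
  exact h

/-- Relations between endomorphisms of `𝔇` are enough, since both products are then defined on all
of `𝔇` and `V` transports their graphs. -/
theorem qCommuteOn_conj {A B : Op N} {A' B' : Module.End ℂ (commonDomain N b)} {k : ℂ}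
    (hA : ∀ f : commonDomain N b, ((f : Hil N), (A' f : Hil N)) ∈ A.graph)
    (hB : ∀ f : commonDomain N b, ((f : Hil N), (B' f : Hil N)) ∈ B.graph) (h : A' * B' = k • (B' * A')) :
    QCommuteOn ((commonDomain N b).map V.toLinearEquiv.toLinearMap)
      (conjOp V.toLinearEquiv A) (conjOp V.toLinearEquiv B) k := by
  rintro _ ⟨f, hf, rfl⟩
  refine ⟨V (B' (A' ⟨f, hf⟩) : Hil N), ?_, ?_⟩
  · exact mem_prodOp_graph (mem_conj_graph V (hA ⟨f, hf⟩)) (mem_conj_graph V (hB _))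
  · have e : k • V (B' (A' ⟨f, hf⟩) : Hil N) = V (A' (B' ⟨f, hf⟩) : Hil N) := by
      rw [← Module.End.mul_apply A', h, ← map_smul]
      rfl
    rw [e]
    exact mem_prodOp_graph (mem_conj_graph V (hB ⟨f, hf⟩)) (mem_conj_graph V (hA _))

end

theorem i3_logZ_fst (L : Fin 4 → ℂ) (a : Fin 6) :
    (i3 (logZ L) a).1 = (![-1, 0, -1, 1, 1, 0] : Fin 6 → ℤ) a := by
  fin_cases a <;> simp [i3, logZ, eps_eq, logU, logY, const]

theorem i3_logZ_snd (L : Fin 4 → ℂ) (a : Fin 6) :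
    (i3 (logZ L) a).2.1 = (![0, 1, 0, -1, -1, 1] : Fin 6 → ℤ) a := by
  fin_cases a <;> simp [i3, logZ, eps_eq, logU, logY, const]

/-- Under `i_3` the edges `4` and `5` acquire a summand `U` and the edge `3` changes sign. The
symplectic form of the resulting exponents is the exchange matrix of the flipped triangulation, by a
check of all 36 pairs. -/
theorem eps'_eq_symplectic (L : Fin 4 → ℂ) (a c : Fin 6) :
    (i3 (logZ L) a).1 * (i3 (logZ L) c).2.1 - (i3 (logZ L) a).2.1 * (i3 (logZ L) c).1 =
      eps' a c := by
  simp only [i3_logZ_fst, i3_logZ_snd, eps'_eq]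
  revert a c
  decide

end FlipQuantization

end

/-! ### The infinite product, and unitarity of the quantum dilogarithm. -/

noncomputable section

namespace FlipQuantization

open scoped ComplexInnerProductSpace

/-! ### The infinite product -/

/-- The entire function `∏_{j ≥ 0} (1 + q^{2j+1} y)`. -/
def qProd (q y : ℂ) : ℂ := ∏' j : ℕ, (1 + q ^ (2 * j + 1) * y)

section qProd

variable {q : ℂ}

theorem summable_norm_qPow (hq : ‖q‖ < 1) : Summable fun j : ℕ => ‖q‖ ^ (2 * j + 1) := by
  have h := (summable_geometric_of_lt_one (sq_nonneg ‖q‖)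
    (pow_lt_one₀ (norm_nonneg q) hq two_ne_zero)).mul_left ‖q‖
  exact h.congr fun j => by rw [← pow_mul, pow_succ']

theorem summable_qProd (hq : ‖q‖ < 1) (y : ℂ) : Summable fun j : ℕ => ‖q ^ (2 * j + 1) * y‖ :=
  ((summable_norm_qPow hq).mul_right ‖y‖).congr fun j => by rw [norm_mul, norm_pow]

theorem multipliable_qProd (hq : ‖q‖ < 1) (y : ℂ) :
    Multipliable fun j : ℕ => 1 + q ^ (2 * j + 1) * y :=
  multipliable_one_add_of_summable (summable_qProd hq y)

theorem differentiable_qProd (hq : ‖q‖ < 1) : Differentiable ℂ (qProd q) := by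
  have h : HasProdLocallyUniformlyOn (fun (j : ℕ) (y : ℂ) => 1 + q ^ (2 * j + 1) * y)
      (qProd q) Set.univ := by
    apply hasProdLocallyUniformlyOn_of_forall_compact isOpen_univ
    intro K _ hK
    obtain ⟨C, hC⟩ := hK.isBounded.exists_norm_le
    exact ((summable_norm_qPow hq).mul_right C).hasProdUniformlyOn_nat_one_add hK
      (Eventually.of_forall fun j y hy => by
        rw [norm_mul, norm_pow]
        exact mul_le_mul_of_nonneg_left (hC y hy) (by positivity)) (fun _ => by fun_prop)
  rw [← differentiableOn_univ]
  refine h.differentiableOn (.of_forall fun s => ?_) isOpen_univ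
  simpa [Finset.prod_fn] using DifferentiableOn.finsetProd (fun _ _ => by fun_prop)

theorem qProd_eq_zero_iff (hq : ‖q‖ < 1) {y : ℂ} :
    qProd q y = 0 ↔ ∃ j : ℕ, 1 + q ^ (2 * j + 1) * y = 0 := by
  constructor
  · intro h
    by_contra! hne
    exact tprod_one_add_ne_zero_of_summable hne (summable_qProd hq y) h
  · rintro ⟨j, hj⟩
    exact (hasProd_zero_of_exists_eq_zero ⟨j, hj⟩).tprod_eq

theorem qProd_ne_zero_of_norm_le_one (hq : ‖q‖ < 1) {y : ℂ} (hy : ‖y‖ ≤ 1) : qProd q y ≠ 0 := by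
  rw [Ne, qProd_eq_zero_iff hq]
  rintro ⟨j, hj⟩
  have h1 : ‖q ^ (2 * j + 1) * y‖ = 1 := by
    rw [eq_neg_of_add_eq_zero_right hj, norm_neg, norm_one]
  rw [norm_mul, norm_pow] at h1
  have h2 := pow_lt_one₀ (norm_nonneg q) hq (Nat.succ_ne_zero (2 * j))
  have h3 : 0 ≤ ‖q‖ ^ (2 * j + 1) := by positivity
  have h4 : ‖q‖ ^ (2 * j + 1) < 1 := h2
  have := mul_le_of_le_one_right h3 hy
  rw [h1] at this
  exact absurd this (not_le.2 h4)

theorem conj_qProd (hq : ‖q‖ < 1) (y : ℂ) :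
    starRingEnd ℂ (qProd q y) = qProd (starRingEnd ℂ q) (starRingEnd ℂ y) := by
  have := (multipliable_qProd hq y).map_tprod (starRingEnd ℂ) continuous_conj
  rw [qProd, this, qProd]
  simp

theorem qProd_eq_mul (hq : ‖q‖ < 1) (y : ℂ) : qProd q y = (1 + q * y) * qProd q (q ^ 2 * y) := by
  rw [qProd, tprod_eq_zero_mul' ?_]
  · simp only [mul_zero, zero_add, pow_one, qProd]
    congr 2; funext j; ring
  · refine (multipliable_qProd hq (q ^ 2 * y)).congr fun j => ?_
    ring

/-- The zeros are simple: the functional equation pulls a zero back to the one at `1 + q y = 0`,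
where the remaining product is evaluated at `-q`, inside the zero-free unit disc. -/
theorem deriv_qProd_ne_zero (hq : ‖q‖ < 1) (hq0 : q ≠ 0) {y : ℂ} (hy : qProd q y = 0) :
    deriv (qProd q) y ≠ 0 := by
  obtain ⟨j, hj⟩ := (qProd_eq_zero_iff hq).1 hy
  have hd : ∀ y, deriv (qProd q) y =
      q * qProd q (q ^ 2 * y) + (1 + q * y) * (q ^ 2 * deriv (qProd q) (q ^ 2 * y)) := by
    intro y
    have e : qProd q = fun y => (1 + q * y) * qProd q (q ^ 2 * y) := funext (qProd_eq_mul hq)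
    have h1 : HasDerivAt (fun y : ℂ => 1 + q * y) q y := by
      simpa using ((hasDerivAt_id y).const_mul q).const_add 1
    have h2 : HasDerivAt (fun y : ℂ => q ^ 2 * y) (q ^ 2) y := by
      simpa using (hasDerivAt_id y).const_mul (q ^ 2)
    have h3 := ((differentiable_qProd hq) (q ^ 2 * y)).hasDerivAt.comp y h2
    conv_lhs => rw [e]
    refine (h1.mul h3).deriv.trans ?_
    simp only [Function.comp]
    ring
  clear hy
  induction j generalizing y with
  | zero =>
    have h0 : 1 + q * y = 0 := by simpa using hj
    rw [hd, h0, zero_mul, add_zero]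
    refine mul_ne_zero hq0 (qProd_ne_zero_of_norm_le_one hq ?_)
    have : q ^ 2 * y = -q := by linear_combination q * h0
    rw [this, norm_neg]; exact hq.le
  | succ j ih =>
    have h1 : 1 + q ^ (2 * j + 1) * (q ^ 2 * y) = 0 := by rw [← hj]; ring
    have h2 : qProd q (q ^ 2 * y) = 0 := (qProd_eq_zero_iff hq).2 ⟨j, h1⟩
    rw [hd, h2, mul_zero, zero_add]
    -- Two factors vanishing at the same `y` would force a positive power of `q` to be `1`.
    refine mul_ne_zero (fun h0 => ?_) (mul_ne_zero (pow_ne_zero _ hq0) (ih h1))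
    have h3 : q ^ (2 * j + 2) = 1 := by linear_combination q ^ (2 * j + 2) * h0 - hj
    have h4 : ‖q‖ ^ (2 * j + 2) = 1 := by rw [← norm_pow, h3, norm_one]
    have h5 : ‖q‖ ^ (2 * j + 2) < 1 := pow_lt_one₀ (norm_nonneg q) hq (by omega)
    exact h5.ne h4

end qProd

variable {N : ℕ} [NeZero N]

theorem natCast_pos_real (N : ℕ) [NeZero N] : (0 : ℝ) < N := Nat.cast_pos.2 (NeZero.pos N)

section

variable {b : ℂ}

/-- The real part of `i (b² + 1)` is `-2 Re b Im b`, so `b` in the open first quadrant makes the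
products converge. -/
theorem norm_qpar_false (hre : 0 < b.re) (him : 0 < b.im) : ‖qpar N b false‖ < 1 := by
  have hN := natCast_pos_real N
  rw [qpar, Complex.norm_exp, Real.exp_lt_one_iff]
  have e : (Real.pi * I / N * ((par b false) ^ 2 + 1)) =
      ((Real.pi / N : ℝ) : ℂ) * (I * (b ^ 2 + 1)) := by
    simp [par]; ring
  rw [e, re_ofReal_mul]
  have h2 : (I * (b ^ 2 + 1)).re = -(2 * (b.re * b.im)) := by
    simp [pow_two]; ring
  rw [h2]
  have : 0 < Real.pi / N := div_pos Real.pi_pos hN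
  nlinarith [mul_pos hre him, mul_pos this (mul_pos hre him)]

theorem inv_eq_conj_of_norm_one (hb : ‖b‖ = 1) : b⁻¹ = starRingEnd ℂ b := by
  rw [Complex.inv_def, Complex.normSq_eq_norm_sq, hb]; simp

omit [NeZero N] in
-- On the unit circle `b⁻¹ = conj b`, and conjugation also reverses the sign of `i`. Thus `q̃⁻¹` is
-- the conjugate of `q`, and the denominator of the dilogarithm converges together with the
-- numerator.
theorem inv_qpar_not (hb : ‖b‖ = 1) (t : Bool) :
    (qpar N b (!t))⁻¹ = starRingEnd ℂ (qpar N b t) := by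
  have h1 : par b (!t) = starRingEnd ℂ (par b t) := by
    cases t
    · simpa [par] using inv_eq_conj_of_norm_one hb
    · simp [par, inv_eq_conj_of_norm_one hb]
  rw [qpar, qpar, ← Complex.exp_neg, ← Complex.exp_conj, h1]
  congr 1
  simp [neg_div]

theorem norm_sym (t : Bool) (x : ℝ) (m : ZMod N) :
    ‖sym N b t x m‖ = Real.exp (2 * Real.pi * (par b t).re / N * x) := by
  rw [sym_eq, norm_mul, AddChar.norm_apply, mul_one, Complex.norm_exp]
  congr 1
  have : (2 * Real.pi * par b t / N * x : ℂ) = ((2 * Real.pi / N * x : ℝ) : ℂ) * par b t := by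
    push_cast; ring
  rw [this, re_ofReal_mul]; ring

theorem par_not (hb : ‖b‖ = 1) (t : Bool) : par b (!t) = starRingEnd ℂ (par b t) := by
  cases t
  · simpa [par] using inv_eq_conj_of_norm_one hb
  · simp [par, inv_eq_conj_of_norm_one hb]

theorem sgn_not (t : Bool) : sgn (!t) = -sgn t := by cases t <;> rfl

theorem conj_sym (hb : ‖b‖ = 1) (t : Bool) (x : ℝ) (m : ZMod N) :
    starRingEnd ℂ (sym N b t x m) = sym N b (!t) x m := by
  rw [sym_eq, sym_eq, map_mul, conj_stdAddChar, ← Complex.exp_conj, par_not hb, sgn_not]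
  have : starRingEnd ℂ 2 = 2 := map_ofNat _ 2
  simp [this]

omit [NeZero N] in
theorem conj_z3coeff (L : Fin 4 → ℂ) (t : Bool) :
    starRingEnd ℂ (z3coeff L t) = z3coeff L (!t) := by
  cases t <;> simp [z3coeff, lift, ← Complex.exp_conj]

theorem z3coeff_ne_zero (L : Fin 4 → ℂ) (t : Bool) : z3coeff L t ≠ 0 := by
  simp [z3coeff, Complex.exp_ne_zero]

/-- The symbol of the operator `φ(-z_3, -z̃_3)`. -/
def dilogSymbol (N : ℕ) (b : ℂ) (L : Fin 4 → ℂ) (ν : ℝ) (n : ZMod N) : ℂ :=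
  dilog N b (-(z3coeff L false * sym N b false ν n)) (-(z3coeff L true * sym N b true ν n))

theorem dilogSymbol_eq (hb : ‖b‖ = 1) (hre : 0 < b.re) (him : 0 < b.im) (L : Fin 4 → ℂ) (ν : ℝ)
    (n : ZMod N) : dilogSymbol N b L ν n =
      (qProd (qpar N b false) (-(z3coeff L false * sym N b false ν n)) / starRingEnd ℂ
        (qProd (qpar N b false) (-(z3coeff L false * sym N b false ν n))))⁻¹ := by
  rw [conj_qProd (norm_qpar_false hre him), ← inv_qpar_not hb, map_neg, map_mul, conj_sym hb,
    conj_z3coeff]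
  rfl

omit [NeZero N] in
theorem continuous_sym (t : Bool) (n : ZMod N) : Continuous fun ν : ℝ => sym N b t ν n := by
  unfold sym; fun_prop

theorem measurable_dilogSymbol (hb : ‖b‖ = 1) (hre : 0 < b.re) (him : 0 < b.im) (L : Fin 4 → ℂ)
    (n : ZMod N) : Measurable fun ν => dilogSymbol N b L ν n := by
  simp only [dilogSymbol_eq hb hre him]
  have : Continuous fun ν : ℝ =>
      qProd (qpar N b false) (-(z3coeff L false * sym N b false ν n)) :=
    (differentiable_qProd (norm_qpar_false hre him)).continuous.comp
      (continuous_const.mul (continuous_sym false n)).neg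
  exact (this.measurable.div (continuous_conj.comp this).measurable).inv

/-- The modulus of the symbol of `u` is strictly monotone in `ν`, so each factor of the product
vanishes at most once. -/
theorem countable_zeros (hre : 0 < b.re) (him : 0 < b.im) (L : Fin 4 → ℂ) (n : ZMod N) :
    {ν : ℝ | qProd (qpar N b false) (-(z3coeff L false * sym N b false ν n)) = 0}.Countable := by
  have hN := natCast_pos_real N
  simp only [qProd_eq_zero_iff (norm_qpar_false hre him), Set.ofPred_exists]
  refine Set.countable_iUnion fun j => Set.Subsingleton.countable fun x hx y hy => ?_
  simp only [Set.mem_ofPred_eq] at hx hy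
  have h1 : sym N b false x n = sym N b false y n := by
    have hc : qpar N b false ^ (2 * j + 1) * z3coeff L false ≠ 0 :=
      mul_ne_zero (pow_ne_zero _ (qpar_ne_zero _ _ _)) (z3coeff_ne_zero _ _)
    apply mul_left_cancel₀ hc
    linear_combination hy - hx
  have h2 := congrArg norm h1
  rw [norm_sym, norm_sym, Real.exp_eq_exp] at h2
  have h3 : 2 * Real.pi * (par b false).re / N ≠ 0 := by
    have : 0 < (par b false).re := by simpa [par] using hre
    have := Real.pi_pos
    positivity
  exact mul_left_cancel₀ h3 h2

theorem norm_dilogSymbol_ae (hb : ‖b‖ = 1) (hre : 0 < b.re) (him : 0 < b.im) (L : Fin 4 → ℂ)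
    (n : ZMod N) : ∀ᵐ ξ : ℝ, ‖dilogSymbol N b L (-(N * ξ)) n‖ = 1 := by
  have hN := natCast_pos_real N
  have hc := (countable_zeros (N := N) hre him L n).preimage (f := fun ξ : ℝ => -(N * ξ))
    (fun x y h => mul_left_cancel₀ hN.ne' (neg_injective h))
  filter_upwards [hc.ae_notMem volume] with ξ hξ
  have h0 : qProd (qpar N b false) (-(z3coeff L false * sym N b false (-(N * ξ)) n)) ≠ 0 := hξ
  rw [dilogSymbol_eq hb hre him, norm_inv, norm_div, RCLike.norm_conj,
    div_self (norm_ne_zero_iff.2 h0), inv_one]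

end

/-! ### Unitary multiplication operators -/

omit [NeZero N] in
theorem exists_mem_mulOp_graph {s : ℝ → ZMod N → ℂ} (hm : ∀ n, Measurable fun x => s x n)
    (h1 : ∀ n, ∀ᵐ x : ℝ, ‖s x n‖ = 1) (f : Hil N) : ∃ g, (f, g) ∈ (mulOp s).graph := by
  have hL : ∀ n, MemLp (fun x => s x n * f n x) 2 volume := fun n =>
    (Lp.memLp (f n)).of_le ((hm n).aestronglyMeasurable.mul (Lp.aestronglyMeasurable _)) (by
      filter_upwards [h1 n] with x hx
      rw [norm_mul, hx, one_mul])
  refine ⟨WithLp.toLp 2 fun n => (hL n).toLp, ?_⟩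
  rw [mem_mulOp_graph]
  exact fun n => (hL n).coeFn_toLp

theorem norm_eq_of_mem_mulOp_graph {s : ℝ → ZMod N → ℂ} (h1 : ∀ n, ∀ᵐ x : ℝ, ‖s x n‖ = 1)
    {f g : Hil N} (h : (f, g) ∈ (mulOp s).graph) : ‖g‖ = ‖f‖ := by
  rw [mem_mulOp_graph] at h
  rw [PiLp.norm_eq_of_L2, PiLp.norm_eq_of_L2]
  congr 1
  refine Finset.sum_congr rfl fun n _ => ?_
  congr 1
  have e : ∀ᵐ x : ℝ, ‖g n x‖ = ‖f n x‖ := by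
    filter_upwards [h n, h1 n] with x hx h1
    rw [hx, norm_mul, h1, one_mul]
  exact le_antisymm (Lp.norm_le_norm_of_ae_le (e.mono fun _ h => h.le))
    (Lp.norm_le_norm_of_ae_le (e.mono fun _ h => h.ge))

theorem exists_linearIsometryEquiv_of_graph {A : Op N} (h1 : ∀ f, ∃ g, (f, g) ∈ A.graph)
    (h2 : ∀ g, ∃ f, (f, g) ∈ A.graph) (h3 : ∀ f g, (f, g) ∈ A.graph → ‖g‖ = ‖f‖) :
    ∃ V : Hil N ≃ₗᵢ[ℂ] Hil N, V.toLinearEquiv.toLinearMap.toPMap ⊤ = A ∧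
      ∀ f, (f, V f) ∈ A.graph := by
  choose v hv using h1
  let V₀ : Hil N →ₗᵢ[ℂ] Hil N :=
    { toFun := v
      map_add' := fun f g => graph_unique (hv _) (A.graph.add_mem (hv f) (hv g))
      map_smul' := fun c f => graph_unique (hv _) (A.graph.smul_mem c (hv f))
      norm_map' := fun f => h3 _ _ (hv f) }
  have hs : Function.Surjective V₀ := fun g => by
    obtain ⟨f, hf⟩ := h2 g
    exact ⟨f, graph_unique (hv f) hf⟩
  refine ⟨LinearIsometryEquiv.ofSurjective V₀ hs, op_ext fun f g => ?_, hv⟩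
  constructor
  · intro h
    rw [LinearPMap.mem_graph_iff] at h
    obtain ⟨x, rfl, rfl⟩ := h
    exact hv x
  · intro h
    rw [LinearPMap.mem_graph_iff]
    exact ⟨⟨f, trivial⟩, rfl, graph_unique (hv f) h⟩

theorem exists_unitary_fourierMulOp {s : ℝ → ZMod N → ℂ} (hm : ∀ n, Measurable fun x => s x n)
    (h1 : ∀ n, ∀ᵐ ξ : ℝ, ‖s (-(N * ξ)) n‖ = 1) :
    ∃ V : Hil N ≃ₗᵢ[ℂ] Hil N, V.toLinearEquiv.toLinearMap.toPMap ⊤ = fourierMulOp s ∧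
      ∀ f, (f, V f) ∈ (fourierMulOp s).graph := by
  have hN := natCast_pos_real N
  have hm' : ∀ n, Measurable fun ξ : ℝ => s (-(N * ξ)) n := fun n =>
    (hm n).comp (by fun_prop)
  refine exists_linearIsometryEquiv_of_graph (fun f => ?_) (fun g => ?_) fun f g h => ?_
  · obtain ⟨g, hg⟩ := exists_mem_mulOp_graph hm' h1 (fourierHil N f)
    refine ⟨(fourierHil N).symm g, ?_⟩
    rw [mem_fourierMulOp_graph, LinearEquiv.apply_symm_apply]
    exact hg
  · obtain ⟨f, hf⟩ := exists_mem_mulOp_graph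
      (s := conjSymbol fun ξ n => s (-(N * ξ)) n)
      (fun n => continuous_conj.measurable.comp (hm' n))
      (fun n => by simpa [conjSymbol] using h1 n) (fourierHil N g)
    refine ⟨(fourierHil N).symm f, ?_⟩
    rw [mem_fourierMulOp_graph, LinearEquiv.apply_symm_apply]
    rw [mem_mulOp_graph] at hf ⊢
    intro n
    filter_upwards [hf n, h1 n] with ξ e1 e2
    rw [e1, conjSymbol, ← mul_assoc, Complex.mul_conj, Complex.normSq_eq_norm_sq, e2]
    simp
  · rw [mem_fourierMulOp_graph] at h
    have h2 := norm_eq_of_mem_mulOp_graph h1 h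
    have h3 := norm_fourierHil f
    rw [← h2, norm_fourierHil] at h3
    -- The factor `N` of the unnormalized Fourier transform occurs on both sides.
    have h4 := mul_left_cancel₀ hN.ne' h3
    exact (sq_eq_sq₀ (norm_nonneg _) (norm_nonneg _)).1 h4

theorem exists_unitary_dilogOp {b : ℂ} (hb : ‖b‖ = 1) (hre : 0 < b.re) (him : 0 < b.im)
    (L : Fin 4 → ℂ) :
    ∃ V : Hil N ≃ₗᵢ[ℂ] Hil N, V.toLinearEquiv.toLinearMap.toPMap ⊤ = dilogOp N b L ∧
      ∀ f, (f, V f) ∈ (fourierMulOp (dilogSymbol N b L)).graph :=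
  exists_unitary_fourierMulOp (measurable_dilogSymbol hb hre him L)
    (norm_dilogSymbol_ae hb hre him L)

/-! ### The operators that commute with `V` -/

/-- Both operators are multiplications on the Fourier side, and the symbol of `V` vanishes almost
nowhere. Hence they commute with equality of domains, not merely on a core. -/
theorem mem_fourierMulOp_graph_iff_of_unitary {s r : ℝ → ZMod N → ℂ} {V : Hil N ≃ₗᵢ[ℂ] Hil N}
    (hV : ∀ f, (f, V f) ∈ (fourierMulOp s).graph)
    (h1 : ∀ n, ∀ᵐ ξ : ℝ, ‖s (-(N * ξ)) n‖ = 1) {f g : Hil N} :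
    (V f, V g) ∈ (fourierMulOp r).graph ↔ (f, g) ∈ (fourierMulOp r).graph := by
  have hV' := fun f n => mem_mulOp_graph.1 (mem_fourierMulOp_graph.1 (hV f)) n
  simp only [mem_fourierMulOp_graph, mem_mulOp_graph]
  refine forall_congr' fun n => ?_
  have h0 : ∀ᵐ ξ : ℝ, s (-(N * ξ)) n ≠ 0 := (h1 n).mono fun ξ h h0 => by simp [h0] at h
  constructor <;> intro h
  · filter_upwards [h, hV' f n, hV' g n, h0] with ξ e1 e2 e3 e0
    rw [e2, e3] at e1
    apply mul_left_cancel₀ e0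
    linear_combination e1
  · filter_upwards [h, hV' f n, hV' g n] with ξ e1 e2 e3
    rw [e2, e3, e1]; ring

theorem mem_expOp_graph_of_snd_eq_zero {b : ℂ} {t : Bool} {Z : LogCoord} (hZ : Z.2.1 = 0)
    {f g : Hil N} :
    (f, g) ∈ (expOp N b t Z).graph ↔ (f, (exp Z.2.2)⁻¹ • g) ∈ (uPow N b t Z.1).graph := by
  rw [expOp, hZ, mul_zero, neg_zero, zpow_zero, mul_one, mem_smul_graph_iff (Complex.exp_ne_zero _),
    mem_prodOp_graph_iff]
  constructor
  · rintro ⟨g', h1, h2⟩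
    rwa [graph_unique (mem_yPow_zero b t f) h1]
  · exact fun h => ⟨f, mem_yPow_zero b t f, h⟩

theorem conjOp_expOp_of_snd_eq_zero {s : ℝ → ZMod N → ℂ} {V : Hil N ≃ₗᵢ[ℂ] Hil N}
    (hV : ∀ f, (f, V f) ∈ (fourierMulOp s).graph)
    (h1 : ∀ n, ∀ᵐ ξ : ℝ, ‖s (-(N * ξ)) n‖ = 1) {b : ℂ} {t : Bool} {Z : LogCoord}
    (hZ : Z.2.1 = 0) : conjOp V.toLinearEquiv (expOp N b t Z) = expOp N b t Z := by
  refine op_ext fun f g => ?_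
  rw [mem_conjOp_graph, mem_expOp_graph_of_snd_eq_zero hZ, mem_expOp_graph_of_snd_eq_zero hZ,
    uPow, ← map_smul, ← mem_fourierMulOp_graph_iff_of_unitary hV h1]
  simp

theorem inverse_expOp_of_snd_eq_zero {b : ℂ} {t : Bool} {Z Z' : LogCoord} (hZ : Z.2.1 = 0)
    (hZ' : Z'.2.1 = 0) (h1 : Z'.1 = -Z.1) (hc : exp Z.2.2 * exp Z'.2.2 = 1) :
    (expOp N b t Z).inverse = expOp N b t Z' := by
  refine op_ext fun f g => ?_
  rw [mem_inverse_graph_iff (ker_eq_bot_of_graph fun f => expOp_injective b t Z),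
    mem_expOp_graph_of_snd_eq_zero hZ, mem_expOp_graph_of_snd_eq_zero hZ', h1,
    ← eq_inv_of_mul_eq_one_left hc]
  have hne := Complex.exp_ne_zero Z.2.2
  constructor
  · intro h
    have := (uPow N b t (-Z.1)).graph.smul_mem (exp Z.2.2) (mem_uPow_neg h)
    simpa [smul_smul, hne] using this
  · intro h
    have := (uPow N b t (- -Z.1)).graph.smul_mem (exp Z.2.2)⁻¹ (mem_uPow_neg h)
    simpa [smul_smul, hne] using this

end FlipQuantization

end

/-! ### Singularities and growth of the dilogarithm ratio in the strip `-Re b ≤ Im z ≤ 0`. -/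

noncomputable section

namespace FlipQuantization

/-! ### Analytic continuation of the quantum dilogarithm to a strip -/

variable {N : ℕ} [NeZero N]

/-- The symbols of `u` and `ũ` as entire functions. -/
def csym (N : ℕ) [NeZero N] (b : ℂ) (t : Bool) (z : ℂ) (n : ZMod N) : ℂ :=
  exp (2 * Real.pi * par b t / N * z) * ZMod.stdAddChar ((sgn t : ZMod N) * n)

/-- The ratio of infinite products `∏ (1 - q^{2j+1} u) / ∏ (1 - q̃^{-2j-1} ũ)`. -/
def dilogRatio (N : ℕ) [NeZero N] (b z : ℂ) (n : ZMod N) : ℂ :=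
  qProd (qpar N b false) (-csym N b false z n) /
    qProd (starRingEnd ℂ (qpar N b false)) (-csym N b true z n)

section

variable (b : ℂ)

theorem differentiable_csym (t : Bool) (n : ZMod N) :
    Differentiable ℂ fun z => csym N b t z n := by
  unfold csym; fun_prop

theorem csym_add (t : Bool) (z w : ℂ) (n m : ZMod N) :
    csym N b t (z + w) (n + m) = csym N b t z n * csym N b t w m := by
  simp only [csym, mul_add, Complex.exp_add, AddChar.map_add_eq_mul]; ring

/-- Together with `csym_other_shift`: the translation attached to `u` multiplies one symbol by `q²`
and fixes the other, so only one of the two infinite products changes. -/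
theorem csym_self_shift (t : Bool) :
    csym N b t (I * par b t) (sgn t : ZMod N) = qpar N b t ^ 2 := by
  have h := qpar_pow_eq (N := N) b t 1 1
  simp only [Int.cast_one, mul_one, one_mul] at h
  rw [csym, h]
  norm_cast

variable {b}

theorem csym_other_shift (hb0 : b ≠ 0) (t : Bool) :
    csym N b t (I * par b !t) (sgn (!t) : ZMod N) = 1 := by
  have h := mixed_comm_eq (N := N) hb0 t 1 1
  simp only [Int.cast_one, mul_one, one_mul] at h
  rw [mul_comm (sgn (!t) : ZMod N)] at h
  exact h

theorem norm_csym (t : Bool) (z : ℂ) (n : ZMod N) :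
    ‖csym N b t z n‖ = Real.exp (2 * Real.pi / N * (par b t * z).re) := by
  rw [csym, norm_mul, AddChar.norm_apply, mul_one, Complex.norm_exp]
  congr 1
  have : (2 * Real.pi * par b t / N * z : ℂ) = ((2 * Real.pi / N : ℝ) : ℂ) * (par b t * z) := by
    push_cast; ring
  rw [this, re_ofReal_mul]

theorem norm_csym_false (z : ℂ) (n : ZMod N) : ‖csym N b false z n‖ =
    Real.exp (2 * Real.pi / N * (b.re * z.re - b.im * z.im)) := by
  rw [norm_csym]; simp [par]

theorem norm_csym_true (hb : ‖b‖ = 1) (z : ℂ) (n : ZMod N) : ‖csym N b true z n‖ =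
    Real.exp (2 * Real.pi / N * (b.re * z.re + b.im * z.im)) := by
  rw [norm_csym]; simp [par, inv_eq_conj_of_norm_one hb]

theorem norm_conj_qpar_false (hre : 0 < b.re) (him : 0 < b.im) :
    ‖starRingEnd ℂ (qpar N b false)‖ < 1 := by
  rw [RCLike.norm_conj]; exact norm_qpar_false hre him

theorem ne_zero_of_norm_eq_one (hb : ‖b‖ = 1) : b ≠ 0 := fun h => by simp [h] at hb

/-- Zeros of the denominator lie on the lines `Im z ∈ (Re b) ℤ`, and are compensated by zeros of the
numerator for `Im z ≤ 0`. -/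
theorem zeros_denominator (hb : ‖b‖ = 1) (hre : 0 < b.re) (him : 0 < b.im) {z : ℂ} {n : ZMod N}
    (h : qProd (starRingEnd ℂ (qpar N b false)) (-csym N b true z n) = 0) :
    ∃ p : ℤ, z.im = b.re * p ∧
      (p ≤ 0 → qProd (qpar N b false) (-csym N b false z n) = 0) := by
  have hb0 := ne_zero_of_norm_eq_one hb
  have hN : (N : ℂ) ≠ 0 := Nat.cast_ne_zero.2 (NeZero.ne N)
  have hpi : (Real.pi : ℂ) ≠ 0 := ofReal_ne_zero.2 Real.pi_ne_zero
  obtain ⟨j, hj⟩ := (qProd_eq_zero_iff (norm_conj_qpar_false hre him)).1 h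
  have hcs : ∀ t, csym N b t z n = exp (2 * Real.pi * par b t / N * z +
      2 * Real.pi * I * (sgn t * n.val : ℤ) / N) := by
    intro t
    have : ((sgn t : ZMod N) * n) = ((sgn t * n.val : ℤ) : ZMod N) := by simp
    rw [csym, this, ZMod.stdAddChar_coe, ← Complex.exp_add]
  have h1 : (starRingEnd ℂ (qpar N b false)) ^ (2 * j + 1) * csym N b true z n = 1 := by
    linear_combination -hj
  rw [← inv_qpar_not hb false, Bool.not_false, qpar, ← Complex.exp_neg, ← Complex.exp_nat_mul, hcs,
    ← Complex.exp_add, Complex.exp_eq_one_iff] at h1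
  obtain ⟨k, hk⟩ := h1
  -- The integer `m` combines the residue `n` with the period `k` of the exponential; the zero is at
  -- `z = i ((2j+1) Re b - m b)`.
  set m : ℤ := n.val - N * k with hm
  have hmc : (m : ℂ) = n.val - N * k := by rw [hm]; push_cast; ring
  have hBb : b⁻¹ * b = 1 := inv_mul_cancel₀ hb0
  have hz : z = I * (-(b * m) + (b⁻¹ + b) * (j + 1 / 2)) := by
    simp only [par, if_true, sgn, one_mul] at hk
    generalize b⁻¹ = B at *
    have e : (-(I / 2) * (B ^ 2 + 1) * (2 * j + 1) * b + B * b * z + I * n.val * b) -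
        k * N * I * b = 0 := by
      rw [← sub_eq_zero] at hk
      have := congrArg (fun x => (N * b / (2 * Real.pi)) * x) hk
      simp only [mul_zero] at this
      rw [← this]
      push_cast
      field_simp
      ring
    rw [hmc]
    linear_combination e + (I * (j + 1 / 2) * B - z) * hBb
  have hbb : b⁻¹ + b = (2 * b.re : ℝ) := by
    rw [inv_eq_conj_of_norm_one hb, add_comm, Complex.add_conj]
  refine ⟨2 * j + 1 - m, ?_, fun hp => ?_⟩
  · rw [hz, hbb]
    have : I * (-(b * m) + ((2 * b.re : ℝ) : ℂ) * (j + 1 / 2)) =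
        I * ((-(m : ℝ) : ℝ) * b + ((2 * b.re * (j + 1 / 2) : ℝ) : ℂ)) := by
      push_cast; ring
    rw [this, I_mul_im, add_re, re_ofReal_mul, ofReal_re]
    push_cast; ring
  · obtain ⟨i, hi⟩ := Int.eq_ofNat_of_zero_le (show 0 ≤ m - j - 1 by omega)
    refine (qProd_eq_zero_iff (norm_qpar_false hre him)).2 ⟨i, ?_⟩
    have hic : (i : ℂ) = m - j - 1 := by exact_mod_cast hi.symm
    have h2 : qpar N b false ^ (2 * i + 1) * csym N b false z n = 1 := by
      rw [qpar, ← Complex.exp_nat_mul, hcs, ← Complex.exp_add, Complex.exp_eq_one_iff]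
      refine ⟨-k, ?_⟩
      simp only [par, sgn, Bool.false_eq_true, if_false]
      have hn : (n.val : ℂ) = m + N * k := by rw [hmc]; ring
      have e : Real.pi * I / N * (b ^ 2 + 1) * (2 * i + 1) + 2 * Real.pi * b * z / N -
          2 * Real.pi * I * n.val / N = -k * (2 * Real.pi * I) := by
        rw [hz, hic, hn]
        generalize b⁻¹ = B at *
        field_simp
        linear_combination (2 * j + 1 : ℂ) * hBb
      rw [← sub_eq_zero] at e ⊢
      rw [← e]
      push_cast
      ring
    linear_combination -h2

theorem denominator_ne_zero (hb : ‖b‖ = 1) (hre : 0 < b.re) (him : 0 < b.im) {z : ℂ} (n : ZMod N)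
    (h1 : -b.re < z.im) (h2 : z.im < 0) :
    qProd (starRingEnd ℂ (qpar N b false)) (-csym N b true z n) ≠ 0 := by
  intro h
  obtain ⟨p, hp, -⟩ := zeros_denominator hb hre him h
  rw [hp] at h1 h2
  have h3 : (-1 : ℝ) < p := by nlinarith
  have h4 : (p : ℝ) < 0 := by nlinarith
  have h3' : (-1 : ℤ) < p := by exact_mod_cast h3
  have h4' : p < 0 := by exact_mod_cast h4
  omega

theorem differentiable_numerator (hre : 0 < b.re) (him : 0 < b.im) (n : ZMod N) :
    Differentiable ℂ fun z => qProd (qpar N b false) (-csym N b false z n) :=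
  (differentiable_qProd (norm_qpar_false hre him)).comp (differentiable_csym b false n).neg

theorem differentiable_denominator (hre : 0 < b.re) (him : 0 < b.im) (n : ZMod N) :
    Differentiable ℂ fun z => qProd (starRingEnd ℂ (qpar N b false)) (-csym N b true z n) :=
  (differentiable_qProd (norm_conj_qpar_false hre him)).comp (differentiable_csym b true n).neg

theorem differentiableAt_dilogRatio (hre : 0 < b.re) (him : 0 < b.im)
    {z : ℂ} {n : ZMod N}
    (h : qProd (starRingEnd ℂ (qpar N b false)) (-csym N b true z n) ≠ 0) :
    DifferentiableAt ℂ (fun z => dilogRatio N b z n) z :=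
  (differentiable_numerator hre him n z).div (differentiable_denominator hre him n z) h

theorem deriv_denominator_ne_zero (hre : 0 < b.re) (him : 0 < b.im) (hb0 : b ≠ 0)
    {z : ℂ} {n : ZMod N}
    (h : qProd (starRingEnd ℂ (qpar N b false)) (-csym N b true z n) = 0) :
    deriv (fun z => qProd (starRingEnd ℂ (qpar N b false)) (-csym N b true z n)) z ≠ 0 := by
  have hq := norm_conj_qpar_false (N := N) hre him
  have hN : (N : ℂ) ≠ 0 := Nat.cast_ne_zero.2 (NeZero.ne N)
  have hpi : (Real.pi : ℂ) ≠ 0 := ofReal_ne_zero.2 Real.pi_ne_zero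
  have h1 : HasDerivAt (fun z => -csym N b true z n)
      (-(csym N b true z n * (2 * Real.pi * par b true / N))) z := by
    have := (((hasDerivAt_id z).const_mul (2 * Real.pi * par b true / N : ℂ)).cexp.mul_const
      (ZMod.stdAddChar ((sgn true : ZMod N) * n) : ℂ)).neg
    refine this.congr_deriv ?_
    unfold csym; simp only [id, mul_one]; ring
  have h2 := ((differentiable_qProd hq) (-csym N b true z n)).hasDerivAt.comp z h1
  have h3 : deriv (fun z => qProd (starRingEnd ℂ (qpar N b false)) (-csym N b true z n)) z = _ :=
    h2.deriv
  rw [h3]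
  refine mul_ne_zero (deriv_qProd_ne_zero hq ?_ h) (neg_ne_zero.2 (mul_ne_zero ?_ ?_))
  · simpa using qpar_ne_zero b false N
  · exact mul_ne_zero (Complex.exp_ne_zero _) (by
      rw [← norm_ne_zero_iff, AddChar.norm_apply]; exact one_ne_zero)
  · have : par b true ≠ 0 := by simpa [par] using hb0
    exact div_ne_zero (mul_ne_zero (mul_ne_zero two_ne_zero hpi) this) hN

/-- The ratio is locally bounded on the closed strip: its singularities there are removable. -/
theorem dilogRatio_locally_bounded (hb : ‖b‖ = 1) (hre : 0 < b.re) (him : 0 < b.im) {z₀ : ℂ}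
    (n : ZMod N) (h2 : z₀.im ≤ 0) :
    ∃ C, ∀ᶠ z in 𝓝 z₀, ‖dilogRatio N b z n‖ ≤ C := by
  by_cases h : qProd (starRingEnd ℂ (qpar N b false)) (-csym N b true z₀ n) = 0
  · obtain ⟨p, hp, hp'⟩ := zeros_denominator hb hre him h
    have hp0 : p ≤ 0 := by
      have : (p : ℝ) ≤ 0 := by
        rw [hp] at h2
        nlinarith
      exact_mod_cast this
    have hnum := hp' hp0
    have hd1 := ((differentiable_denominator (N := N) hre him n) z₀).hasDerivAt
    have hd2 := ((differentiable_numerator (N := N) hre him n) z₀).hasDerivAt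
    have ht : Tendsto (fun z : ℂ => (z, z₀)) (𝓝 z₀) (𝓝 z₀ ×ˢ pure z₀) :=
      tendsto_id.prodMk tendsto_const_pure
    -- The zero of the denominator is simple, so `z - z₀` is controlled by the denominator, while
    -- the numerator is `O(z - z₀)`.
    have o2 := (hd1.isTheta_sub (deriv_denominator_ne_zero hre him
      (ne_zero_of_norm_eq_one hb) h)).isBigO_symm.comp_tendsto ht
    have o3 := hd2.isBigO_sub.trans o2
    simp only [Function.comp_def, h, hnum, sub_zero] at o3
    obtain ⟨C, hC0, hC⟩ := o3.exists_nonneg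
    refine ⟨C, hC.bound.mono fun z hz => ?_⟩
    rw [dilogRatio, norm_div]
    -- This also covers `z₀` itself, where the quotient `0 / 0` has the value `0`.
    exact div_le_of_le_mul₀ (norm_nonneg _) hC0 hz
  · have hc := (differentiableAt_dilogRatio hre him h).continuousAt.norm
    exact ⟨_, (hc.eventually (gt_mem_nhds (lt_add_one _))).mono fun z hz => le_of_lt hz⟩

theorem dilogRatio_bounded_on_compact (hb : ‖b‖ = 1) (hre : 0 < b.re) (him : 0 < b.im)
    {K : Set ℂ} (hK : IsCompact K) (hK0 : ∀ z ∈ K, z.im ≤ 0) :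
    ∃ C, ∀ z ∈ K, ∀ n, ‖dilogRatio N b z n‖ ≤ C := by
  have key : ∀ n : ZMod N, ∃ C, ∀ z ∈ K, ‖dilogRatio N b z n‖ ≤ C := by
    intro n
    refine hK.induction_on (p := fun S => ∃ C, ∀ z ∈ S, ‖dilogRatio N b z n‖ ≤ C) ⟨0, by simp⟩
      (fun S T hST ⟨C, hC⟩ => ⟨C, fun z hz => hC z (hST hz)⟩) ?_ ?_
    · rintro S T ⟨C, hC⟩ ⟨D, hD⟩
      refine ⟨max C D, ?_⟩
      rintro z (hz | hz)
      · exact (hC z hz).trans (le_max_left _ _)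
      · exact (hD z hz).trans (le_max_right _ _)
    · intro z hz
      obtain ⟨C, hC⟩ := dilogRatio_locally_bounded hb hre him n (hK0 z hz)
      exact ⟨_, mem_nhdsWithin_of_mem_nhds hC, C, fun w hw => hw⟩
  choose C hC using key
  refine ⟨∑ n, |C n|, fun z hz n => (hC n z hz).trans ((le_abs_self _).trans ?_)⟩
  exact Finset.single_le_sum (f := fun n => |C n|) (fun _ _ => abs_nonneg _) (Finset.mem_univ n)

/-- For `Re z ≤ -Im b` in the strip both symbols have modulus at most one, and the products are
continuous and zero-free on the closed unit disc. -/
theorem dilogRatio_bounded_left (hb : ‖b‖ = 1) (hre : 0 < b.re) (him : 0 < b.im) :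
    ∃ C, ∀ z : ℂ, -b.re ≤ z.im → z.im ≤ 0 → z.re ≤ -b.im → ∀ n,
      ‖dilogRatio N b z n‖ ≤ C := by
  have hN := natCast_pos_real N
  have hc := isCompact_closedBall (0 : ℂ) 1
  have hq := norm_qpar_false (N := N) hre him
  have hq' := norm_conj_qpar_false (N := N) hre him
  obtain ⟨C, hC⟩ := hc.exists_bound_of_continuousOn (differentiable_qProd hq).continuous.continuousOn
  obtain ⟨D, hD⟩ := hc.exists_bound_of_continuousOn
    (f := fun y => (qProd (starRingEnd ℂ (qpar N b false)) y)⁻¹)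
    ((differentiable_qProd hq').continuous.continuousOn.inv₀ fun y hy =>
      qProd_ne_zero_of_norm_le_one hq' (by simpa using hy))
  refine ⟨C * D, fun z h1 h2 h3 n => ?_⟩
  have hp : 0 < 2 * Real.pi / N := by have := Real.pi_pos; positivity
  have e1 : ‖csym N b false z n‖ ≤ 1 := by
    rw [norm_csym_false, Real.exp_le_one_iff]
    exact mul_nonpos_of_nonneg_of_nonpos hp.le (by nlinarith)
  have e2 : ‖csym N b true z n‖ ≤ 1 := by
    rw [norm_csym_true hb, Real.exp_le_one_iff]
    exact mul_nonpos_of_nonneg_of_nonpos hp.le (by nlinarith)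
  rw [dilogRatio, div_eq_mul_inv, norm_mul]
  have f1 := hC (-csym N b false z n) (by simpa using e1)
  have f2 := hD (-csym N b true z n) (by simpa using e2)
  exact mul_le_mul f1 f2 (norm_nonneg _) ((norm_nonneg _).trans f1)

/-- The shift of the ratio by `-i b`, respectively `-i b⁻¹`. -/
theorem dilogRatio_sub (hb : ‖b‖ = 1) (hre : 0 < b.re) (him : 0 < b.im) (t : Bool) {z : ℂ}
    {n : ZMod N} (h : qProd (starRingEnd ℂ (qpar N b false)) (-csym N b true z n) ≠ 0) :
    dilogRatio N b (z - I * par b t) (n - (sgn t : ZMod N)) =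
      (1 - (qpar N b t)⁻¹ * csym N b t z n) * dilogRatio N b z n := by
  have hb0 := ne_zero_of_norm_eq_one hb
  have hs : csym N b t z n = csym N b t (z - I * par b t) (n - (sgn t : ZMod N)) *
      qpar N b t ^ 2 := by
    rw [← csym_self_shift, ← csym_add]; simp
  have ho : csym N b (!t) z n = csym N b (!t) (z - I * par b t) (n - (sgn t : ZMod N)) := by
    have := csym_add b (!t) (z - I * par b t) (I * par b t) (n - (sgn t : ZMod N)) (sgn t : ZMod N)
    have h1 := csym_other_shift (N := N) hb0 (!t)
    rw [Bool.not_not] at h1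
    rw [h1] at this
    simpa using this
  have hq0 := qpar_ne_zero b t N
  -- For `t = false` the numerator gains a factor; for `t = true` the denominator loses one, and
  -- cancelling it uses that the denominator does not vanish.
  cases t
  · rw [dilogRatio, dilogRatio, ← Bool.not_false, ← ho, hs]
    generalize csym N b false (z - I * par b false) (n - (sgn false : ZMod N)) = w
    rw [qProd_eq_mul (norm_qpar_false hre him) (-w), mul_neg, mul_neg, mul_comm (_ ^ 2) w,
      ← mul_div_assoc]
    congr 2
    field_simp
    ring
  · have hqq : starRingEnd ℂ (qpar N b false) = (qpar N b true)⁻¹ := (inv_qpar_not hb false).symm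
    rw [dilogRatio, dilogRatio]
    rw [Bool.not_true] at ho
    rw [← ho]
    rw [hs] at h ⊢
    generalize csym N b true (z - I * par b true) (n - (sgn true : ZMod N)) = w at *
    rw [qProd_eq_mul (norm_conj_qpar_false hre him) (-(w * qpar N b true ^ 2))] at h ⊢
    rw [hqq] at h ⊢
    have e1 : (qpar N b true)⁻¹ ^ 2 * -(w * qpar N b true ^ 2) = -w := by field_simp
    rw [e1] at h ⊢
    have e2 : 1 - (qpar N b true)⁻¹ * (w * qpar N b true ^ 2) =
        1 + (qpar N b true)⁻¹ * -(w * qpar N b true ^ 2) := by ring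
    rw [e2]
    rw [← mul_div_assoc, mul_div_mul_left _ _ (left_ne_zero_of_mul h)]

/-- The real number `2 Im b` equals `i b⁻¹ - i b`, so composing one shift with the inverse of the
other moves horizontally; each product changes by one factor. -/
theorem dilogRatio_add_period (hb : ‖b‖ = 1) (hre : 0 < b.re) (him : 0 < b.im) (z : ℂ)
    (n : ZMod N) :
    dilogRatio N b (z + (2 * b.im : ℝ)) (n + 2) =
      (1 - (qpar N b false)⁻¹ * csym N b false z n) / (1 - qpar N b true * csym N b true z n) *
        dilogRatio N b z n := by
  have hb0 := ne_zero_of_norm_eq_one hb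
  have hper : z + (2 * b.im : ℝ) + I * par b false = z + I * par b true := by
    have : par b true = b⁻¹ := rfl
    rw [this, inv_eq_conj_of_norm_one hb]
    have h2 : b - starRingEnd ℂ b = (2 * b.im : ℝ) * I := Complex.sub_conj b
    have : par b false = b := rfl
    rw [this]
    linear_combination I * h2 + (2 * b.im : ℝ) * I_mul_I
  have hn : n + 2 + (sgn false : ZMod N) = n + (sgn true : ZMod N) := by
    simp [sgn]; ring
  have h1 : csym N b false (z + (2 * b.im : ℝ)) (n + 2) * qpar N b false ^ 2 =
      csym N b false z n := by
    rw [← csym_self_shift, ← csym_add, hper, hn, csym_add, ← Bool.not_false,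
      csym_other_shift hb0, mul_one]
  have h2 : csym N b true (z + (2 * b.im : ℝ)) (n + 2) = csym N b true z n * qpar N b true ^ 2 := by
    rw [← csym_self_shift, ← csym_add, ← hper, ← hn, csym_add _ _ (z + _), ← Bool.not_true,
      csym_other_shift hb0, mul_one]
  have hqq : starRingEnd ℂ (qpar N b false) = (qpar N b true)⁻¹ := (inv_qpar_not hb false).symm
  have hq0 := qpar_ne_zero b false N
  have hq1 := qpar_ne_zero b true N
  rw [dilogRatio, dilogRatio, h2, ← h1]
  generalize csym N b false (z + (2 * b.im : ℝ)) (n + 2) = w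
  generalize csym N b true z n = w'
  rw [qProd_eq_mul (norm_qpar_false hre him) (-w),
    qProd_eq_mul (norm_conj_qpar_false hre him) (-(w' * _)), hqq, div_mul_div_comm]
  congr 2
  · field_simp; ring
  · congr 1; ring
  · field_simp; ring
  · congr 1; field_simp

/-- Far to the right the factor behaves like `q⁻¹ u / (q̃ ũ)`. Here `|q⁻¹| = |q̃|`, and `|u| / |ũ|`
depends only on `Im z`, which is bounded. -/
theorem norm_period_factor_le (hb : ‖b‖ = 1) (hre : 0 < b.re) (him : 0 < b.im) :
    ∃ X K : ℝ, 1 ≤ K ∧ ∀ (z : ℂ) (n : ZMod N), -b.re ≤ z.im → z.im ≤ 0 → X ≤ z.re →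
      ‖(1 - (qpar N b false)⁻¹ * csym N b false z n) /
        (1 - qpar N b true * csym N b true z n)‖ ≤ K := by
  have hN := natCast_pos_real N
  have hp : 0 < 2 * Real.pi / N := by have := Real.pi_pos; positivity
  have hA1 : 1 ≤ ‖qpar N b true‖ := by
    have h1 := norm_conj_qpar_false (N := N) hre him
    rw [← inv_qpar_not hb false, norm_inv] at h1
    exact (inv_lt_one_iff₀.1 h1).elim (fun h => absurd (norm_pos_iff.2 (qpar_ne_zero b true N))
      (not_lt.2 h)) le_of_lt
  have hA2 : ‖(qpar N b false)⁻¹‖ = ‖qpar N b true‖ := by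
    have h1 := inv_qpar_not (N := N) hb false
    have h2 := congrArg norm h1
    rw [RCLike.norm_conj, norm_inv] at h2
    rw [norm_inv, ← h2, inv_inv, Bool.not_false]
  set A := ‖qpar N b true‖
  set B := Real.exp (2 * Real.pi / N * (2 * b.im * b.re)) with hB
  have hB0 : 0 < B := Real.exp_pos _
  -- Beyond this abscissa `|ũ| ≥ 2`, so the subtracted `1` costs at most half of the denominator;
  -- `B` bounds `|u| / |ũ|`.
  refine ⟨(1 / (2 * Real.pi / N) + b.im * b.re) / b.re, 2 * (1 + B), by linarith,
    fun z n h1 h2 h3 => ?_⟩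
  rw [div_le_iff₀ hre] at h3
  set U' := ‖csym N b true z n‖ with hU'
  have hU'2 : 2 ≤ U' := by
    rw [hU', norm_csym_true hb]
    have e : 1 ≤ 2 * Real.pi / N * (b.re * z.re + b.im * z.im) := by
      have : 1 / (2 * Real.pi / N) ≤ b.re * z.re + b.im * z.im := by nlinarith
      rwa [div_le_iff₀' hp] at this
    have := Real.add_one_le_exp (2 * Real.pi / N * (b.re * z.re + b.im * z.im))
    linarith
  have hU : ‖csym N b false z n‖ ≤ U' * B := by
    rw [hU', norm_csym_true hb, norm_csym_false, hB, ← Real.exp_add, Real.exp_le_exp, ← mul_add]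
    exact mul_le_mul_of_nonneg_left (by nlinarith) hp.le
  have hAU : 2 ≤ A * U' := by nlinarith
  have hnum : ‖1 - (qpar N b false)⁻¹ * csym N b false z n‖ ≤ A * U' * (1 + B) := by
    refine (norm_sub_le _ _).trans ?_
    rw [norm_one, norm_mul, hA2]
    nlinarith [mul_le_mul_of_nonneg_left hU (zero_le_one.trans hA1)]
  have hden : A * U' / 2 ≤ ‖1 - qpar N b true * csym N b true z n‖ := by
    have := norm_sub_norm_le (qpar N b true * csym N b true z n) 1
    rw [norm_sub_rev, norm_mul, norm_one] at this
    change A * U' - 1 ≤ _ at this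
    linarith
  rw [norm_div, div_le_iff₀ (by linarith)]
  nlinarith

/-- The ratio grows at most exponentially in the closed strip. -/
theorem dilogRatio_le_exp (hb : ‖b‖ = 1) (hre : 0 < b.re) (him : 0 < b.im) :
    ∃ C A : ℝ, ∀ (z : ℂ) (n : ZMod N), -b.re ≤ z.im → z.im ≤ 0 →
      ‖dilogRatio N b z n‖ ≤ C * Real.exp (A * |z.re|) := by
  obtain ⟨X, K, hK, hXK⟩ := norm_period_factor_le (N := N) hb hre him
  obtain ⟨C₁, hC₁⟩ := dilogRatio_bounded_left (N := N) hb hre him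
  obtain ⟨C₂, hC₂⟩ := dilogRatio_bounded_on_compact (N := N) hb hre him
    (K := Set.Icc (-b.im) (X + 2 * b.im) ×ℂ Set.Icc (-b.re) 0)
    (isCompact_Icc.reProdIm isCompact_Icc) (fun z hz => hz.2.2)
  set M := max (max C₁ C₂) 0
  have hM0 : 0 ≤ M := le_max_right _ _
  -- Moving right by one period `2 Im b` costs a factor `K`; the induction starts from the left half
  -- of the strip and a compact rectangle.
  have key : ∀ k : ℕ, ∀ (z : ℂ) (n : ZMod N), -b.re ≤ z.im → z.im ≤ 0 →
      z.re ≤ X + 2 * b.im * (k + 1) → ‖dilogRatio N b z n‖ ≤ M * K ^ k := by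
    intro k
    induction k with
    | zero =>
      intro z n h1 h2 h3
      rw [pow_zero, mul_one]
      rcases le_total z.re (-b.im) with h4 | h4
      · exact (hC₁ z h1 h2 h4 n).trans ((le_max_left _ _).trans (le_max_left _ _))
      · exact (hC₂ z ⟨⟨h4, by simpa using h3⟩, ⟨h1, h2⟩⟩ n).trans
          ((le_max_right _ _).trans (le_max_left _ _))
    | succ k ih =>
      intro z n h1 h2 h3
      rcases le_total z.re (X + 2 * b.im * (k + 1)) with h4 | h4
      · exact (ih z n h1 h2 h4).trans
          (mul_le_mul_of_nonneg_left (pow_le_pow_right₀ hK (Nat.le_succ k)) hM0)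
      · set z' : ℂ := z - (2 * b.im : ℝ) with hz'
        have hre' : z'.re = z.re - 2 * b.im := by simp [hz']
        have him' : z'.im = z.im := by simp [hz']
        have e := dilogRatio_add_period hb hre him z' (n - 2)
        rw [hz', sub_add_cancel, sub_add_cancel, ← hz'] at e
        rw [e, norm_mul, pow_succ, mul_comm (K ^ k), mul_left_comm]
        push_cast at h3
        refine mul_le_mul (hXK z' _ (him' ▸ h1) (him' ▸ h2) ?_)
          (ih z' _ (him' ▸ h1) (him' ▸ h2) ?_) (norm_nonneg _) (zero_le_one.trans hK)
        · rw [hre']; nlinarith [Nat.cast_nonneg (α := ℝ) k]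
        · rw [hre']; nlinarith
  have hs : 0 < 2 * b.im := by linarith
  refine ⟨M * Real.exp (Real.log K * (|X| / (2 * b.im) + 1)), Real.log K / (2 * b.im),
    fun z n h1 h2 => ?_⟩
  set k := ⌈(|z.re| + |X|) / (2 * b.im)⌉₊ with hk
  have hk1 : (|z.re| + |X|) / (2 * b.im) ≤ k := Nat.le_ceil _
  have hk2 : (k : ℝ) ≤ (|z.re| + |X|) / (2 * b.im) + 1 :=
    (Nat.ceil_lt_add_one (by positivity)).le
  refine (key k z n h1 h2 ?_).trans ?_
  · rw [div_le_iff₀ hs] at hk1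
    nlinarith [le_abs_self z.re, neg_abs_le X]
  · rw [mul_assoc, ← Real.exp_add]
    refine mul_le_mul_of_nonneg_left ?_ hM0
    have hK0 : 0 < K := by linarith
    rw [← Real.exp_log (pow_pos hK0 k), Real.log_pow, Real.exp_le_exp]
    have hl : 0 ≤ Real.log K := Real.log_nonneg hK
    calc k * Real.log K ≤ ((|z.re| + |X|) / (2 * b.im) + 1) * Real.log K :=
          mul_le_mul_of_nonneg_right hk2 hl
      _ = _ := by ring

end

end FlipQuantization

end

/-! ### Cauchy's theorem for a strip with merely almost everywhere continuous boundary values. -/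

noncomputable section

namespace FlipQuantization

/-! ### Shifting contours -/

section contour

variable {F : ℂ → ℂ} {h : ℝ} {g : ℝ → ℝ}

theorem continuous_horizontal (hd : ∀ z : ℂ, 0 < z.im → z.im < h → DifferentiableAt ℂ F z)
    {τ : ℝ} (h0 : 0 < τ) (h1 : τ < h) : Continuous fun x : ℝ => F (x + τ * I) := by
  rw [continuous_iff_continuousAt]
  intro x
  have := (hd (x + τ * I) (by simpa using h0) (by simpa using h1)).continuousAt
  exact ContinuousAt.comp (f := fun x : ℝ => (x + τ * I : ℂ)) this (by fun_prop)

theorem integrable_horizontal (hg : Integrable g)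
    (hd : ∀ z : ℂ, 0 < z.im → z.im < h → DifferentiableAt ℂ F z)
    (hF : ∀ z : ℂ, 0 ≤ z.im → z.im ≤ h → ‖F z‖ ≤ g z.re)
    {τ : ℝ} (h0 : 0 < τ) (h1 : τ < h) : Integrable fun x : ℝ => F (x + τ * I) :=
  hg.mono' (continuous_horizontal hd h0 h1).aestronglyMeasurable <|
    Eventually.of_forall fun x => by
      simpa using hF (x + τ * I) (by simpa using h0.le) (by simpa using h1.le)

/-- Cauchy's theorem on rectangles; the majorant makes the vertical sides vanish in the limit. -/
theorem integral_horizontal_eq (hg : Integrable g) (hg1 : Tendsto g atTop (𝓝 0))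
    (hg2 : Tendsto g atBot (𝓝 0))
    (hd : ∀ z : ℂ, 0 < z.im → z.im < h → DifferentiableAt ℂ F z)
    (hF : ∀ z : ℂ, 0 ≤ z.im → z.im ≤ h → ‖F z‖ ≤ g z.re)
    {τ₁ τ₂ : ℝ} (h0 : 0 < τ₁) (h12 : τ₁ ≤ τ₂) (h1 : τ₂ < h) :
    ∫ x : ℝ, F (x + τ₁ * I) = ∫ x : ℝ, F (x + τ₂ * I) := by
  have hrect : ∀ T : ℝ, (∫ x : ℝ in -T..T, F (x + τ₁ * I)) - (∫ x : ℝ in -T..T, F (x + τ₂ * I)) =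
      I • (∫ y : ℝ in τ₁..τ₂, F ((-T : ℝ) + y * I)) - I • ∫ y : ℝ in τ₁..τ₂, F (T + y * I) := by
    intro T
    have := Complex.integral_boundary_rect_eq_zero_of_differentiableOn F (⟨-T, τ₁⟩ : ℂ) ⟨T, τ₂⟩
      (fun z hz => (hd z ?_ ?_).differentiableWithinAt)
    · simp only at this
      linear_combination this
    · have := hz.2.1
      rw [min_eq_left h12] at this
      exact h0.trans_le this
    · have := hz.2.2
      rw [max_eq_right h12] at this
      exact lt_of_le_of_lt this h1
  have hlim : ∀ τ, 0 < τ → τ < h → Tendsto (fun T : ℝ => ∫ x : ℝ in -T..T, F (x + τ * I)) atTop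
      (𝓝 (∫ x : ℝ, F (x + τ * I))) := fun τ a b =>
    intervalIntegral_tendsto_integral (integrable_horizontal hg hd hF a b)
      tendsto_neg_atTop_atBot tendsto_id
  have hvert : ∀ u : ℝ → ℝ, Tendsto (fun T => g (u T)) atTop (𝓝 0) →
      Tendsto (fun T : ℝ => I • ∫ y : ℝ in τ₁..τ₂, F ((u T : ℝ) + y * I)) atTop (𝓝 0) := by
    intro u hu
    have hz : Tendsto (fun T => g (u T) * |τ₂ - τ₁|) atTop (𝓝 0) := by
      simpa using hu.mul_const |τ₂ - τ₁|
    refine squeeze_zero_norm (fun T => ?_) hz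
    rw [norm_smul, norm_I, one_mul]
    refine intervalIntegral.norm_integral_le_of_norm_le_const fun y hy => ?_
    rw [Set.uIoc_of_le h12] at hy
    have := hF ((u T : ℝ) + y * I) (by simpa using h0.le.trans hy.1.le)
      (by simpa using hy.2.trans h1.le)
    simpa using this
  have l1 := (hlim τ₁ h0 (h12.trans_lt h1)).sub (hlim τ₂ (h0.trans_le h12) h1)
  have l2 := (hvert (fun T => -T) (hg2.comp tendsto_neg_atTop_atBot)).sub (hvert (fun T => T) hg1)
  rw [sub_zero] at l2
  exact sub_eq_zero.1 (tendsto_nhds_unique (l1.congr hrect) l2)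

/-- The integral of a holomorphic function along the two sides of a strip. -/
theorem integral_eq_integral_add_mul_I (hh : 0 < h) (hg : Integrable g)
    (hg1 : Tendsto g atTop (𝓝 0)) (hg2 : Tendsto g atBot (𝓝 0))
    (hd : ∀ z : ℂ, 0 < z.im → z.im < h → DifferentiableAt ℂ F z)
    (hF : ∀ z : ℂ, 0 ≤ z.im → z.im ≤ h → ‖F z‖ ≤ g z.re)
    (hc0 : ∀ᵐ x : ℝ, ContinuousAt F x) (hc1 : ∀ᵐ x : ℝ, ContinuousAt F (x + h * I)) :
    ∫ x : ℝ, F x = ∫ x : ℝ, F (x + h * I) := by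
  have hconst : ∀ τ, 0 < τ → τ < h → ∫ x : ℝ, F (x + τ * I) = ∫ x : ℝ, F (x + (h / 2 : ℝ) * I) := by
    intro τ a b
    rcases le_total τ (h / 2) with hle | hle
    · exact integral_horizontal_eq hg hg1 hg2 hd hF a hle (by linarith)
    · exact (integral_horizontal_eq hg hg1 hg2 hd hF (by linarith) hle b).symm
  -- The edges are reached by dominated convergence, which tolerates a null set of exceptional
  -- points such as removable singularities with wrong values.
  have lim : ∀ (l : Filter ℝ) [l.NeBot] [l.IsCountablyGenerated] (τ₀ : ℝ), l ≤ 𝓝 τ₀ →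
      (∀ᶠ τ in l, 0 < τ ∧ τ < h) →
      (∀ᵐ x : ℝ, ContinuousAt F (x + τ₀ * I)) →
      ∫ x : ℝ, F (x + τ₀ * I) = ∫ x : ℝ, F (x + (h / 2 : ℝ) * I) := by
    intro l _ _ τ₀ hl hτ hc
    have h1 : Tendsto (fun τ : ℝ => ∫ x : ℝ, F (x + τ * I)) l (𝓝 (∫ x : ℝ, F (x + τ₀ * I))) := by
      refine tendsto_integral_filter_of_dominated_convergence g ?_ ?_ hg ?_
      · exact hτ.mono fun τ ht => (continuous_horizontal hd ht.1 ht.2).aestronglyMeasurable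
      · refine hτ.mono fun τ ht => Eventually.of_forall fun x => ?_
        simpa using hF (x + τ * I) (by simpa using ht.1.le) (by simpa using ht.2.le)
      · filter_upwards [hc] with x hx
        refine hx.tendsto.comp ?_
        have : Tendsto (fun τ : ℝ => (x + τ * I : ℂ)) (𝓝 τ₀) (𝓝 (x + τ₀ * I)) :=
          Continuous.tendsto (by fun_prop) _
        exact this.mono_left hl
    have h2 : (fun τ : ℝ => ∫ x : ℝ, F (x + τ * I)) =ᶠ[l]
        fun _ => ∫ x : ℝ, F (x + (h / 2 : ℝ) * I) := hτ.mono fun τ ht => hconst τ ht.1 ht.2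
    exact tendsto_nhds_unique h1 (tendsto_const_nhds.congr' h2.symm)
  have e0 := lim (𝓝[>] 0) 0 nhdsWithin_le_nhds (Ioo_mem_nhdsGT hh) (by simpa using hc0)
  have e1 := lim (𝓝[<] h) h nhdsWithin_le_nhds (Ioo_mem_nhdsLT hh) hc1
  simp only [ofReal_zero, zero_mul, add_zero] at e0
  rw [e0, e1]

/-- The imaginary part of `w` is a contour shift, the real part a translation of the line. -/
theorem integral_eq_integral_add (hg : Integrable g)
    (hg1 : Tendsto g atTop (𝓝 0)) (hg2 : Tendsto g atBot (𝓝 0)) {w : ℂ} (hw : 0 < w.im)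
    (hd : ∀ z : ℂ, 0 < z.im → z.im < w.im → DifferentiableAt ℂ F z)
    (hF : ∀ z : ℂ, 0 ≤ z.im → z.im ≤ w.im → ‖F z‖ ≤ g z.re)
    (hc0 : ∀ᵐ x : ℝ, ContinuousAt F x) (hc1 : ∀ᵐ x : ℝ, ContinuousAt F (x + w.im * I)) :
    ∫ x : ℝ, F x = ∫ x : ℝ, F (x + w) := by
  rw [integral_eq_integral_add_mul_I hw hg hg1 hg2 hd hF hc0 hc1,
    ← integral_add_right_eq_self (fun x : ℝ => F (x + w.im * I)) w.re]
  congr 1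
  funext x
  congr 1
  push_cast
  rw [add_assoc, re_add_im]

end contour

end FlipQuantization

end

/-! ### Cauchy's theorem applied to the dilogarithm ratio times Gaussians. -/

noncomputable section

namespace FlipQuantization

open scoped ComplexInnerProductSpace

variable {N : ℕ} [NeZero N]

/-! ### The contour shift for the quantum dilogarithm -/

theorem norm_gaussFun_mul_le (a a' W : ℂ) (h : ℝ) :
    ∃ D E : ℝ, 0 ≤ D ∧ 0 ≤ E ∧ ∀ z : ℂ, 0 ≤ z.im → z.im ≤ h →
      ‖gaussFun a (z - W) * gaussFun a' z‖ ≤ D * Real.exp (-2 * Real.pi * z.re ^ 2 + E * |z.re|) := by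
  have hpi := Real.pi_pos
  set B : ℂ := 2 * Real.pi * W + a + a'
  set C : ℂ := -Real.pi * W ^ 2 - a * W
  refine ⟨Real.exp (2 * Real.pi * h ^ 2 + |B.im| * h + C.re), |B.re|, (Real.exp_pos _).le,
    abs_nonneg _, fun z h0 h1 => ?_⟩
  have e : gaussFun a (z - W) * gaussFun a' z =
      exp (((-2 * Real.pi : ℝ) : ℂ) * z ^ 2 + B * z + C) := by
    rw [gaussFun, gaussFun, ← Complex.exp_add]
    congr 1
    simp only [B, C]; push_cast; ring
  rw [e, Complex.norm_exp, ← Real.exp_add, Real.exp_le_exp, add_re, add_re, re_ofReal_mul, mul_re,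
    pow_two z, mul_re]
  have h2 : z.im * z.im ≤ h * h := mul_le_mul h1 h1 h0 (h0.trans h1)
  have h3 : -(B.im * z.im) ≤ |B.im| * h :=
    (neg_le_abs _).trans (by
      rw [abs_mul, abs_of_nonneg h0]
      exact mul_le_mul_of_nonneg_left h1 (abs_nonneg _))
  have h4 : B.re * z.re ≤ |B.re| * |z.re| := by rw [← abs_mul]; exact le_abs_self _
  nlinarith

theorem gaussian_dominates (D E : ℝ) (hD : 0 ≤ D) : ∃ D' : ℝ, ∀ x : ℝ,
    D * Real.exp (-2 * Real.pi * x ^ 2 + E * |x|) ≤ D' * Real.exp (-Real.pi * |x| ^ 2) := by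
  have hpi := Real.pi_pos
  refine ⟨D * Real.exp (E ^ 2 / (4 * Real.pi)), fun x => ?_⟩
  rw [mul_assoc D, ← Real.exp_add]
  refine mul_le_mul_of_nonneg_left (Real.exp_le_exp.2 ?_) hD
  have h1 : 0 ≤ Real.pi * (|x| - E / (2 * Real.pi)) ^ 2 := by positivity
  have h2 : Real.pi * (|x| - E / (2 * Real.pi)) ^ 2 =
      Real.pi * |x| ^ 2 - E * |x| + E ^ 2 / (4 * Real.pi) := by field_simp; ring
  rw [← sq_abs x]
  nlinarith

section

variable {b : ℂ}

theorem countable_zeros_denominator (hb : ‖b‖ = 1) (hre : 0 < b.re) (him : 0 < b.im) (w : ℂ)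
    (n : ZMod N) :
    {x : ℝ | qProd (starRingEnd ℂ (qpar N b false))
      (-csym N b true (-(N * x) + w) n) = 0}.Countable := by
  have hN := natCast_pos_real N
  simp only [qProd_eq_zero_iff (norm_conj_qpar_false hre him), Set.ofPred_exists]
  refine Set.countable_iUnion fun j => Set.Subsingleton.countable fun x hx y hy => ?_
  simp only [Set.mem_ofPred_eq] at hx hy
  have h1 : csym N b true (-(N * x) + w) n = csym N b true (-(N * y) + w) n := by
    have hc : starRingEnd ℂ (qpar N b false) ^ (2 * j + 1) ≠ 0 :=
      pow_ne_zero _ (by simpa using qpar_ne_zero b false N)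
    apply mul_left_cancel₀ hc
    linear_combination hy - hx
  have h2 := congrArg norm h1
  have hp : 2 * Real.pi / N ≠ 0 := by have := Real.pi_pos; positivity
  rw [norm_csym_true hb, norm_csym_true hb, Real.exp_eq_exp] at h2
  have h3 := mul_left_cancel₀ hp h2
  simp at h3
  rcases h3 with (h3 | h3) | h3
  · exact h3
  · exact absurd h3 (NeZero.ne N)
  · exact absurd h3 hre.ne'

/-- The substitution `z ↦ -N z + μ₀` takes `0 ≤ Im z ≤ Im W` onto the strip where the ratio is
controlled. Shifting the contour by `W` shifts the argument of the ratio by `-i b`, respectively `-i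
b⁻¹`, which produces the factor on the right. -/
theorem integral_dilogRatio_shift (hb : ‖b‖ = 1) (hre : 0 < b.re) (him : 0 < b.im) (t : Bool)
    (μ₀ : ℝ) (n : ZMod N) (a a' : ℂ) :
    ∫ x : ℝ, dilogRatio N b (-(N * x) + μ₀) (n - (sgn t : ZMod N)) *
        (gaussFun a (x - I * par b t / N) * gaussFun a' x) =
      ∫ x : ℝ, (1 - (qpar N b t)⁻¹ * csym N b t (-(N * x) + μ₀) n) *
        dilogRatio N b (-(N * x) + μ₀) n *
        (gaussFun a x * gaussFun a' (x + I * par b t / N)) := by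
  have hN := natCast_pos_real N
  have hNc : (N : ℂ) ≠ 0 := Nat.cast_ne_zero.2 (NeZero.ne N)
  have hpi := Real.pi_pos
  set W : ℂ := I * par b t / N with hW
  have hWim : W.im = b.re / N := by
    have : W = ((1 / N : ℝ) : ℂ) * (I * par b t) := by rw [hW]; push_cast; ring
    rw [this, im_ofReal_mul, I_mul_im]
    have : (par b t).re = b.re := by cases t <;> simp [par, inv_eq_conj_of_norm_one hb]
    rw [this]; ring
  have hWpos : 0 < W.im := by rw [hWim]; positivity
  set m := n - (sgn t : ZMod N) with hm
  set F : ℂ → ℂ := fun z => dilogRatio N b (-(N * z) + μ₀) m *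
    (gaussFun a (z - W) * gaussFun a' z) with hF
  have hden : ∀ z : ℂ, qProd (starRingEnd ℂ (qpar N b false))
      (-csym N b true (-(N * z) + μ₀) m) ≠ 0 → DifferentiableAt ℂ F z := by
    intro z hz
    have h1 := (differentiableAt_dilogRatio hre him hz)
    have h2 : DifferentiableAt ℂ (fun z : ℂ => -(N * z) + (μ₀ : ℂ)) z := by fun_prop
    have h3 : DifferentiableAt ℂ (fun z => dilogRatio N b (-(N * z) + μ₀) m) z :=
      DifferentiableAt.comp (g := fun z => dilogRatio N b z m) z h1 h2
    have h4 : DifferentiableAt ℂ (fun z => gaussFun a (z - W)) z :=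
      (differentiable_gaussFun a _).comp z (by fun_prop)
    exact h3.mul (h4.mul (differentiable_gaussFun a' z))
  have him' : ∀ z : ℂ, (-(N * z) + (μ₀ : ℂ)).im = -(N * z.im) := by
    intro z; simp [mul_im]
  have hre' : ∀ z : ℂ, (-(N * z) + (μ₀ : ℂ)).re = -(N * z.re) + μ₀ := by
    intro z; simp [mul_re]
  obtain ⟨D, E, hD, hE, hDE⟩ := norm_gaussFun_mul_le a a' W W.im
  obtain ⟨C, A, hCA⟩ := dilogRatio_le_exp (N := N) hb hre him
  obtain ⟨D', hD'⟩ := gaussian_dominates (|C| * Real.exp (|A| * |μ₀|) * D) (E + |A| * N)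
    (by positivity)
  have hbound : ∀ z : ℂ, 0 ≤ z.im → z.im ≤ W.im →
      ‖F z‖ ≤ D' * Real.exp (-Real.pi * |z.re| ^ 2) := by
    intro z h0 h1
    refine le_trans ?_ (hD' z.re)
    rw [hF, norm_mul]
    have i1 : -b.re ≤ (-(N * z) + (μ₀ : ℂ)).im := by
      rw [him']
      rw [hWim, le_div_iff₀ hN] at h1
      linarith
    have i2 : (-(N * z) + (μ₀ : ℂ)).im ≤ 0 := by
      rw [him']; nlinarith
    have i3 := hCA _ m i1 i2
    rw [hre'] at i3
    have i4 : C * Real.exp (A * |-(N * z.re) + μ₀|) ≤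
        |C| * (Real.exp (|A| * |μ₀|) * Real.exp (|A| * N * |z.re|)) := by
      rw [← Real.exp_add]
      refine mul_le_mul (le_abs_self C) (Real.exp_le_exp.2 ?_) (Real.exp_pos _).le (abs_nonneg _)
      have j1 : |-(N * z.re) + μ₀| ≤ N * |z.re| + |μ₀| := by
        refine (abs_add_le _ _).trans ?_
        rw [abs_neg, abs_mul, Nat.abs_cast]
      calc A * |-(N * z.re) + μ₀| ≤ |A| * |-(N * z.re) + μ₀| :=
            mul_le_mul_of_nonneg_right (le_abs_self A) (abs_nonneg _)
        _ ≤ |A| * (N * |z.re| + |μ₀|) := mul_le_mul_of_nonneg_left j1 (abs_nonneg _)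
        _ = _ := by ring
    refine (mul_le_mul (i3.trans i4) (hDE z h0 h1) (norm_nonneg _) (by positivity)).trans
      (le_of_eq ?_)
    have : Real.exp (-2 * Real.pi * z.re ^ 2 + (E + |A| * N) * |z.re|) =
        Real.exp (|A| * N * |z.re|) * Real.exp (-2 * Real.pi * z.re ^ 2 + E * |z.re|) := by
      rw [← Real.exp_add]; congr 1; ring
    rw [this]; ring
  have hgi : Integrable fun x : ℝ => D' * Real.exp (-Real.pi * |x| ^ 2) := by
    simp only [sq_abs]
    exact (integrable_exp_neg_mul_sq hpi).const_mul _
  have hgt : Tendsto (fun x : ℝ => D' * Real.exp (-Real.pi * x ^ 2)) atTop (𝓝 0) := by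
    have : Tendsto (fun x : ℝ => Real.exp (-Real.pi * x ^ 2)) atTop (𝓝 0) := by
      refine Real.tendsto_exp_atBot.comp ?_
      have := ((tendsto_pow_atTop (α := ℝ) two_ne_zero).const_mul_atTop hpi)
      simpa [Function.comp_def] using tendsto_neg_atTop_atBot.comp this
    simpa using this.const_mul D'
  have main := integral_eq_integral_add (F := F) hgi (hgt.comp tendsto_abs_atTop_atTop)
    (hgt.comp tendsto_abs_atBot_atTop) hWpos (fun z h0 h1 => hden z ?_) hbound ?_ ?_
  · refine main.trans ?_
    refine integral_congr_ae ?_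
    filter_upwards [(countable_zeros_denominator (N := N) hb hre him μ₀ n).ae_notMem volume]
      with x hx
    have e1 : -(N * (x + W)) + (μ₀ : ℂ) = -(N * x) + μ₀ - I * par b t := by
      rw [hW]; field_simp; ring
    simp only [hF]
    rw [e1, hm, dilogRatio_sub hb hre him t hx, add_sub_cancel_right]
  · refine denominator_ne_zero hb hre him m ?_ ?_
    · rw [him']
      rw [hWim, lt_div_iff₀ hN] at h1
      linarith
    · rw [him']; nlinarith
  · filter_upwards [(countable_zeros_denominator (N := N) hb hre him μ₀ m).ae_notMem volume]
      with x hx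
    exact (hden x hx).continuousAt
  · filter_upwards [(countable_zeros_denominator (N := N) hb hre him
      (-(N * (W.im * I)) + μ₀) m).ae_notMem volume] with x hx
    refine (hden _ ?_).continuousAt
    have : -(N * (x + W.im * I)) + (μ₀ : ℂ) = -(N * x) + (-(N * (W.im * I)) + μ₀) := by ring
    rw [this]
    exact hx

end

end FlipQuantization

end

/-! ### The weak form of `V y V⁻¹ = y (1 - q z_3)`. -/

noncomputable section

namespace FlipQuantization

open scoped ComplexInnerProductSpace

variable {N : ℕ} [NeZero N]

/-! ### Conjugation of `y` by the quantum dilogarithm -/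

theorem gauss_eq_sum (c : ℂ) (m : ZMod N) :
    gauss c m = ∑ n : ZMod N, ((ZMod.stdAddChar (-(m * n)) : ℂ) *
      exp (c ^ 2 / (4 * Real.pi))) • fgauss (-I * c) n := by
  apply (fourierHil N).injective
  rw [map_sum]
  ext1 k
  rw [fourierHil_gauss]
  simp only [map_smul, fourierHil_fgauss]
  rw [WithLp.ofLp_sum, Finset.sum_apply, Finset.sum_eq_single k]
  · rw [PiLp.smul_apply, gauss_self]
  · intro n _ hn
    rw [PiLp.smul_apply, gauss_of_ne _ hn.symm, smul_zero]
  · simp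

theorem mem_charOp_graph_of_fgauss {v : ℂ} {l : ZMod N} {f f' : Hil N}
    (h : ∀ c n, ∃ g', (fgauss c n, g') ∈ (charOp (starRingEnd ℂ v) (-l)).graph ∧
      ⟪fgauss c n, f'⟫ = ⟪g', f⟫) : (f, f') ∈ (charOp v l).graph := by
  refine mem_mulOp_graph_of_gauss fun c m => ?_
  choose g' h1 h2 using h
  refine ⟨∑ n : ZMod N, ((ZMod.stdAddChar (-(m * n)) : ℂ) *
      exp (c ^ 2 / (4 * Real.pi))) • g' (-I * c) n, ?_, ?_⟩
  · rw [conjSymbol_charSymbol]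
    change _ ∈ (charOp _ _).graph
    have := Submodule.sum_mem (charOp (starRingEnd ℂ v) (-l)).graph (t := Finset.univ)
      fun n _ => Submodule.smul_mem _ ((ZMod.stdAddChar (-(m * n)) : ℂ) *
      exp (c ^ 2 / (4 * Real.pi))) (h1 (-I * c) n)
    convert this using 1
    rw [gauss_eq_sum]
    ext1
    · rw [Prod.fst_sum]; rfl
    · rw [Prod.snd_sum]; rfl
  · rw [gauss_eq_sum, sum_inner, sum_inner]
    refine Finset.sum_congr rfl fun n _ => ?_
    rw [inner_smul_left, inner_smul_left, h2]

section

variable {b : ℂ} {L : Fin 4 → ℂ} {μ₀ : ℝ} {m₀ : ZMod N}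

theorem csym_ofReal (b : ℂ) (t : Bool) (x : ℝ) (n : ZMod N) : csym N b t x n = sym N b t x n :=
  (sym_eq b t x n).symm

theorem z3coeff_eq_csym (hb : ‖b‖ = 1) (h : z3coeff L false = csym N b false μ₀ m₀) (t : Bool) :
    z3coeff L t = csym N b t μ₀ m₀ := by
  cases t
  · exact h
  · rw [← Bool.not_false, ← conj_z3coeff, h, csym_ofReal, conj_sym hb, csym_ofReal]

/-- The condition on the coefficient of `z_3` absorbs it into a translation by `(μ₀, m₀)`;
conjugation inverts a quotient of two conjugate numbers. -/
theorem conj_dilogSymbol (hb : ‖b‖ = 1) (hre : 0 < b.re) (him : 0 < b.im)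
    (h : z3coeff L false = csym N b false μ₀ m₀) (x : ℝ) (n : ZMod N) :
    starRingEnd ℂ (dilogSymbol N b L x n) = dilogRatio N b (x + μ₀) (n + m₀) := by
  have e : z3coeff L false * sym N b false x n = csym N b false (x + μ₀) (n + m₀) := by
    rw [csym_add, h, ← csym_ofReal, mul_comm]
  have e' : starRingEnd ℂ (csym N b false (x + μ₀) (n + m₀)) =
      csym N b true (x + μ₀) (n + m₀) := by
    rw [← ofReal_add, csym_ofReal, conj_sym hb, csym_ofReal]; rfl
  rw [dilogSymbol_eq hb hre him, e, map_inv₀, map_div₀, conj_conj, inv_div, dilogRatio,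
    conj_qProd (norm_qpar_false hre him), map_neg, e']

variable {V : Hil N ≃ₗᵢ[ℂ] Hil N}

theorem inner_dilog_fgauss_of_ne
    (hV : ∀ f, (f, V f) ∈ (fourierMulOp (dilogSymbol N b L)).graph) (c c' : ℂ) {n n' : ZMod N}
    (hn : n' ≠ n) : ⟪V (fgauss c n), fgauss c' n'⟫ = 0 := by
  have hN : (N : ℂ) ≠ 0 := Nat.cast_ne_zero.2 (NeZero.ne N)
  apply mul_left_cancel₀ hN
  rw [← inner_fourierHil, fourierHil_fgauss, ← inner_conj_symm, inner_gauss, mul_zero]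
  have h := mem_mulOp_graph.1 (mem_fourierMulOp_graph.1 (hV (fgauss c n))) n'
  rw [fourierHil_fgauss, gauss_of_ne c hn] at h
  have : fourierHil N (V (fgauss c n)) n' = 0 := by
    rw [Lp.eq_zero_iff_ae_eq_zero]
    filter_upwards [h, Lp.coeFn_zero ℂ 2 (volume : Measure ℝ)] with x h1 h2
    rw [h1, h2]; simp
  rw [this, inner_zero_right, map_zero]

theorem inner_dilog_fgauss (hb : ‖b‖ = 1) (hre : 0 < b.re) (him : 0 < b.im)
    (h : z3coeff L false = csym N b false μ₀ m₀)
    (hV : ∀ f, (f, V f) ∈ (fourierMulOp (dilogSymbol N b L)).graph) (c c' : ℂ) (n : ZMod N) :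
    Integrable (fun x : ℝ => dilogRatio N b (-(N * x) + μ₀) (n + m₀) *
      (gaussFun (starRingEnd ℂ c) x * gaussFun c' x)) ∧
    N * ⟪V (fgauss c n), fgauss c' n⟫ = ∫ x : ℝ, dilogRatio N b (-(N * x) + μ₀) (n + m₀) *
      (gaussFun (starRingEnd ℂ c) x * gaussFun c' x) := by
  have h1 := mem_mulOp_graph.1 (mem_fourierMulOp_graph.1 (hV (fgauss c n))) n
  rw [fourierHil_fgauss, gauss_self] at h1
  have e : (fun x => ⟪fourierHil N (V (fgauss c n)) n x, gaussLp c' x⟫) =ᵐ[volume]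
      fun x : ℝ => dilogRatio N b (-(N * x) + μ₀) (n + m₀) *
        (gaussFun (starRingEnd ℂ c) x * gaussFun c' x) := by
    filter_upwards [h1, coeFn_gaussLp c, coeFn_gaussLp c'] with x e1 e2 e3
    have e4 := conj_dilogSymbol hb hre him h (-(N * x)) n
    have e5 := conj_gaussFun c x
    rw [conj_ofReal] at e5
    push_cast at e4
    rw [e1, e2, e3, RCLike.inner_apply, map_mul, e4, e5]
    ring
  have i := L2.integrable_inner (𝕜 := ℂ) (fourierHil N (V (fgauss c n)) n) (gaussLp c')
  refine ⟨i.congr e, ?_⟩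
  rw [← inner_fourierHil, fourierHil_fgauss, ← inner_conj_symm, inner_gauss, inner_conj_symm,
    L2.inner_def, integral_congr_ae e]

/-- On Gaussians, `ỹ V (1 - q̃ z̃_3) = V ỹ` up to exchanging the tilde. -/
theorem dilog_fgauss_mem_charOp_graph (hb : ‖b‖ = 1) (hre : 0 < b.re) (him : 0 < b.im)
    (h : z3coeff L false = csym N b false μ₀ m₀)
    (hV : ∀ f, (f, V f) ∈ (fourierMulOp (dilogSymbol N b L)).graph) (t : Bool) (c : ℂ)
    (n : ZMod N) :
    (V (fgauss c n) - (qpar N b (!t) * z3coeff L (!t) * ZMod.stdAddChar ((sgn !t : ZMod N) * n)) •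
        V (fgauss (c + 2 * Real.pi * I * (I * par b !t)) n),
      gaussFun c (I * par b (!t) / N) •
        V (fgauss (c - 2 * Real.pi * I * par b (!t) / N) (n + (sgn !t : ZMod N)))) ∈
      (charOp (2 * Real.pi * par b (!t) / N) (sgn !t : ZMod N)).graph := by
  have hN : (N : ℂ) ≠ 0 := Nat.cast_ne_zero.2 (NeZero.ne N)
  have hpi : (Real.pi : ℂ) ≠ 0 := ofReal_ne_zero.2 Real.pi_ne_zero
  have h2 : starRingEnd ℂ 2 = 2 := map_ofNat _ 2
  have hpar : starRingEnd ℂ (par b !t) = par b t := by rw [← par_not hb, Bool.not_not]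
  refine mem_charOp_graph_of_fgauss fun c' n' => ⟨_, charOp_fgauss _ _ c' n', ?_⟩
  have ev : starRingEnd ℂ (2 * Real.pi * par b (!t) / N) = 2 * Real.pi * par b t / N := by
    simp [h2, hpar]
  set W : ℂ := I * par b t / N with hW
  have e1 : I * (2 * Real.pi * par b t / N) / (2 * Real.pi) = W := by
    rw [hW]; field_simp
  rw [ev, e1]
  have e2 : starRingEnd ℂ (I * par b (!t) / N) = -W := by
    simp [hW, hpar, neg_div]
  -- Passing to conjugates puts `V` in the first slot, so that the conjugate symbol, the ratio with
  -- controlled poles, appears in the integrals.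
  rw [← inner_conj_symm, ← inner_conj_symm (gaussFun c' W • _)]
  congr 1
  rw [inner_smul_left, inner_smul_right, inner_sub_left, inner_smul_left, conj_gaussFun, e2]
  -- For any other `n'` both sides vanish, because the supports in the discrete Fourier variable are
  -- disjoint.
  by_cases hn : n' = n + (sgn !t : ZMod N)
  · subst hn
    have en : n + (sgn !t : ZMod N) + -(sgn !t : ZMod N) = n := add_neg_cancel_right _ _
    rw [en]
    apply mul_left_cancel₀ hN
    have j1 := inner_dilog_fgauss hb hre him h hV (c - 2 * Real.pi * I * par b (!t) / N) c'
      (n + (sgn !t : ZMod N))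
    have j2 := inner_dilog_fgauss hb hre him h hV c (c' - I * (2 * Real.pi * par b t / N)) n
    have j3 := inner_dilog_fgauss hb hre him h hV (c + 2 * Real.pi * I * (I * par b !t))
      (c' - I * (2 * Real.pi * par b t / N)) n
    have main := integral_dilogRatio_shift hb hre him t μ₀ (n + m₀) (starRingEnd ℂ c) c'
    rw [← hW] at main
    have k1 : N * (gaussFun (starRingEnd ℂ c) (-W) *
        ⟪V (fgauss (c - 2 * Real.pi * I * par b (!t) / N) (n + (sgn !t : ZMod N))),
          fgauss c' (n + (sgn !t : ZMod N))⟫) =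
        ∫ x : ℝ, dilogRatio N b (-(N * x) + μ₀) (n + m₀ - (sgn t : ZMod N)) *
        (gaussFun (starRingEnd ℂ c) (x - W) * gaussFun c' x) := by
      rw [mul_left_comm, j1.2, ← integral_const_mul]
      congr 1
      funext x
      have f1 : n + (sgn !t : ZMod N) + m₀ = n + m₀ - (sgn t : ZMod N) := by
        rw [sgn_not]; push_cast; ring
      have f2 : starRingEnd ℂ (c - 2 * Real.pi * I * par b (!t) / N) =
          starRingEnd ℂ c - 2 * Real.pi * -W := by
        simp [h2, hpar, hW]; ring
      rw [f1, f2, sub_eq_add_neg (x : ℂ) W, gaussFun_add]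
      ring
    have k2 : N * (gaussFun c' W *
        (⟪V (fgauss c n), fgauss (c' - I * (2 * Real.pi * par b t / N)) n⟫ -
          starRingEnd ℂ (qpar N b (!t) * z3coeff L (!t) *
            ZMod.stdAddChar ((sgn !t : ZMod N) * n)) *
          ⟪V (fgauss (c + 2 * Real.pi * I * (I * par b !t)) n),
            fgauss (c' - I * (2 * Real.pi * par b t / N)) n⟫)) =
        ∫ x : ℝ, (1 - (qpar N b t)⁻¹ * csym N b t (-(N * x) + μ₀) (n + m₀)) *
        dilogRatio N b (-(N * x) + μ₀) (n + m₀) *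
        (gaussFun (starRingEnd ℂ c) x * gaussFun c' (x + W)) := by
      rw [mul_left_comm, mul_sub, mul_left_comm (N : ℂ), j2.2, j3.2, ← integral_const_mul,
        ← integral_sub j2.1 (j3.1.const_mul _), ← integral_const_mul]
      congr 1
      funext x
      have g1 : starRingEnd ℂ (qpar N b (!t) * z3coeff L (!t) *
            ZMod.stdAddChar ((sgn !t : ZMod N) * n)) =
          (qpar N b t)⁻¹ * csym N b t μ₀ m₀ * ZMod.stdAddChar ((sgn t : ZMod N) * n) := by
        rw [map_mul, map_mul, ← inv_qpar_not hb, conj_z3coeff, Bool.not_not, conj_stdAddChar,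
          z3coeff_eq_csym hb h, sgn_not]
        push_cast
        rw [neg_mul, neg_neg]
      have g2 : starRingEnd ℂ (c + 2 * Real.pi * I * (I * par b !t)) =
          starRingEnd ℂ c + -(2 * Real.pi * par b t) := by
        simp [h2, hpar]; linear_combination (2 * Real.pi * par b t) * I_mul_I
      have g3 : csym N b t (-(N * x) + μ₀) (n + m₀) =
          exp (-(2 * Real.pi * par b t) * x) * ZMod.stdAddChar ((sgn t : ZMod N) * n) *
            csym N b t μ₀ m₀ := by
        rw [csym_add, csym]
        congr 3
        field_simp
      have g4 : gaussFun c' (x + W) =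
          gaussFun c' W * gaussFun (c' - I * (2 * Real.pi * par b t / N)) x := by
        rw [gaussFun_add]
        congr 2
        rw [hW]; ring
      rw [g1, g2, g3, g4, ← exp_mul_gaussFun]
      ring
    rw [k1, k2, main]
  · have hn' : n' + -(sgn !t : ZMod N) ≠ n := fun h => hn (by rw [← h]; ring)
    rw [inner_dilog_fgauss_of_ne hV _ _ hn, inner_dilog_fgauss_of_ne hV _ _ hn',
      inner_dilog_fgauss_of_ne hV _ _ hn']
    simp

/-- The adjoint of `y` is `ỹ`. For a test vector `g`, the relation `V ỹ g = ỹ V (1 - q̃ z̃_3) g`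
turns `⟪V ỹ g, f⟫` into `⟪V g, (1 - q⁻¹ z_3) y f⟫`, and `(1 - q⁻¹ z_3) y = y (1 - q z_3)`. That `f`
lies in `𝔇` ensures that `y f` and `u y f` exist; that `V⁻¹ f` lies in the domain of `y` is part of
the conclusion. -/
theorem symm_yEnd_mem_yPow_graph (hb : ‖b‖ = 1) (hre : 0 < b.re) (him : 0 < b.im)
    (h : z3coeff L false = csym N b false μ₀ m₀)
    (hV : ∀ f, (f, V f) ∈ (fourierMulOp (dilogSymbol N b L)).graph) (t : Bool)
    (f : commonDomain N b) :
    (V.symm f, V.symm ((yEnd N b t 1 * (1 - (qpar N b t * z3coeff L t) • uEnd N b t 1)) f :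
      commonDomain N b)) ∈ (yPow N b t 1).graph := by
  have hpi : (Real.pi : ℂ) ≠ 0 := ofReal_ne_zero.2 Real.pi_ne_zero
  have h2 : starRingEnd ℂ 2 = 2 := map_ofNat _ 2
  have h1 := norm_dilogSymbol_ae (N := N) hb hre him L
  have hcp : starRingEnd ℂ (par b t) = par b (!t) := (par_not hb t).symm
  have hq := qpar_ne_zero b t N
  have er : yEnd N b t 1 * (1 - (qpar N b t * z3coeff L t) • uEnd N b t 1) =
      yEnd N b t 1 - ((qpar N b t)⁻¹ * z3coeff L t) • (uEnd N b t 1 * yEnd N b t 1) := by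
    rw [mul_sub, mul_one, mul_smul_comm, yEnd_mul_uEnd, smul_smul]
    congr 2
    have : qpar N b t ^ (-(2 * (1 * 1)) : ℤ) = (qpar N b t)⁻¹ * (qpar N b t)⁻¹ := by
      rw [← zpow_neg_one, ← zpow_add₀ hq]; norm_num
    rw [this]; field_simp
  have ev : starRingEnd ℂ (2 * Real.pi * (1 : ℤ) * par b t / N) = 2 * Real.pi * par b (!t) / N := by
    simp [h2, hcp]
  have es : -((1 * sgn t : ℤ) : ZMod N) = (sgn !t : ZMod N) := by rw [sgn_not]; push_cast; ring
  have hy := yEnd_graph b t 1 f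
  rw [yPow_eq] at hy ⊢
  refine mem_charOp_graph_of_fgauss fun c n => ⟨_, charOp_fgauss _ _ c n, ?_⟩
  rw [ev, es]
  have hk := dilog_fgauss_mem_charOp_graph hb hre him h hV t c n
  have hsw : ∀ g k : Hil N, ⟪g, V.symm k⟫ = ⟪V g, k⟫ := fun g k => by
    rw [← V.inner_map_map, V.apply_symm_apply]
  rw [hsw, hsw, map_smul, er]
  have hu : ⟪V (fgauss c n), ((uEnd N b t 1 (yEnd N b t 1 f) : commonDomain N b) : Hil N)⟫ =
      ⟪(ZMod.stdAddChar ((sgn !t : ZMod N) * n) : ℂ) •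
        V (fgauss (c + 2 * Real.pi * I * (I * par b !t)) n), (yEnd N b t 1 f : Hil N)⟫ := by
    have hu1 := uEnd_graph b t 1 (yEnd N b t 1 f)
    rw [uPow_eq] at hu1
    refine inner_shiftOp hu1 ?_
    have e3 : -starRingEnd ℂ (I * (1 : ℤ) * par b t) = I * (1 : ℤ) * par b (!t) := by
      simp [hcp]
    have e4 : -((1 * sgn t : ℤ) : ZMod N) = ((1 * sgn !t : ℤ) : ZMod N) := by rw [es, one_mul]
    rw [e3, e4, ← uPow_eq, uPow, ← map_smul, mem_fourierMulOp_graph_iff_of_unitary hV h1, ← uPow,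
      uPow_eq]
    have := shiftOp_fgauss (I * (1 : ℤ) * par b (!t)) ((1 * sgn !t : ℤ) : ZMod N) c n
    simpa using this
  have hx := inner_charOp hy (by rw [ev, es]; exact hk)
  have e5 : I * (2 * Real.pi * par b (!t) / N) / (2 * Real.pi) = I * par b (!t) / N := by
    field_simp
  have e6 : I * (2 * Real.pi * par b (!t) / N) = 2 * Real.pi * I * par b (!t) / N := by ring
  have e7 : starRingEnd ℂ (qpar N b (!t) * z3coeff L !t) = (qpar N b t)⁻¹ * z3coeff L t := by
    rw [map_mul, ← inv_qpar_not hb, conj_z3coeff, Bool.not_not]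
  rw [e5, e6, ← hx, LinearMap.sub_apply, Submodule.coe_sub, inner_sub_right, inner_sub_left,
    LinearMap.smul_apply, Submodule.coe_smul, inner_smul_right, Module.End.mul_apply, hu,
    mul_smul]
  simp only [inner_smul_left, e7]

end

end FlipQuantization

end

/-! ### The cluster formulas and their classical limit. -/

noncomputable section

namespace FlipQuantization

variable {N : ℕ} [NeZero N]

/-! ### The explicit form of the quantum cluster transformation -/

theorem exp_logZ_two (L : Fin 4 → ℂ) (t : Bool) :
    exp (logZ (lift L t) 2).2.2 = z3coeff L t := by
  have e : (logZ (lift L t) 2).2.2 =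
      lift L t 0 - lift L t 1 + lift L t 2 + lift L t 3 + 2 * Real.pi * I := by
    simp [logZ, logU, const]; ring
  rw [e, Complex.exp_add, Complex.exp_two_pi_mul_I, z3coeff, mul_one, Complex.exp_add,
    Complex.exp_add, Complex.exp_sub]
  ring

theorem zEnd_two (b : ℂ) (L : Fin 4 → ℂ) (t : Bool) :
    expEnd N b t (logZ (lift L t) 2) = z3coeff L t • uEnd N b t 1 := by
  rw [expEnd_eq, exp_logZ_two]
  simp [logZ, logU, const, yEnd_zero]

section

variable {b : ℂ} {L : Fin 4 → ℂ} {μ₀ : ℝ} {m₀ : ZMod N} {V : Hil N ≃ₗᵢ[ℂ] Hil N}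

theorem mem_conj_expOp_graph (hb : ‖b‖ = 1) (hre : 0 < b.re) (him : 0 < b.im)
    (h : z3coeff L false = csym N b false μ₀ m₀)
    (hV : ∀ f, (f, V f) ∈ (fourierMulOp (dilogSymbol N b L)).graph) (t : Bool)
    {Z : LogCoord} (hZ1 : Z.1 = 0) (hZ2 : Z.2.1 = 1) (f : commonDomain N b) :
    ((f : Hil N), ((expEnd N b t Z *
      (1 - qpar N b t • expEnd N b t (logZ (lift L t) 2))) f : Hil N)) ∈
      (conjOp V.toLinearEquiv (expOp N b t Z)).graph := by
  have main := symm_yEnd_mem_yPow_graph hb hre him h hV t f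
  rw [mem_conjOp_graph, zEnd_two, expEnd_eq, expOp, hZ1, hZ2, uEnd_zero, one_mul, smul_mul_assoc,
    smul_smul, LinearMap.smul_apply, Submodule.coe_smul, map_smul]
  exact mem_smul_graph (mem_prodOp_graph main (mem_uPow_zero b t _))

/-- Up to a scalar the claimed value is `y (1 - q z_3) u⁻¹ f`, and `V⁻¹` sends it to a multiple of
`y V⁻¹ u⁻¹ f`. Applying `y⁻¹` and then `u`, which commutes with `V`, returns `V⁻¹ f`. -/
theorem mem_inverse_conj_expOp_graph (hb : ‖b‖ = 1) (hre : 0 < b.re) (him : 0 < b.im)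
    (h : z3coeff L false = csym N b false μ₀ m₀)
    (hV : ∀ f, (f, V f) ∈ (fourierMulOp (dilogSymbol N b L)).graph) (t : Bool)
    {Z X : LogCoord} (hZ1 : Z.1 = 0) (hZ2 : Z.2.1 = -1) (hX1 : X.1 = 1) (hX2 : X.2.1 = -1)
    (hX : exp X.2.2 = -(exp Z.2.2 * z3coeff L t)) (f : commonDomain N b) :
    ((f : Hil N), (((1 - qpar N b t • Ring.inverse (expEnd N b t (logZ (lift L t) 2))) *
      Ring.inverse (expEnd N b t Z)) f : Hil N)) ∈
      (conjOp V.toLinearEquiv (expOp N b t X)).inverse.graph := by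
  have h1 := norm_dilogSymbol_ae (N := N) hb hre him L
  have hq := qpar_ne_zero b t N
  have hz := z3coeff_ne_zero L t
  have hZ := Complex.exp_ne_zero Z.2.2
  have main := symm_yEnd_mem_yPow_graph hb hre him h hV t (uEnd N b t (-1) f)
  have hu : (V.symm (uEnd N b t (-1) f : Hil N), V.symm (f : Hil N)) ∈ (uPow N b t 1).graph := by
    rw [uPow, ← mem_fourierMulOp_graph_iff_of_unitary hV h1, V.apply_symm_apply,
      V.apply_symm_apply]
    have := mem_uPow_neg (uEnd_graph b t (-1) f)
    rwa [neg_neg] at this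
  have hr : (1 - qpar N b t • Ring.inverse (expEnd N b t (logZ (lift L t) 2))) *
      Ring.inverse (expEnd N b t Z) = (exp X.2.2 * qpar N b t)⁻¹ •
      ((yEnd N b t 1 * (1 - (qpar N b t * z3coeff L t) • uEnd N b t 1)) * uEnd N b t (-1)) := by
    have e1 : Ring.inverse (expEnd N b t Z) = (exp Z.2.2)⁻¹ • yEnd N b t 1 := by
      rw [ringInverse_expEnd, expEnd_eq]
      simp [hZ1, hZ2, uEnd_zero, Complex.exp_neg]
    have e2 : Ring.inverse (expEnd N b t (logZ (lift L t) 2)) =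
        (z3coeff L t)⁻¹ • uEnd N b t (-1) := by
      rw [ringInverse_expEnd, expEnd_eq, ← exp_logZ_two, ← Complex.exp_neg]
      simp [logZ, logU, const, yEnd_zero]
    have e3 : yEnd N b t 1 * uEnd N b t (-1) =
        qpar N b t ^ 2 • (uEnd N b t (-1) * yEnd N b t 1) := by
      rw [yEnd_mul_uEnd]; norm_cast
    have e4 : yEnd N b t 1 * (1 - (qpar N b t * z3coeff L t) • uEnd N b t 1) * uEnd N b t (-1) =
        qpar N b t ^ 2 • (uEnd N b t (-1) * yEnd N b t 1) -
          (qpar N b t * z3coeff L t) • yEnd N b t 1 := by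
      rw [mul_assoc, sub_mul, one_mul, smul_mul_assoc, uEnd_mul, add_neg_cancel, uEnd_zero,
        mul_sub, e3, mul_smul_comm, mul_one]
    rw [e1, e2, e4, hX, sub_mul, one_mul, smul_sub, smul_smul, smul_smul, smul_smul,
      smul_mul_smul_comm, sub_eq_neg_add, sub_eq_add_neg, ← neg_smul, ← neg_smul]
    congr 2
    · field_simp
    · field_simp
  rw [mem_inverse_graph_iff (ker_conj_expOp b t V X), mem_conjOp_graph, hr, expOp, hX1, hX2]
  have h2 := mem_smul_graph (c := exp X.2.2 * qpar N b t ^ (-(1 * -1) : ℤ))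
    (mem_prodOp_graph (mem_yPow_neg main) hu)
  have h3 := Submodule.smul_mem _ (exp X.2.2 * qpar N b t)⁻¹ h2
  have hne : exp X.2.2 * qpar N b t ≠ 0 := mul_ne_zero (Complex.exp_ne_zero _) hq
  convert h3 using 1
  ext1
  · exact map_smul V.symm _ _
  · change V.symm (f : Hil N) = _
    have e : qpar N b t ^ (-(1 * -1) : ℤ) = qpar N b t := by norm_num
    rw [Prod.smul_snd, smul_smul, e, inv_mul_cancel₀ hne, one_smul]

theorem i3_logZ_of_nonpos (L : Fin 4 → ℂ) {a : Fin 6} (ha : a ≠ 2) (h : eps a 2 ≤ 0) :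
    i3 (logZ L) a = logZ L a := by
  rw [i3, if_neg ha, max_eq_right h, zero_smul, add_zero]

/-- The sign is `e^{-iπ}` from the shift by `-iπ` in `i_3`. -/
theorem exp_i3_logZ (L : Fin 4 → ℂ) (t : Bool) {a : Fin 6} (ha : a ≠ 2) (h : eps a 2 = 1) :
    exp (i3 (logZ (lift L t)) a).2.2 = -(exp (logZ (lift L t) a).2.2 * z3coeff L t) := by
  rw [i3, if_neg ha, h, ← exp_logZ_two]
  simp only [zero_le_one, sup_of_le_left, one_smul, Prod.snd_add, Prod.snd_sub, const,
    Complex.exp_add, Complex.exp_sub]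
  rw [mul_comm I, Complex.exp_pi_mul_I]
  ring

theorem flipExpr_mem_graph (hb : ‖b‖ = 1) (hre : 0 < b.re) (him : 0 < b.im)
    (h : z3coeff L false = csym N b false μ₀ m₀)
    (hV : ∀ f, (f, V f) ∈ (fourierMulOp (dilogSymbol N b L)).graph)
    (h0 : ∀ t, zPrime b L V t 0 = zOp N b L t 0)
    (h2 : ∀ t, zPrime b L V t 2 = (zOp N b L t 2).inverse)
    (t : Bool) (a : Fin 6) (f : commonDomain N b) :
    ((f : Hil N), (flipExpr (qpar N b t) (zEnd N b L t) a f : Hil N)) ∈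
      (flipLhs (zPrime b L V t) a).graph := by
  have e1 : ∀ a, flipSign a = 1 → flipLhs (zPrime b L V t) a = zPrime b L V t a :=
    fun a ha => if_pos ha
  have e2 : ∀ a, flipSign a ≠ 1 → flipLhs (zPrime b L V t) a = (zPrime b L V t a).inverse :=
    fun a ha => if_neg ha
  fin_cases a
  · change _ ∈ (flipLhs (zPrime b L V t) 0).graph
    rw [e1 0 rfl, h0]
    exact expEnd_graph b t _ f
  · change _ ∈ (flipLhs (zPrime b L V t) 1).graph
    rw [e1 1 rfl, zPrime, i3zOp,
      i3_logZ_of_nonpos _ (by decide) (by rw [eps_eq]; decide)]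
    exact mem_conj_expOp_graph hb hre him h hV t (by simp [logZ, logY, const])
      (by simp [logZ, logY, const]) f
  · change _ ∈ (flipLhs (zPrime b L V t) 2).graph
    rw [e1 2 rfl, h2, zOp, mem_inverse_graph_iff (ker_eq_bot_of_graph fun f => expOp_injective b t _)]
    change ((Ring.inverse (expEnd N b t (logZ (lift L t) 2)) f : commonDomain N b).1, f.1) ∈ _
    have := expEnd_graph b t (logZ (lift L t) 2)
      (Ring.inverse (expEnd N b t (logZ (lift L t) 2)) f)
    rwa [← Module.End.mul_apply, Ring.mul_inverse_cancel _ (isUnit_expEnd b t _)] at this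
  · change _ ∈ (flipLhs (zPrime b L V t) 3).graph
    rw [e2 3 (by decide)]
    exact mem_inverse_conj_expOp_graph hb hre him h hV t (by simp [logZ, logY, const])
      (by simp [logZ, logY, const]) (by rw [i3_logZ_fst]; rfl) (by rw [i3_logZ_snd]; rfl)
      (exp_i3_logZ L t (by decide) (by rw [eps_eq]; rfl)) f
  · change _ ∈ (flipLhs (zPrime b L V t) 4).graph
    rw [e2 4 (by decide)]
    exact mem_inverse_conj_expOp_graph hb hre him h hV t (by simp [logZ, logY, const])
      (by simp [logZ, logY, const]) (by rw [i3_logZ_fst]; rfl) (by rw [i3_logZ_snd]; rfl)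
      (exp_i3_logZ L t (by decide) (by rw [eps_eq]; rfl)) f
  · change _ ∈ (flipLhs (zPrime b L V t) 5).graph
    rw [e1 5 rfl, zPrime, i3zOp,
      i3_logZ_of_nonpos _ (by decide) (by rw [eps_eq]; decide)]
    exact mem_conj_expOp_graph hb hre him h hV t (by simp [logZ, logY, const])
      (by simp [logZ, logY, const]) f

theorem zPrime_zero (hb : ‖b‖ = 1) (hre : 0 < b.re) (him : 0 < b.im)
    (hV : ∀ f, (f, V f) ∈ (fourierMulOp (dilogSymbol N b L)).graph) (t : Bool) :
    zPrime b L V t 0 = zOp N b L t 0 := by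
  rw [zPrime, i3zOp, conjOp_expOp_of_snd_eq_zero hV (norm_dilogSymbol_ae hb hre him L)
    (by rw [i3_logZ_snd]; rfl), i3_logZ_of_nonpos _ (by decide) (by rw [eps_eq]; decide), zOp]

theorem zPrime_two (hb : ‖b‖ = 1) (hre : 0 < b.re) (him : 0 < b.im)
    (hV : ∀ f, (f, V f) ∈ (fourierMulOp (dilogSymbol N b L)).graph) (t : Bool) :
    zPrime b L V t 2 = (zOp N b L t 2).inverse := by
  rw [zPrime, i3zOp, conjOp_expOp_of_snd_eq_zero hV (norm_dilogSymbol_ae hb hre him L)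
    (by rw [i3_logZ_snd]; rfl), zOp]
  refine (inverse_expOp_of_snd_eq_zero (by simp [logZ, logU, const]) (by rw [i3_logZ_snd]; rfl)
    (by rw [i3_logZ_fst]; simp [logZ, logU, const]) ?_).symm
  rw [i3, if_pos rfl, ← Complex.exp_add]
  simp [const, Complex.exp_two_pi_mul_I]

end

/-! ### The classical limit -/

theorem tendsto_qpar (b : ℂ) (t : Bool) : Tendsto (fun n : ℕ => qpar n b t) atTop (𝓝 1) := by
  have h : Tendsto (fun n : ℕ => (Real.pi * I / n * ((par b t) ^ 2 + 1) : ℂ)) atTop (𝓝 0) := by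
    simpa using (tendsto_const_div_atTop_nhds_zero_nat (Real.pi * I : ℂ)).mul_const
      ((par b t) ^ 2 + 1)
  simpa [qpar, Function.comp_def] using (Complex.continuous_exp.tendsto 0).comp h

theorem tendsto_flipExpr {q : ℕ → ℂ} (hq : Tendsto q atTop (𝓝 1)) {x : Fin 6 → ℂ}
    (h0 : ∀ a, x a ≠ 0) (h1 : x 2 ≠ 1) (a : Fin 6) :
    Tendsto (fun n => flipExpr (q n) x a ^ flipSign a) atTop (𝓝 (classicalFlip x a)) := by
  have e1 : Tendsto (fun n => 1 - q n * x 2) atTop (𝓝 (1 - x 2)) := by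
    simpa using tendsto_const_nhds.sub (hq.mul_const (x 2))
  have e2 : Tendsto (fun n => 1 - q n * (x 2)⁻¹) atTop (𝓝 (1 - (x 2)⁻¹)) := by
    simpa using tendsto_const_nhds.sub (hq.mul_const (x 2)⁻¹)
  have h2 : 1 - (x 2)⁻¹ ≠ 0 := fun h => h1 (inv_eq_one.1 (sub_eq_zero.1 h).symm)
  fin_cases a
  · simp [flipExpr, flipSign, classicalFlip]
  · simpa [flipExpr, flipSign, classicalFlip] using e1.const_mul (x 1)
  · simp [flipExpr, flipSign, classicalFlip]
  · simpa [flipExpr, flipSign, classicalFlip] using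
      (e2.mul_const (x 3)⁻¹).inv₀ (mul_ne_zero h2 (inv_ne_zero (h0 3)))
  · simpa [flipExpr, flipSign, classicalFlip] using
      (e2.mul_const (x 4)⁻¹).inv₀ (mul_ne_zero h2 (inv_ne_zero (h0 4)))
  · simpa [flipExpr, flipSign, classicalFlip] using e1.const_mul (x 5)

end FlipQuantization

end

open FlipQuantization in
theorem mainTheorem11 (N : ℕ) [NeZero N] (b : ℂ) (hb : ‖b‖ = 1) (hre : 0 < b.re) (him : 0 < b.im)
    (L : Fin 4 → ℂ) :
    Dense (FlipQuantization.commonDomain N b : Set (FlipQuantization.Hil N)) ∧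
    (∃ V : FlipQuantization.Hil N ≃ₗᵢ[ℂ] FlipQuantization.Hil N,
      -- `V` is the unitary operator `φ(-z_3, -z̃_3)`
      V.toLinearEquiv.toLinearMap.toPMap ⊤ = FlipQuantization.dilogOp N b L ∧
      -- quantum torus relations of `T'` on the invariant dense subspace `V 𝔇`
      (∀ (t : Bool) (a : Fin 6),
        LinearMap.ker (FlipQuantization.zPrime b L V t a).toFun = ⊥ ∧
        FlipQuantization.Preserves
          ((FlipQuantization.commonDomain N b).map V.toLinearEquiv.toLinearMap)
          (FlipQuantization.zPrime b L V t a) ∧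
        FlipQuantization.Preserves
          ((FlipQuantization.commonDomain N b).map V.toLinearEquiv.toLinearMap)
          (FlipQuantization.zPrime b L V t a).inverse) ∧
      (∀ (t : Bool) (a c : Fin 6),
        FlipQuantization.QCommuteOn
          ((FlipQuantization.commonDomain N b).map V.toLinearEquiv.toLinearMap)
          (FlipQuantization.zPrime b L V t a) (FlipQuantization.zPrime b L V t c)
          (FlipQuantization.qpar N b t ^ (2 * FlipQuantization.eps' a c))) ∧
      (∀ a c : Fin 6,
        FlipQuantization.QCommuteOn
          ((FlipQuantization.commonDomain N b).map V.toLinearEquiv.toLinearMap)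
          (FlipQuantization.zPrime b L V false a) (FlipQuantization.zPrime b L V true c) 1) ∧
      -- the explicit form of the transformation
      (∀ t : Bool,
        FlipQuantization.zPrime b L V t 0 = FlipQuantization.zOp N b L t 0 ∧
        FlipQuantization.zPrime b L V t 2 = (FlipQuantization.zOp N b L t 2).inverse) ∧
      (∀ (t : Bool) (a : Fin 6), IsUnit (FlipQuantization.zEnd N b L t a)) ∧
      ((∃ (μ₀ : ℝ) (m₀ : ℤ), Complex.exp (L 0) * Complex.exp (L 2) * Complex.exp (L 3)
            / Complex.exp (L 1)
          = Complex.exp (2 * Real.pi * Complex.I / N * (-Complex.I * b * μ₀ - m₀))) →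
        ∀ (t : Bool) (a : Fin 6) (f : FlipQuantization.commonDomain N b),
          ((f : FlipQuantization.Hil N),
            (FlipQuantization.flipExpr (FlipQuantization.qpar N b t)
              (FlipQuantization.zEnd N b L t) a f : FlipQuantization.Hil N)) ∈
            (FlipQuantization.flipLhs (FlipQuantization.zPrime b L V t) a).graph)) ∧
    -- the classical limit
    (∀ t : Bool, Tendsto (fun n : ℕ => FlipQuantization.qpar n b t) atTop (𝓝 1) ∧
      ∀ x : Fin 6 → ℂ, (∀ a, x a ≠ 0) → x 2 ≠ 1 → ∀ a : Fin 6,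
        Tendsto (fun n : ℕ => FlipQuantization.flipExpr (FlipQuantization.qpar n b t) x a
            ^ FlipQuantization.flipSign a) atTop
          (𝓝 (FlipQuantization.classicalFlip x a))) := by
  refine ⟨dense_commonDomain b, ?_, fun t => ⟨tendsto_qpar b t, fun x h0 h1 a =>
    tendsto_flipExpr (tendsto_qpar b t) h0 h1 a⟩⟩
  have hb0 : b ≠ 0 := fun h => by simp [h] at hb
  obtain ⟨V, hV1, hV⟩ := exists_unitary_dilogOp (N := N) hb hre him L
  have h0 := zPrime_zero (N := N) hb hre him hV
  have h2 := zPrime_two (N := N) hb hre him hV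
  refine ⟨V, hV1, fun t a => ⟨ker_conj_expOp b t V _, preserves_conj_expOp b t V _,
    preserves_conj_expOp_inverse b t V _⟩, fun t a c => ?_, fun a c => ?_,
    fun t => ⟨h0 t, h2 t⟩, fun t a => isUnit_expEnd b t _, ?_⟩
  · rw [← eps'_eq_symplectic (lift L t)]
    exact qCommuteOn_conj b V (expEnd_graph b t _) (expEnd_graph b t _) (expEnd_comm b t _ _)
  · refine qCommuteOn_conj b V (expEnd_graph b false _) (expEnd_graph b true _) ?_
    rw [one_smul]
    exact commute_expEnd false hb0 _ _
  · rintro ⟨μ₀, m₀, h⟩ t a f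
    -- Only the residue of `m₀` modulo `N` enters, through the discrete character.
    have hc : z3coeff L false = csym N b false μ₀ (m₀ : ZMod N) := by
      have e : z3coeff L false = exp (2 * Real.pi * I / N * (-I * b * μ₀ - m₀)) := h
      have e1 : ((sgn false : ZMod N) * m₀) = ((-m₀ : ℤ) : ZMod N) := by simp [sgn]
      rw [e, csym, e1, ZMod.stdAddChar_coe, ← Complex.exp_add]
      congr 1
      push_cast
      simp only [par, Bool.false_eq_true, if_false]
      linear_combination (-(2 * Real.pi * b * μ₀ / N) : ℂ) * I_mul_I
    exact flipExpr_mem_graph hb hre him hc hV h0 h2 t a f
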